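/- **Definitions.** A group $\Gamma$ acts on a compact metrizable space $M$ *as a convergence group* if it acts by homeomorphisms and every sequence of distinct elements of $\Gamma$ has a subsequence $(\gamma_n)$ for which there are points $\xi,\eta\in M$ (possibly equal) such that $\gamma_nK\to\xi$ uniformly for every compact $K\subseteq M\setminus\{\eta\}$. A subgroup $H$ of a group acting on $X$ is *parabolic* with parabolic point $\xi\in X$ if $H$ is infinite, no element of $H$ is loxodromic (of infinite order with exactly two fixed points in $X$), $H$ fixes $\xi$, and $\xi$ is the only point fixed by $H$. **Theorem.** Let $Y$ be a finite connected graph, and let a graph of groups over $Y$ be given, with countable vertex groups $G_v$ and edge groups $G_e$ embedded in the adjacent vertex groups. Suppose that each $G_v$ acts on a compact metrizable space $X_v$ as a convergence group, and that each $G_e$ is parabolic in each of the two adjacent vertex groups. Let $\Gamma$ be the fundamental group with respect to a maximal tree of $Y$, and let $T$ be the Bass–Serre tree. Then $\Gamma$ is a convergence group. More precisely, $\Gamma$ acts as a convergence group on the following compact metrizable space $M$, and the natural maps $X_v\to M$ are topological embeddings. *The set $M$.* Let $\Omega$ be the disjoint union, over the vertices $v$ of $T$, of the translates $X_v$ of the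 vertex spaces; thus $\Omega=\bigsqcup_{v\in V(Y)}\Gamma\times_{G_v}X_v$. For each edge $e$ of $T$ with vertices $v,w$, the (translated) parabolic point $x_{e,v}\in X_v$ of its stabilizer is identified with the parabolic point $x_{e,w}\in X_w$; let $\Omega/{\sim}$ be the quotient by the equivalence relation generated by this. The domain $D(x)$ of $x\in\Omega/{\sim}$ is the set of vertices $v$ of $T$ such that $x$ lies in the image of $X_v$. Then $M$ is the quotient of $\partial T\sqcup(\Omega/{\sim})$ in which, for each $x\in\Omega/{\sim}$, all boundary points of $D(x)$ in $\partial T$ are identified with $x$. Let $(\partial T)'\subseteq\partial T$ be the set of boundary points that lie in the boundary of no $D(x)$, so that $M=(\Omega/{\sim})\sqcup(\partial T)'$ as a set. *The topology of $M$.* For a vertex $v$ of $T$ and $U\subseteq X_v$, let $T_{v,U}$ be the set of vertices $w\ne v$ such that $x_{e,v}\in U$ for the first edge $e$ of $[v,w]$. The topology of $M$ is generated by the following sets. 1. For $x\in\Omega/{\sim}$ and open sets $U_v\subseteq X_v$ containing $x$, one for each $v\in D(x)$, with $U_v=X_v$ for all but finitely many $v$: the set of all points of $(\partial T)'\cap\bigcap_{v\in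 D(x)}\partial T_{v,U_v}$, all $y\in\Omega/{\sim}$ with $D(y)\cap D(x)=\emptyset$ and $D(y)\subseteq\bigcap_{v\in D(x)}T_{v,U_v}$, and all points of $\bigcup_{v\in D(x)}U_v$. 2. For $\xi\in(\partial T)'$, a base vertex $v_0$ and $m\in\mathbb N$, with $T_m(\xi)$ the set of vertices $w$ such that $[v_0,w]\cap[v_0,\xi)$ has length greater than $m$: the set of all $\zeta\in(\partial T)'\cap\partial T_m(\xi)$ and all $y\in\Omega/{\sim}$ with $D(y)\subseteq T_m(\xi)$. -/

import Mathlib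

open Set Filter Topology

/-! ### Convergence groups -/

/-- `Γ` acts on the compact metrizable space `M` (by homeomorphisms) as a convergence group: every
sequence of distinct elements of `Γ` has a subsequence `γ (σ n)` for which there are points `ξ`, `η`
of `M` (possibly equal) such that, for every compact `K ⊆ M \ {η}`, the sets `γ (σ n) • K` converge
uniformly to `ξ`. -/
structure IsConvergenceGroupOn (Γ : Type*) [Group Γ] (M : Type*) [TopologicalSpace M]
    [MulAction Γ M] : Prop where
  compact : CompactSpace M
  metrizable : TopologicalSpace.MetrizableSpace M
  continuous_smul : ∀ g : Γ, Continuous fun x : M => g • x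
  convergence : ∀ γ : ℕ → Γ, Function.Injective γ →
    ∃ σ : ℕ → ℕ, StrictMono σ ∧ ∃ ξ η : M, ∀ K : Set M, IsCompact K → K ⊆ {η}ᶜ →
      ∀ U ∈ 𝓝 ξ, ∀ᶠ n in atTop, ∀ x ∈ K, γ (σ n) • x ∈ U

/-- A loxodromic element: it has infinite order and exactly two fixed points. -/
def IsLoxodromic {G : Type*} [Group G] (X : Type*) [MulAction G X] (g : G) : Prop :=
  ¬ IsOfFinOrder g ∧ (MulAction.fixedBy X g).ncard = 2

/-- The subgroup `H` is parabolic with parabolic point `ξ`: it is infinite, contains no loxodromic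
element, and `ξ` is the unique point fixed by `H`. -/
structure IsParabolicAt {G : Type*} [Group G] {X : Type*} [MulAction G X] (H : Subgroup G)
    (ξ : X) : Prop where
  infinite : Infinite H
  not_loxodromic : ∀ h ∈ H, ¬ IsLoxodromic X h
  fixes : ∀ h ∈ H, h • ξ = ξ
  unique : ∀ x : X, (∀ h ∈ H, h • x = x) → x = ξ

/-! ### Graphs of groups and their fundamental groups -/

/-- A graph of groups. The underlying graph has vertex set `V` and edge set `E`, loops and multiple
edges being allowed; every edge is given an (arbitrary) orientation. Every edge group embeds in the
two adjacent vertex groups. -/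
structure GraphOfGroups (V E : Type*) where
  /-- origin of an edge -/
  src : E → V
  /-- terminus of an edge -/
  tgt : E → V
  /-- vertex groups -/
  G : V → Type*
  [groupG : ∀ v, Group (G v)]
  /-- edge groups -/
  A : E → Type*
  [groupA : ∀ e, Group (A e)]
  /-- inclusion of an edge group in the vertex group at the origin -/
  φ : ∀ e, A e →* G (src e)
  /-- inclusion of an edge group in the vertex group at the terminus -/
  ψ : ∀ e, A e →* G (tgt e)
  φ_injective : ∀ e, Function.Injective (φ e)
  ψ_injective : ∀ e, Function.Injective (ψ e)

namespace GraphOfGroups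

attribute [instance] groupG groupA

section Basic

variable {V E : Type*} (𝒢 : GraphOfGroups V E)

/-- The edges in `S` connect any two vertices of the underlying graph. -/
def Connects (S : Set E) : Prop :=
  ∀ v w : V, Relation.EqvGen (fun a b => ∃ e ∈ S, 𝒢.src e = a ∧ 𝒢.tgt e = b) v w

/-- `S` is the edge set of a maximal (i.e. spanning) tree of the underlying graph: it connects all
vertices and no edge can be omitted. Such an `S` exists, for finite graphs, exactly when the graph
is connected. -/
def IsMaximalTree (S : Set E) : Prop := Minimal 𝒢.Connects S

/-- The free product of the vertex groups and of a free group on the edges. -/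
abbrev FreeProd : Type _ := Monoid.Coprod (Monoid.CoprodI 𝒢.G) (FreeGroup E)

/-- A vertex group in the free product. -/
def vertexGen (v : V) : 𝒢.G v →* 𝒢.FreeProd := Monoid.Coprod.inl.comp Monoid.CoprodI.of

/-- The letter of an edge in the free product. -/
def edgeGen (e : E) : 𝒢.FreeProd := Monoid.Coprod.inr (FreeGroup.of e)

/-- The relators of the fundamental group: `tₑ ψₑ(a) tₑ⁻¹ = φₑ(a)` for every edge `e` and every `a`
in its edge group, and `tₑ = 1` for the edges of the maximal tree `S`. -/
def relators (S : Set E) : Set 𝒢.FreeProd :=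
  {r | ∃ (e : E) (a : 𝒢.A e), r = 𝒢.edgeGen e * 𝒢.vertexGen _ (𝒢.ψ e a) * (𝒢.edgeGen e)⁻¹ *
      (𝒢.vertexGen _ (𝒢.φ e a))⁻¹} ∪
    {r | ∃ e ∈ S, r = 𝒢.edgeGen e}

/-- The fundamental group of the graph of groups with respect to the maximal tree `S`. -/
def π₁ (S : Set E) : Type _ := 𝒢.FreeProd ⧸ Subgroup.normalClosure (𝒢.relators S)

variable (S : Set E)

instance : Group (𝒢.π₁ S) :=
  inferInstanceAs (Group (𝒢.FreeProd ⧸ Subgroup.normalClosure (𝒢.relators S)))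

/-- The projection from the free product. -/
def proj : 𝒢.FreeProd →* 𝒢.π₁ S := QuotientGroup.mk' (Subgroup.normalClosure (𝒢.relators S))

/-- The canonical map of a vertex group to the fundamental group. -/
def ι (v : V) : 𝒢.G v →* 𝒢.π₁ S := (𝒢.proj S).comp (𝒢.vertexGen v)

/-- The element of the fundamental group given by an edge. -/
def t (e : E) : 𝒢.π₁ S := 𝒢.proj S (𝒢.edgeGen e)

/-! ### The Bass-Serre tree -/

/-- The vertices of the Bass-Serre tree: the cosets of the vertex groups. -/
abbrev TreeVertex : Type _ := Σ v : V, 𝒢.π₁ S ⧸ (𝒢.ι S v).range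

/-- The vertex `g G_v` of the Bass-Serre tree. -/
def coset (v : V) (g : 𝒢.π₁ S) : 𝒢.TreeVertex S := ⟨v, QuotientGroup.mk g⟩

/-- The Bass-Serre tree: the edges are the translates, under the fundamental group, of the edges
that join `G_{src e}` to `tₑ G_{tgt e}`. -/
def tree : SimpleGraph (𝒢.TreeVertex S) :=
  SimpleGraph.fromRel fun a b =>
    ∃ (e : E) (g : 𝒢.π₁ S), a = 𝒢.coset S (𝒢.src e) g ∧ b = 𝒢.coset S (𝒢.tgt e) (g * 𝒢.t S e)

theorem smul_coset (v : V) (g h : 𝒢.π₁ S) : g • 𝒢.coset S v h = 𝒢.coset S v (g * h) := rfl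

theorem tree_adj_smul {a b : 𝒢.TreeVertex S} (g : 𝒢.π₁ S) (h : (𝒢.tree S).Adj a b) :
    (𝒢.tree S).Adj (g • a) (g • b) := by
  rw [tree, SimpleGraph.fromRel_adj] at h ⊢
  refine ⟨fun hab => h.1 (MulAction.injective g hab), ?_⟩
  rcases h.2 with ⟨e, k, rfl, rfl⟩ | ⟨e, k, rfl, rfl⟩
  · exact Or.inl ⟨e, g * k, rfl, by rw [smul_coset, mul_assoc]⟩
  · exact Or.inr ⟨e, g * k, rfl, by rw [smul_coset, mul_assoc]⟩

/-- The geodesic rays of the Bass-Serre tree: in a tree these are the infinite edge paths without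
repeated vertices. -/
def Ray : Type _ :=
  {r : ℕ → 𝒢.TreeVertex S // (∀ n, (𝒢.tree S).Adj (r n) (r (n + 1))) ∧ Function.Injective r}

/-- Two rays are asymptotic if they coincide from some vertices on. -/
def raySetoid : Setoid (𝒢.Ray S) where
  r a b := ∃ m n : ℕ, ∀ k, a.1 (m + k) = b.1 (n + k)
  iseqv :=
    { refl := fun _ => ⟨0, 0, fun _ => rfl⟩
      symm := fun ⟨m, n, h⟩ => ⟨n, m, fun k => (h k).symm⟩
      trans := by
        rintro a b c ⟨m, n, h⟩ ⟨p, q, h'⟩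
        refine ⟨m + p, q + n, fun k => ?_⟩
        rw [add_assoc, h, add_assoc q, ← h', ← add_assoc, ← add_assoc, add_comm n p] }

/-- The (visual) boundary `∂T` of the Bass-Serre tree. -/
def Boundary : Type _ := Quotient (𝒢.raySetoid S)

/-- The translate of a ray. -/
def smulRay (g : 𝒢.π₁ S) (r : 𝒢.Ray S) : 𝒢.Ray S :=
  ⟨fun n => g • r.1 n, fun n => 𝒢.tree_adj_smul S g (r.2.1 n),
    fun _ _ h => r.2.2 (MulAction.injective g h)⟩

instance : MulAction (𝒢.π₁ S) (𝒢.Boundary S) where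
  smul g := Quotient.map (𝒢.smulRay S g)
    (fun _ _ ⟨m, n, h⟩ => ⟨m, n, fun k => congrArg (g • ·) (h k)⟩)
  one_smul ξ := by
    induction ξ using Quotient.inductionOn with
    | h r => exact congrArg _ (Subtype.ext (funext fun n => one_smul _ (r.1 n)))
  mul_smul g h ξ := by
    induction ξ using Quotient.inductionOn with
    | h r => exact congrArg _ (Subtype.ext (funext fun n => mul_smul g h (r.1 n)))

/-- The boundary points of a set of vertices of the tree: the ends of the rays that lie in it. -/
def boundaryOf (D : Set (𝒢.TreeVertex S)) : Set (𝒢.Boundary S) :=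
  {ξ | ∃ r : 𝒢.Ray S, Quotient.mk _ r = ξ ∧ ∀ n, r.1 n ∈ D}

end Basic

/-! ### The space built from the vertex spaces -/

/-- Spaces on which the vertex groups act, and for each edge a point in each of the two adjacent
vertex spaces (these will be the parabolic points of the edge group). -/
structure VertexSpaces {V E : Type*} (𝒢 : GraphOfGroups V E) where
  /-- vertex spaces -/
  X : V → Type*
  [top : ∀ v, TopologicalSpace (X v)]
  [act : ∀ v, MulAction (𝒢.G v) (X v)]
  /-- the point of an edge in the space at its origin -/
  srcPt : ∀ e, X (𝒢.src e)
  /-- the point of an edge in the space at its terminus -/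
  tgtPt : ∀ e, X (𝒢.tgt e)

namespace VertexSpaces

attribute [instance] top act

variable {V E : Type*} {𝒢 : GraphOfGroups V E} (𝒳 : VertexSpaces 𝒢) (S : Set E)

/-- The relation on `Γ × X_v`: `(γ₁, x₁)` and `(γ₂, x₂)` are equivalent if `γ₂⁻¹ γ₁` is (the image
of) an element `h` of the vertex group and `h x₁ = x₂`. -/
def fibreSetoid (v : V) : Setoid (𝒢.π₁ S × 𝒳.X v) where
  r a b := ∃ h : 𝒢.G v, b.1⁻¹ * a.1 = 𝒢.ι S v h ∧ h • a.2 = b.2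
  iseqv :=
    { refl := fun a => ⟨1, by simp, one_smul _ _⟩
      symm := by
        rintro a b ⟨h, h1, h2⟩
        exact ⟨h⁻¹, by rw [map_inv, ← h1]; group, by rw [← h2, inv_smul_smul]⟩
      trans := by
        rintro a b c ⟨h, h1, h2⟩ ⟨k, k1, k2⟩
        exact ⟨k * h, by rw [map_mul, ← h1, ← k1]; group, by rw [mul_smul, h2, k2]⟩ }

/-- The disjoint union `Ω` of the translates of the vertex spaces. -/
def Omega : Type _ := Σ v : V, Quotient (𝒳.fibreSetoid S v)

/-- The point `γ x` of `Ω`, for `x` in the vertex space `X_v`. -/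
def pt (v : V) (g : 𝒢.π₁ S) (x : 𝒳.X v) : 𝒳.Omega S := ⟨v, Quotient.mk _ (g, x)⟩

/-- `Ω` is the topological disjoint union of the translates of the vertex spaces: a set is open if
its traces on all the translates are open. -/
instance : TopologicalSpace (𝒳.Omega S) :=
  ⨆ (v : V) (g : 𝒢.π₁ S), TopologicalSpace.coinduced (𝒳.pt S v g) inferInstance

/-- The vertex of the tree to which a point of `Ω` belongs. -/
def vert (x : 𝒳.Omega S) : 𝒢.TreeVertex S :=
  ⟨x.1, Quotient.lift (fun a : 𝒢.π₁ S × 𝒳.X x.1 => (QuotientGroup.mk a.1 : _ ⧸ (𝒢.ι S x.1).range))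
    (by
      rintro a b ⟨h, h1, -⟩
      exact ((QuotientGroup.eq (s := (𝒢.ι S x.1).range)).2 ⟨h, h1.symm⟩).symm) x.2⟩

/-- The compactum `X_v ⊆ Ω` of a vertex `v` of the tree. -/
def fibre (v : 𝒢.TreeVertex S) : Set (𝒳.Omega S) := {x | 𝒳.vert S x = v}

instance : MulAction (𝒢.π₁ S) (𝒳.Omega S) where
  smul g x := ⟨x.1, Quotient.map (fun a : 𝒢.π₁ S × 𝒳.X x.1 => (g * a.1, a.2))
    (by
      rintro a b ⟨h, h1, h2⟩
      exact ⟨h, by rw [← h1]; group, h2⟩) x.2⟩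
  one_smul := by
    rintro ⟨v, x⟩
    induction x using Quotient.inductionOn with
    | h a => exact congrArg (fun z => 𝒳.pt S v z a.2) (one_mul a.1)
  mul_smul g h := by
    rintro ⟨v, x⟩
    induction x using Quotient.inductionOn with
    | h a => exact congrArg (fun z => 𝒳.pt S v z a.2) (mul_assoc g h a.1)

theorem smul_pt (g h : 𝒢.π₁ S) (v : V) (x : 𝒳.X v) : g • 𝒳.pt S v h x = 𝒳.pt S v (g * h) x := rfl

theorem vert_smul (g : 𝒢.π₁ S) (x : 𝒳.Omega S) : 𝒳.vert S (g • x) = g • 𝒳.vert S x := by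
  obtain ⟨v, x⟩ := x
  induction x using Quotient.inductionOn with
  | h a => rfl

/-- `Glue x y`: there is an edge of the tree, a translate by `g` of the edge from `G_{src e}` to
`tₑ G_{tgt e}`, such that `x` and `y` are the images of its point in the compacta of its two
vertices. -/
def Glue (x y : 𝒳.Omega S) : Prop :=
  ∃ (e : E) (g : 𝒢.π₁ S), x = 𝒳.pt S (𝒢.src e) g (𝒳.srcPt e) ∧
    y = 𝒳.pt S (𝒢.tgt e) (g * 𝒢.t S e) (𝒳.tgtPt e)

/-- The quotient `Ω/∼` by the equivalence relation generated by the gluing along the edges. -/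
def OmegaQuot : Type _ := Quot (𝒳.Glue S)

/-- The projection from `Ω` to `Ω/∼`. -/
def toQuot (x : 𝒳.Omega S) : 𝒳.OmegaQuot S := Quot.mk _ x

theorem glue_smul (g : 𝒢.π₁ S) {x y : 𝒳.Omega S} (h : 𝒳.Glue S x y) :
    𝒳.Glue S (g • x) (g • y) := by
  obtain ⟨e, k, rfl, rfl⟩ := h
  exact ⟨e, g * k, rfl, by rw [smul_pt, mul_assoc]⟩

instance : MulAction (𝒢.π₁ S) (𝒳.OmegaQuot S) where
  smul g := Quot.map (g • ·) (fun _ _ h => 𝒳.glue_smul S g h)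
  one_smul := by
    rintro ⟨x⟩
    exact congrArg (𝒳.toQuot S) (one_smul _ x)
  mul_smul g h := by
    rintro ⟨x⟩
    exact congrArg (𝒳.toQuot S) (mul_smul g h x)

theorem smul_toQuot (g : 𝒢.π₁ S) (x : 𝒳.Omega S) :
    g • 𝒳.toQuot S x = 𝒳.toQuot S (g • x) := rfl

/-- The domain `D(x)` of a point of `Ω/∼`: the vertices whose compactum contains `x`. -/
def domain (x : 𝒳.OmegaQuot S) : Set (𝒢.TreeVertex S) :=
  {v | ∃ y ∈ 𝒳.fibre S v, 𝒳.toQuot S y = x}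

theorem smul_mem_domain (g : 𝒢.π₁ S) {x : 𝒳.OmegaQuot S} {v : 𝒢.TreeVertex S}
    (h : v ∈ 𝒳.domain S x) : g • v ∈ 𝒳.domain S (g • x) := by
  obtain ⟨y, hy, rfl⟩ := h
  refine ⟨g • y, ?_, rfl⟩
  show 𝒳.vert S (g • y) = g • v
  rw [vert_smul, show 𝒳.vert S y = v from hy]

/-- The identifications on `∂T ⊔ Ω/∼`: the boundary points of the domain `D(x)` are identified
with `x`. -/
def Ident : 𝒢.Boundary S ⊕ 𝒳.OmegaQuot S → 𝒢.Boundary S ⊕ 𝒳.OmegaQuot S → Prop :=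
  fun a b => ∃ (ξ : 𝒢.Boundary S) (x : 𝒳.OmegaQuot S),
    a = Sum.inl ξ ∧ b = Sum.inr x ∧ ξ ∈ 𝒢.boundaryOf S (𝒳.domain S x)

/-- The underlying set of the space `M`: the quotient of `∂T ⊔ Ω/∼` in which the boundary points of
the domain of each point `x` are identified with `x`. -/
def M : Type _ := Quot (𝒳.Ident S)

/-- The point of `M` given by a boundary point of the tree. -/
def ofEnd (ξ : 𝒢.Boundary S) : 𝒳.M S := Quot.mk _ (Sum.inl ξ)

/-- The point of `M` given by a point of `Ω/∼`. -/
def ofPt (x : 𝒳.OmegaQuot S) : 𝒳.M S := Quot.mk _ (Sum.inr x)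

/-- The canonical map of a vertex space to `M`. -/
def vertexMap (v : V) (x : 𝒳.X v) : 𝒳.M S := 𝒳.ofPt S (𝒳.toQuot S (𝒳.pt S v 1 x))

theorem ident_smul (g : 𝒢.π₁ S) {a b : 𝒢.Boundary S ⊕ 𝒳.OmegaQuot S} (h : 𝒳.Ident S a b) :
    𝒳.Ident S (Sum.map (g • ·) (g • ·) a) (Sum.map (g • ·) (g • ·) b) := by
  obtain ⟨ξ, x, rfl, rfl, r, rfl, hr⟩ := h
  exact ⟨_, _, rfl, rfl, 𝒢.smulRay S g r, rfl, fun n => 𝒳.smul_mem_domain S g (hr n)⟩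

/-- The action of the fundamental group on `M` induced by its actions on the tree and on `Ω`. -/
instance : MulAction (𝒢.π₁ S) (𝒳.M S) where
  smul g := Quot.map (Sum.map (g • ·) (g • ·)) (fun _ _ h => 𝒳.ident_smul S g h)
  one_smul := by
    rintro ⟨ξ | x⟩
    · exact congrArg (𝒳.ofEnd S) (one_smul _ ξ)
    · exact congrArg (𝒳.ofPt S) (one_smul _ x)
  mul_smul g h := by
    rintro ⟨ξ | x⟩
    · exact congrArg (𝒳.ofEnd S) (mul_smul g h ξ)
    · exact congrArg (𝒳.ofPt S) (mul_smul g h x)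

/-! ### The topology of the space -/

/-- `(∂T)'`: the boundary points of the tree that are not identified with a point of `Ω/∼`. -/
def FreeEnds : Set (𝒢.Boundary S) := {ξ | ∀ x, ξ ∉ 𝒢.boundaryOf S (𝒳.domain S x)}

/-- `T_{v,U}`, for a vertex `v` of the tree and a subset `U` of its compactum: the vertices `w ≠ v`
such that the point, in the compactum of `v`, of the first edge of `[v, w]` lies in `U`. Here `x` is
the point of this edge in the compactum of `v`, and `y` that in the compactum of its other vertex. -/
def branches (v : 𝒢.TreeVertex S) (U : Set (𝒳.Omega S)) : Set (𝒢.TreeVertex S) :=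
  {w | ∃ x y : 𝒳.Omega S, (𝒳.Glue S x y ∨ 𝒳.Glue S y x) ∧ 𝒳.vert S x = v ∧ x ∈ U ∧
    (𝒢.tree S).dist v w = (𝒢.tree S).dist (𝒳.vert S y) w + 1}

/-- The families `(U_v)`, `v ∈ D(x)`, that define neighbourhoods of a point `x` of `Ω/∼`: each `U_v`
is an open subset of the compactum of `v` that contains `x`, and all but finitely many `U_v` are the
whole compactum. (The values at the vertices outside `D(x)` are irrelevant.) -/
structure IsNhdFamily (x : 𝒳.OmegaQuot S) (U : 𝒢.TreeVertex S → Set (𝒳.Omega S)) : Prop where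
  subset : ∀ v ∈ 𝒳.domain S x, U v ⊆ 𝒳.fibre S v
  isOpen : ∀ v ∈ 𝒳.domain S x, IsOpen (U v)
  mem : ∀ v ∈ 𝒳.domain S x, x ∈ 𝒳.toQuot S '' U v
  finite : {v ∈ 𝒳.domain S x | U v ≠ 𝒳.fibre S v}.Finite

/-- The basic neighbourhood `W_{(U_v)}(x)` of a point `x` of `Ω/∼`. It is the union of
* the points of `(∂T)'` that are boundary points of all the `T_{v,U_v}`, `v ∈ D(x)`;
* the points `y` of `Ω/∼` outside all the compacta `X_v`, `v ∈ D(x)`, whose domain lies in all the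
  `T_{v,U_v}`, `v ∈ D(x)`;
* the sets `U_v`, `v ∈ D(x)`. -/
def nhdPt (x : 𝒳.OmegaQuot S) (U : 𝒢.TreeVertex S → Set (𝒳.Omega S)) : Set (𝒳.M S) :=
  𝒳.ofEnd S '' {ξ | ξ ∈ 𝒳.FreeEnds S ∧
      ∀ v ∈ 𝒳.domain S x, ξ ∈ 𝒢.boundaryOf S (𝒳.branches S v (U v))} ∪
    𝒳.ofPt S '' {y | Disjoint (𝒳.domain S y) (𝒳.domain S x) ∧
      ∀ v ∈ 𝒳.domain S x, 𝒳.domain S y ⊆ 𝒳.branches S v (U v)} ∪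
    𝒳.ofPt S '' {y | ∃ v ∈ 𝒳.domain S x, y ∈ 𝒳.toQuot S '' U v}

/-- `T_m(ξ)` for the end `ξ` of the ray `r`, with base point the origin of `r`: the vertices `w`
such that the common part of `r` and of the segment from the origin of `r` to `w` has length more
than `m`. -/
def rayTail (r : 𝒢.Ray S) (m : ℕ) : Set (𝒢.TreeVertex S) :=
  {w | (𝒢.tree S).dist (r.1 0) w = (m + 1) + (𝒢.tree S).dist (r.1 (m + 1)) w}

/-- The basic neighbourhood `W_m(ξ)` of the end `ξ` of the ray `r`: the points of `M` whose domain
lies in `T_m(ξ)`. -/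
def nhdEnd (r : 𝒢.Ray S) (m : ℕ) : Set (𝒳.M S) :=
  𝒳.ofEnd S '' {ζ | ζ ∈ 𝒳.FreeEnds S ∧ ζ ∈ 𝒢.boundaryOf S (rayTail S r m)} ∪
    𝒳.ofPt S '' {y | 𝒳.domain S y ⊆ rayTail S r m}

/-- The topology of `M` is generated by the sets `W_{(U_v)}(x)`, `x ∈ Ω/∼`, and `W_m(ξ)`,
`ξ ∈ (∂T)'`, for all base points. -/
instance : TopologicalSpace (𝒳.M S) :=
  TopologicalSpace.generateFrom
    ({W | ∃ x U, 𝒳.IsNhdFamily S x U ∧ W = 𝒳.nhdPt S x U} ∪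
      {W | ∃ (r : 𝒢.Ray S) (m : ℕ), Quotient.mk (𝒢.raySetoid S) r ∈ 𝒳.FreeEnds S ∧
        W = 𝒳.nhdEnd S r m})

end VertexSpaces

end GraphOfGroups

/-! The idea is to see `M` through its projections to the compacta of the vertices of `T`. A point
projects to `X_t` as itself if it lies there, and otherwise as the point of the first edge leading
from `t` towards it (`dirPt`). These projections form an injective map `coords` from `M` to the
product of copies of `Ω` indexed by the vertices. By `coords_coherent` and `exists_coords_eq`, its
image consists of the coherent families: for `v ≠ w`, the coordinate at `v` points to `w` or the
coordinate at `w` points to `v`. This is a closed condition on pairs of coordinates, and the given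
topology is the one induced by `coords` (`isEmbedding_coords`). Hence `M` is compact and metrizable,
and since `coords` is equivariant, all dynamics can be checked on coordinates.

For a sequence of distinct elements there are two cases. If it moves every vertex to infinity,
coherence alone gives a collapsing subsequence (`exists_collapses_of_far`): the attracting and
repelling points are limits of the images of a base point under the elements and under their
inverses. Otherwise a subsequence maps one vertex to a fixed vertex, and after a translation it lies
in a vertex stabilizer. A subsequence then collapses the compactum of that vertex, and
`collapses_of_collapsesFibre` extends this to `M`. Two facts about parabolic points are needed: they
are not conical limit points (`tendsto_of_parabolic`), and distinct elements of a parabolic group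
collapse the space to its parabolic point (`collapses_of_parabolic`).

The Bass-Serre theory is derived from the presentation by constructing actions: permutations of `ℕ`
show that the vertex groups embed, and an affine action on integral functions of the edges yields a
cocycle that makes every edge a bridge. -/

namespace GraphOfGroups

/-! ### The presentation of the fundamental group -/

section Presentation

variable {V E : Type*} {𝒢 : GraphOfGroups V E} {S : Set E}

/-- Labels of the edges of a maximal tree by elements of a group come from a potential. -/
theorem IsMaximalTree.exists_potential [Finite E] (hS : 𝒢.IsMaximalTree S) {H : Type*} [Group H]
    (τ : E → H) : ∃ c : V → H, ∀ e ∈ S, c (𝒢.src e) * τ e = c (𝒢.tgt e) := by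
  classical
  have key : ∀ F : Finset E, (F : Set E) ⊆ S →
      ∃ c : V → H, ∀ e ∈ F, c (𝒢.src e) * τ e = c (𝒢.tgt e) := by
    intro F
    induction F using Finset.induction_on with
    | empty => exact fun _ => ⟨fun _ => 1, by simp⟩
    | insert e F he ih =>
      intro hF
      obtain ⟨c, hc⟩ := ih fun x hx => hF (Finset.mem_insert_of_mem hx)
      have heS : e ∈ S := hF (Finset.mem_insert_self e F)
      set R := Relation.EqvGen (fun a b => ∃ e ∈ F, 𝒢.src e = a ∧ 𝒢.tgt e = b) with hR
      -- If `F` already joined the ends of `e`, then `S` without `e` would still connect all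
      -- vertices, against minimality.
      have hne : ¬ R (𝒢.tgt e) (𝒢.src e) := by
        intro h
        have hmono : ∀ a b, R a b →
            Relation.EqvGen (fun a b => ∃ e' ∈ S \ {e}, 𝒢.src e' = a ∧ 𝒢.tgt e' = b) a b := by
          intro a b hab
          refine Relation.EqvGen.mono ?_ _ _ hab
          rintro a b ⟨e', he', h1, h2⟩
          refine ⟨e', ⟨hF (Finset.mem_insert_of_mem he'), ?_⟩, h1, h2⟩
          rintro rfl
          exact he he'
        have hcon : 𝒢.Connects (S \ {e}) := by
          intro v w
          induction hS.1 v w with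
          | rel a b hab =>
            obtain ⟨e', he', rfl, rfl⟩ := hab
            by_cases hee : e' = e
            · subst hee
              exact (hmono _ _ h).symm
            · exact .rel _ _ ⟨e', ⟨he', hee⟩, rfl, rfl⟩
          | refl a => exact .refl a
          | symm a b _ ih => exact ih.symm
          | trans a b c _ _ ih1 ih2 => exact ih1.trans _ _ _ ih2
        exact (hS.2 hcon sdiff_subset heS).2 rfl
      -- A constant left factor on one whole component of `F` preserves the equations for the edges
      -- of `F`; it is chosen to satisfy the equation for `e`.
      refine ⟨fun w => if R (𝒢.tgt e) w then c (𝒢.src e) * τ e * (c (𝒢.tgt e))⁻¹ * c w else c w, ?_⟩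
      intro e' he'
      rcases Finset.mem_insert.1 he' with rfl | he'
      · have h1 : R (𝒢.tgt e') (𝒢.tgt e') := .refl _
        simp [hne, h1]
      · have h1 : R (𝒢.src e') (𝒢.tgt e') := .rel _ _ ⟨e', he', rfl, rfl⟩
        have h2 : R (𝒢.tgt e) (𝒢.src e') ↔ R (𝒢.tgt e) (𝒢.tgt e') :=
          ⟨fun h => h.trans _ _ _ h1, fun h => h.trans _ _ _ h1.symm⟩
        simp only [h2]
        split_ifs
        · rw [mul_assoc, hc e' he']
        · exact hc e' he'
  obtain ⟨c, hc⟩ := key S.toFinite.toFinset (by simp)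
  exact ⟨c, fun e he => hc e (by simpa using he)⟩

variable (𝒢 S)

theorem t_eq_one {e : E} (he : e ∈ S) : 𝒢.t S e = 1 :=
  (QuotientGroup.eq_one_iff _).2 (Subgroup.subset_normalClosure (Or.inr ⟨e, he, rfl⟩))

theorem t_mul_ι (e : E) (a : 𝒢.A e) :
    𝒢.t S e * 𝒢.ι S _ (𝒢.ψ e a) = 𝒢.ι S _ (𝒢.φ e a) * 𝒢.t S e := by
  have h : 𝒢.proj S (𝒢.edgeGen e * 𝒢.vertexGen _ (𝒢.ψ e a) * (𝒢.edgeGen e)⁻¹ *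
      (𝒢.vertexGen _ (𝒢.φ e a))⁻¹) = 1 :=
    (QuotientGroup.eq_one_iff _).2 (Subgroup.subset_normalClosure (Or.inl ⟨e, a, rfl⟩))
  simp only [map_mul, map_inv] at h
  rw [mul_inv_eq_one, mul_inv_eq_iff_eq_mul] at h
  exact h

/-- The universal property of the fundamental group. -/
theorem exists_hom {H : Type*} [Group H] (f : ∀ v, 𝒢.G v →* H) (τ : E → H)
    (h₁ : ∀ e a, τ e * f _ (𝒢.ψ e a) = f _ (𝒢.φ e a) * τ e) (h₂ : ∀ e ∈ S, τ e = 1) :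
    ∃ Θ : 𝒢.π₁ S →* H, (∀ v g, Θ (𝒢.ι S v g) = f v g) ∧ ∀ e, Θ (𝒢.t S e) = τ e := by
  let Θ₀ : 𝒢.FreeProd →* H := Monoid.Coprod.lift (Monoid.CoprodI.lift f) (FreeGroup.lift τ)
  have hv : ∀ v g, Θ₀ (𝒢.vertexGen v g) = f v g := fun v g => by simp [Θ₀, vertexGen]
  have he : ∀ e, Θ₀ (𝒢.edgeGen e) = τ e := fun e => by simp [Θ₀, edgeGen]
  have hk : Subgroup.normalClosure (𝒢.relators S) ≤ Θ₀.ker := by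
    refine Subgroup.normalClosure_le_normal ?_
    rintro r (⟨e, a, rfl⟩ | ⟨e, heS, rfl⟩)
    · simp [MonoidHom.mem_ker, hv, he, h₁]
    · simp [MonoidHom.mem_ker, he, h₂ e heS]
  exact ⟨QuotientGroup.lift _ Θ₀ hk, hv, he⟩

/-- The fundamental group is generated by the vertex groups and the edge letters. -/
theorem eq_top_of_generators (K : Subgroup (𝒢.π₁ S)) (h₁ : ∀ v g, 𝒢.ι S v g ∈ K)
    (h₂ : ∀ e, 𝒢.t S e ∈ K) : K = ⊤ := by
  have h : K.comap (𝒢.proj S) = ⊤ := by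
    rw [eq_top_iff, ← Monoid.Coprod.range_inl_sup_range_inr, sup_le_iff]
    constructor
    · rintro _ ⟨x, rfl⟩
      induction x using Monoid.CoprodI.induction_on with
      | one => simp
      | of v g => exact h₁ v g
      | mul x y hx hy => rw [map_mul]; exact mul_mem hx hy
    · rintro _ ⟨x, rfl⟩
      induction x using FreeGroup.induction_on with
      | C1 => simp
      | of e => exact h₂ e
      | inv_of e h => rw [map_inv]; exact inv_mem h
      | mul x y hx hy => rw [map_mul]; exact mul_mem hx hy
  rw [eq_top_iff]
  intro g _
  obtain ⟨x, rfl⟩ := QuotientGroup.mk'_surjective _ g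
  have : x ∈ K.comap (𝒢.proj S) := h ▸ Subgroup.mem_top x
  exact this

instance [Countable V] [Countable E] [∀ v, Countable (𝒢.G v)] : Countable (𝒢.π₁ S) := by
  let L := (Σ v, 𝒢.G v) ⊕ E
  let f : FreeGroup L →* 𝒢.π₁ S :=
    FreeGroup.lift (Sum.elim (fun x => 𝒢.ι S x.1 x.2) (fun e => 𝒢.t S e))
  have hf : f.range = ⊤ := 𝒢.eq_top_of_generators S _
    (fun v g => ⟨FreeGroup.of (Sum.inl ⟨v, g⟩), by simp [f]⟩)
    (fun e => ⟨FreeGroup.of (Sum.inr e), by simp [f]⟩)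
  exact Function.Surjective.countable (MonoidHom.range_eq_top.1 hf)

end Presentation

/-! ### Embedding of the vertex groups -/

section Embedding

/-- Right translations by a subgroup on `G × ℕ`, for a countable group `G`, are isomorphic to right
translations on `A × ℕ`. -/
theorem exists_equiv_prod_nat {A G : Type*} [Group A] [Group G] [Countable G] (f : A →* G)
    (hf : Function.Injective f) : ∃ u : A × ℕ ≃ G × ℕ, ∀ a n b,
      u (a * b, n) = ((u (a, n)).1 * f b, (u (a, n)).2) := by
  have : Countable (G ⧸ f.range) := Quotient.countable
  -- The orbits of the image of `A` on `G × ℕ` are free and indexed by the cosets times `ℕ`. The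
  -- factor `ℕ` makes this index set countably infinite whatever the index of the image.
  obtain ⟨w⟩ : Nonempty (ℕ ≃ (G ⧸ f.range) × ℕ) := nonempty_equiv_of_countable
  let u : A × ℕ → G × ℕ := fun x => ((w x.2).1.out * f x.1, (w x.2).2)
  have hmk : ∀ x : A × ℕ, (QuotientGroup.mk (u x).1 : G ⧸ f.range) = (w x.2).1 := by
    intro x
    rw [QuotientGroup.mk_mul_of_mem _ (MonoidHom.mem_range.2 ⟨x.1, rfl⟩), QuotientGroup.out_eq']
  have hu : Function.Bijective u := by
    constructor
    · intro x y hxy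
      have h1 : (w x.2).1 = (w y.2).1 := by rw [← hmk, ← hmk, hxy]
      have h2 : x.2 = y.2 := w.injective (Prod.ext h1 (congrArg Prod.snd hxy :))
      have h3 := congrArg Prod.fst hxy
      simp only [u, h2, mul_right_inj] at h3
      exact Prod.ext (hf h3) h2
    · rintro ⟨g, k⟩
      obtain ⟨a, ha⟩ : (QuotientGroup.mk g : G ⧸ f.range).out⁻¹ * g ∈ f.range :=
        QuotientGroup.eq.1 (QuotientGroup.out_eq' _)
      refine ⟨(a, w.symm (QuotientGroup.mk g, k)), ?_⟩
      simp [u, ha]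
  exact ⟨Equiv.ofBijective u hu, fun a n b => by simp [u, mul_assoc]⟩

/-- The action of a group `G` on `G × ℕ` by right translations. -/
def rightTranslation (G : Type*) [Group G] : G →* Equiv.Perm (G × ℕ) where
  toFun g := Equiv.prodCongr (Equiv.mulRight g⁻¹) (Equiv.refl ℕ)
  map_one' := by ext <;> simp
  map_mul' g h := by ext <;> simp [mul_assoc]

variable {V E : Type*} {𝒢 : GraphOfGroups V E} {S : Set E}

/-- The vertex groups embed in the fundamental group. -/
theorem IsMaximalTree.ι_injective [Finite E] [∀ v, Countable (𝒢.G v)] (hS : 𝒢.IsMaximalTree S)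
    (v : V) : Function.Injective (𝒢.ι S v) := by
  have hu : ∀ v, Nonempty (𝒢.G v × ℕ ≃ ℕ) := fun v => nonempty_equiv_of_countable
  let u := fun v => (hu v).some
  choose p hp using fun e => exists_equiv_prod_nat (𝒢.φ e) (𝒢.φ_injective e)
  choose q hq using fun e => exists_equiv_prod_nat (𝒢.ψ e) (𝒢.ψ_injective e)
  -- The two actions of an edge group, through `ψ` and through `φ`, are both isomorphic to `A e ×
  -- ℕ`; `τ e` intertwines them after transport to the common set `ℕ`.
  let τ : E → Equiv.Perm ℕ := fun e => (u (𝒢.tgt e)).symm.trans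
    ((q e).symm.trans ((p e).trans (u (𝒢.src e))))
  obtain ⟨c, hc⟩ := hS.exists_potential τ
  let ρ : ∀ v, 𝒢.G v →* Equiv.Perm ℕ := fun v =>
    (u v).permCongrHom.toMonoidHom.comp (rightTranslation (𝒢.G v))
  have hτ : ∀ e a, τ e * ρ _ (𝒢.ψ e a) = ρ _ (𝒢.φ e a) * τ e := by
    intro e a
    ext n
    obtain ⟨x, rfl⟩ := (u (𝒢.tgt e)).surjective n
    obtain ⟨⟨b, k⟩, rfl⟩ := (q e).surjective x
    have h1 := hq e b k a⁻¹
    have h2 := hp e b k a⁻¹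
    simp only [map_inv] at h1 h2
    simp [τ, ρ, rightTranslation, Equiv.permCongr_apply]
    simp [Prod.map, ← h1, ← h2]
  -- Conjugating the actions by the potential `c` makes the edge letters of the maximal tree
  -- trivial.
  obtain ⟨Θ, hΘ, -⟩ := 𝒢.exists_hom S
    (fun v => (MulAut.conj (c v)).toMonoidHom.comp (ρ v))
    (fun e => c (𝒢.src e) * τ e * (c (𝒢.tgt e))⁻¹)
    (fun e a => by
      have := hτ e a
      simp only [MonoidHom.comp_apply, MulEquiv.toMonoidHom_eq_coe, MonoidHom.coe_coe,
        MulAut.conj_apply]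
      calc _ = c (𝒢.src e) * (τ e * ρ _ (𝒢.ψ e a)) * (c (𝒢.tgt e))⁻¹ := by group
        _ = _ := by rw [this]; group)
    (fun e he => by rw [hc e he, mul_inv_cancel])
  intro g h hgh
  have h1 := congrArg Θ hgh
  rw [hΘ, hΘ] at h1
  -- Right translation is free, so the image of `(1, 0)` determines the group element.
  have h2 := congrArg (fun f => ((u v).symm (f (u v (1, 0)))).1)
    ((MulAut.conj (c v)).injective h1)
  simpa [ρ, rightTranslation, Equiv.permCongr_apply] using h2

end Embedding

end GraphOfGroups

namespace GraphOfGroups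

/-! ### The Bass-Serre graph is a tree -/

section AffineShift

variable {Γ α : Type*} [Group Γ] [MulAction Γ α]

/-- The affine permutation of `α → ℤ` with linear part `g` that maps `n` to `m`. -/
def affineShift (g : Γ) (n m : α → ℤ) : Equiv.Perm (α → ℤ) where
  toFun x a := x (g⁻¹ • a) - n (g⁻¹ • a) + m a
  invFun x a := x (g • a) - m (g • a) + n a
  left_inv x := by ext; simp
  right_inv x := by ext; simp

theorem affineShift_apply (g : Γ) (n m x : α → ℤ) (a : α) :
    affineShift g n m x a = x (g⁻¹ • a) - n (g⁻¹ • a) + m a := rfl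

theorem affineShift_self (g : Γ) (n m : α → ℤ) : affineShift g n m n = m := by
  ext; simp [affineShift_apply]

theorem affineShift_mul (g h : Γ) (n m l : α → ℤ) :
    affineShift g m l * affineShift h n m = affineShift (g * h) n l := by
  ext x a
  simp [affineShift_apply, mul_smul]

end AffineShift

variable {V E : Type*} {𝒢 : GraphOfGroups V E} {S : Set E}

variable (𝒢 S) in
/-- The oriented edges of the Bass-Serre tree. -/
abbrev TreeEdge : Type _ := Σ e : E, 𝒢.π₁ S ⧸ ((𝒢.ι S (𝒢.src e)).comp (𝒢.φ e)).range

variable (𝒢 S) in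
/-- The translate by `g` of the edge of the Bass-Serre tree given by `e`. -/
def edgeCoset (e : E) (g : 𝒢.π₁ S) : 𝒢.TreeEdge S := ⟨e, QuotientGroup.mk g⟩

theorem smul_edgeCoset (e : E) (g h : 𝒢.π₁ S) :
    g • 𝒢.edgeCoset S e h = 𝒢.edgeCoset S e (g * h) := rfl

theorem edgeCoset_mul (e : E) (g : 𝒢.π₁ S) (a : 𝒢.A e) :
    𝒢.edgeCoset S e (g * 𝒢.ι S _ (𝒢.φ e a)) = 𝒢.edgeCoset S e g := by
  refine congrArg (Sigma.mk e) (QuotientGroup.eq.2 ⟨a⁻¹, ?_⟩)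
  simp

theorem edgeCoset_eq {e : E} {g h : 𝒢.π₁ S} (hgh : 𝒢.edgeCoset S e g = 𝒢.edgeCoset S e h) :
    ∃ a : 𝒢.A e, h = g * 𝒢.ι S _ (𝒢.φ e a) := by
  obtain ⟨a, ha⟩ := QuotientGroup.eq.1 (eq_of_heq (Sigma.mk.inj hgh).2)
  exact ⟨a, by rw [← MonoidHom.comp_apply, ha, mul_inv_cancel_left]⟩

theorem coset_mul (v : V) (g : 𝒢.π₁ S) (h : 𝒢.G v) :
    𝒢.coset S v (g * 𝒢.ι S v h) = 𝒢.coset S v g := by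
  unfold coset
  rw [QuotientGroup.mk_mul_of_mem _ (MonoidHom.mem_range.2 ⟨h, rfl⟩)]

theorem coset_eq_iff {v : V} {g h : 𝒢.π₁ S} :
    𝒢.coset S v g = 𝒢.coset S v h ↔ ∃ a : 𝒢.G v, h = g * 𝒢.ι S v a := by
  constructor
  · intro hgh
    obtain ⟨a, ha⟩ := QuotientGroup.eq.1 (eq_of_heq (Sigma.mk.inj hgh).2)
    exact ⟨a, by rw [ha, mul_inv_cancel_left]⟩
  · rintro ⟨a, rfl⟩
    exact (coset_mul v g a).symm

theorem exists_coset (v : 𝒢.TreeVertex S) : ∃ g, v = 𝒢.coset S v.1 g := by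
  obtain ⟨v, x⟩ := v
  obtain ⟨g, rfl⟩ := QuotientGroup.mk_surjective x
  exact ⟨g, rfl⟩

/-- A cocycle: an integral function of the oriented edges at each vertex of the Bass-Serre tree,
that changes along every edge by the indicator function of this edge. -/
theorem IsMaximalTree.exists_cocycle [Finite E] (hS : 𝒢.IsMaximalTree S) :
    ∃ D : 𝒢.TreeVertex S → 𝒢.TreeEdge S → ℤ, ∀ (e : E) (g : 𝒢.π₁ S) (ε : 𝒢.TreeEdge S),
      (ε = 𝒢.edgeCoset S e g →
        D (𝒢.coset S (𝒢.tgt e) (g * 𝒢.t S e)) ε = D (𝒢.coset S (𝒢.src e) g) ε + 1) ∧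
      (ε ≠ 𝒢.edgeCoset S e g →
        D (𝒢.coset S (𝒢.tgt e) (g * 𝒢.t S e)) ε = D (𝒢.coset S (𝒢.src e) g) ε) := by
  classical
  let δ : E → 𝒢.TreeEdge S → ℤ := fun e => Pi.single (𝒢.edgeCoset S e 1) 1
  have hδ : ∀ e (g : 𝒢.π₁ S) ε, δ e (g⁻¹ • ε) = if ε = 𝒢.edgeCoset S e g then 1 else 0 := by
    intro e g ε
    simp [δ, Pi.single_apply, inv_smul_eq_iff, smul_edgeCoset]
  -- `N v` will be the value of the cocycle at the base vertex of `v`. As the letters of `S` are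
  -- trivial, the values must differ by `δ e` along the edges of `S`.
  obtain ⟨n, hn⟩ := hS.exists_potential (H := Multiplicative (𝒢.TreeEdge S → ℤ))
    (fun e => Multiplicative.ofAdd (δ e))
  replace hn : ∀ e ∈ S, (n (𝒢.src e)).toAdd + δ e = (n (𝒢.tgt e)).toAdd := hn
  generalize hN : (fun v => (n v).toAdd) = N at hn
  replace hn : ∀ e ∈ S, N (𝒢.src e) + δ e = N (𝒢.tgt e) := by subst hN; exact hn
  let f : ∀ v, 𝒢.G v →* Equiv.Perm (𝒢.TreeEdge S → ℤ) := fun v =>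
    { toFun := fun g => affineShift (𝒢.ι S v g) (N v) (N v)
      map_one' := by ext; simp [affineShift_apply]
      map_mul' := fun g h => by rw [affineShift_mul, map_mul] }
  have hf : ∀ v g, f v g = affineShift (𝒢.ι S v g) (N v) (N v) := fun _ _ => rfl
  -- The edge group fixes its edge, hence also `δ e`, so that `N (src e) + δ e` is a fixed point as
  -- well as `N (src e)`. This is what the relator of `e` requires.
  have hφ : ∀ e a, f _ (𝒢.φ e a) =
      affineShift (𝒢.ι S _ (𝒢.φ e a)) (N (𝒢.src e) + δ e) (N (𝒢.src e) + δ e) := by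
    intro e a
    ext x ε
    have h1 := hδ e (𝒢.ι S _ (𝒢.φ e a)) ε
    have h2 := hδ e 1 ε
    rw [← one_mul (𝒢.ι S _ (𝒢.φ e a)), edgeCoset_mul, one_mul] at h1
    rw [inv_one, one_smul] at h2
    rw [hf, affineShift_apply, affineShift_apply, Pi.add_apply, Pi.add_apply, h1, h2]
    ring
  obtain ⟨Θ, hΘ, hΘt⟩ := 𝒢.exists_hom S f
    (fun e => affineShift (𝒢.t S e) (N (𝒢.tgt e)) (N (𝒢.src e) + δ e))
    (fun e a => by rw [hφ, hf, affineShift_mul, affineShift_mul, t_mul_ι])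
    (fun e he => by
      ext x ε
      simp [affineShift_apply, 𝒢.t_eq_one S he, hn e he])
  -- The linear part of `Θ g` is translation by `g`.
  have hlin : ∀ g x y, Θ g (x + y) = Θ g x + fun ε => y (g⁻¹ • ε) := by
    intro g
    have htop := 𝒢.eq_top_of_generators S
      { carrier := {g | ∀ x y, Θ g (x + y) = Θ g x + fun ε => y (g⁻¹ • ε)}
        one_mem' := by intro x y; simp
        mul_mem' := by
          intro g h hg hh x y
          rw [map_mul, Equiv.Perm.mul_apply, hh, hg]
          simp [mul_smul]
        inv_mem' := by
          intro g hg x y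
          rw [map_inv, Equiv.Perm.inv_eq_iff_eq, hg]
          ext ε
          simp } ?_ ?_
    · have := Subgroup.mem_top g
      rw [← htop] at this
      exact this
    · intro v g x y
      ext ε
      simp only [hΘ, hf, affineShift_apply, Pi.add_apply]
      ring
    · intro e x y
      ext ε
      simp only [hΘt, affineShift_apply, Pi.add_apply]
      ring
  -- The cocycle is the orbit map of the points `N v`, which is well defined on cosets because the
  -- vertex group fixes `N v`.
  refine ⟨fun v => Quotient.lift (fun g => Θ g (N v.1)) ?_ v.2, ?_⟩
  · intro g h hgh
    obtain ⟨a, ha⟩ := QuotientGroup.leftRel_apply.1 hgh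
    rw [eq_inv_mul_iff_mul_eq] at ha
    rw [← ha, map_mul, Equiv.Perm.mul_apply, hΘ, hf, affineShift_self]
  · intro e g ε
    show (_ → Θ (g * 𝒢.t S e) (N (𝒢.tgt e)) ε = Θ g (N (𝒢.src e)) ε + 1) ∧
      (_ → Θ (g * 𝒢.t S e) (N (𝒢.tgt e)) ε = Θ g (N (𝒢.src e)) ε)
    rw [map_mul, Equiv.Perm.mul_apply, hΘt, affineShift_self, hlin, Pi.add_apply, hδ]
    constructor <;> intro h <;> simp [h]

/-- An edge of the Bass-Serre tree is determined, with its orientation, by its vertices. -/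
theorem IsMaximalTree.edge_unique [Finite E] (hS : 𝒢.IsMaximalTree S) {e e' : E}
    {g g' : 𝒢.π₁ S}
    (h : (𝒢.coset S (𝒢.src e) g = 𝒢.coset S (𝒢.src e') g' ∧
        𝒢.coset S (𝒢.tgt e) (g * 𝒢.t S e) = 𝒢.coset S (𝒢.tgt e') (g' * 𝒢.t S e')) ∨
      (𝒢.coset S (𝒢.src e) g = 𝒢.coset S (𝒢.tgt e') (g' * 𝒢.t S e') ∧
        𝒢.coset S (𝒢.tgt e) (g * 𝒢.t S e) = 𝒢.coset S (𝒢.src e') g')) :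
    𝒢.edgeCoset S e g = 𝒢.edgeCoset S e' g' ∧
      𝒢.coset S (𝒢.src e) g = 𝒢.coset S (𝒢.src e') g' := by
  obtain ⟨D, hD⟩ := hS.exists_cocycle
  have h1 := (hD e g _).1 rfl
  by_cases hee : 𝒢.edgeCoset S e g = 𝒢.edgeCoset S e' g'
  · refine ⟨hee, ?_⟩
    rcases h with h | ⟨h2, h3⟩
    · exact h.1
    · have h4 := (hD e' g' _).1 hee
      rw [h2, h3] at h1
      omega
  · have h4 := (hD e' g' _).2 hee
    rcases h with ⟨h2, h3⟩ | ⟨h2, h3⟩ <;> rw [h2, h3] at h1 <;> omega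

theorem IsMaximalTree.src_ne_tgt [Finite E] (hS : 𝒢.IsMaximalTree S) (e : E) (g : 𝒢.π₁ S) :
    𝒢.coset S (𝒢.src e) g ≠ 𝒢.coset S (𝒢.tgt e) (g * 𝒢.t S e) := by
  obtain ⟨D, hD⟩ := hS.exists_cocycle
  intro h
  have h1 := (hD e g _).1 rfl
  rw [h] at h1
  omega

theorem IsMaximalTree.tree_adj_iff [Finite E] (hS : 𝒢.IsMaximalTree S) {a b : 𝒢.TreeVertex S} :
    (𝒢.tree S).Adj a b ↔ ∃ (e : E) (g : 𝒢.π₁ S),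
      (a = 𝒢.coset S (𝒢.src e) g ∧ b = 𝒢.coset S (𝒢.tgt e) (g * 𝒢.t S e)) ∨
      (b = 𝒢.coset S (𝒢.src e) g ∧ a = 𝒢.coset S (𝒢.tgt e) (g * 𝒢.t S e)) := by
  rw [tree, SimpleGraph.fromRel_adj]
  constructor
  · rintro ⟨-, ⟨e, g, h⟩ | ⟨e, g, h⟩⟩
    · exact ⟨e, g, Or.inl h⟩
    · exact ⟨e, g, Or.inr h⟩
  · rintro ⟨e, g, ⟨rfl, rfl⟩ | ⟨rfl, rfl⟩⟩
    · exact ⟨hS.src_ne_tgt e g, Or.inl ⟨e, g, rfl, rfl⟩⟩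
    · exact ⟨(hS.src_ne_tgt e g).symm, Or.inr ⟨e, g, rfl, rfl⟩⟩

/-- Every edge is a bridge: the component of the cocycle at this edge is constant along walks that
avoid the edge, but differs by 1 at its two ends. -/
theorem IsMaximalTree.tree_isAcyclic [Finite E] (hS : 𝒢.IsMaximalTree S) :
    (𝒢.tree S).IsAcyclic := by
  obtain ⟨D, hD⟩ := hS.exists_cocycle
  rw [SimpleGraph.isAcyclic_iff_forall_adj_isBridge]
  have key : ∀ (e : E) (g : 𝒢.π₁ S),
      ¬ ((𝒢.tree S).deleteEdges {s(𝒢.coset S (𝒢.src e) g, 𝒢.coset S (𝒢.tgt e) (g * 𝒢.t S e))}).Reachable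
        (𝒢.coset S (𝒢.src e) g) (𝒢.coset S (𝒢.tgt e) (g * 𝒢.t S e)) := by
    rintro e g ⟨p⟩
    have hinv : ∀ {x y}, ((𝒢.tree S).deleteEdges
        {s(𝒢.coset S (𝒢.src e) g, 𝒢.coset S (𝒢.tgt e) (g * 𝒢.t S e))}).Walk x y →
        D x (𝒢.edgeCoset S e g) = D y (𝒢.edgeCoset S e g) := by
      intro x y p
      induction p with
      | nil => rfl
      | @cons x y z hxy p ih =>
        rw [← ih]
        rw [SimpleGraph.deleteEdges_adj, hS.tree_adj_iff] at hxy
        obtain ⟨⟨e', g', h⟩, hne⟩ := hxy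
        have hee : 𝒢.edgeCoset S e g ≠ 𝒢.edgeCoset S e' g' := by
          intro hee
          apply hne
          obtain rfl : e = e' := (Sigma.mk.inj hee).1
          obtain ⟨a, rfl⟩ := edgeCoset_eq hee
          rw [coset_mul, mul_assoc, ← t_mul_ι, ← mul_assoc, coset_mul] at h
          rcases h with ⟨rfl, rfl⟩ | ⟨rfl, rfl⟩
          · rfl
          · exact Sym2.eq_swap
        have h1 := (hD e' g' _).2 hee
        rcases h with ⟨rfl, rfl⟩ | ⟨rfl, rfl⟩
        · exact h1.symm
        · exact h1
    have h1 := (hD e g _).1 rfl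
    have h2 := hinv p
    omega
  intro v w hvw
  rw [SimpleGraph.isBridge_iff]
  obtain ⟨e, g, ⟨rfl, rfl⟩ | ⟨rfl, rfl⟩⟩ := hS.tree_adj_iff.1 hvw
  · exact key e g
  · intro h
    rw [Sym2.eq_swap] at h
    exact key e g h.symm

theorem reachable_smul {a b : 𝒢.TreeVertex S} (g : 𝒢.π₁ S) (h : (𝒢.tree S).Reachable a b) :
    (𝒢.tree S).Reachable (g • a) (g • b) := by
  obtain ⟨p⟩ := h
  induction p with
  | nil => rfl
  | cons h _ ih => exact (𝒢.tree_adj_smul S g h).reachable.trans ih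

/-- The base vertices are joined by lifts of the edges of `S`. The elements that move every base
vertex within its component form a subgroup, which contains the generators. -/
theorem IsMaximalTree.tree_preconnected [Finite E] (hS : 𝒢.IsMaximalTree S) :
    (𝒢.tree S).Preconnected := by
  have hedge : ∀ e g, (𝒢.tree S).Reachable (𝒢.coset S (𝒢.src e) g)
      (𝒢.coset S (𝒢.tgt e) (g * 𝒢.t S e)) := fun e g =>
    (hS.tree_adj_iff.2 ⟨e, g, Or.inl ⟨rfl, rfl⟩⟩).reachable
  have hbase : ∀ v w, (𝒢.tree S).Reachable (𝒢.coset S v 1) (𝒢.coset S w 1) := by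
    intro v w
    induction hS.1 v w with
    | rel a b hab =>
      obtain ⟨e, he, rfl, rfl⟩ := hab
      simpa [𝒢.t_eq_one S he] using hedge e 1
    | refl a => rfl
    | symm a b _ ih => exact ih.symm
    | trans a b c _ _ ih1 ih2 => exact ih1.trans ih2
  have hgrp : ∀ (g : 𝒢.π₁ S) v, (𝒢.tree S).Reachable (𝒢.coset S v 1) (𝒢.coset S v g) := by
    intro g
    have htop := 𝒢.eq_top_of_generators S
      { carrier := {g | ∀ v, (𝒢.tree S).Reachable (𝒢.coset S v 1) (𝒢.coset S v g)}
        one_mem' := fun v => by rfl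
        mul_mem' := by
          intro g h hg hh v
          have := reachable_smul g (hh v)
          rw [smul_coset, smul_coset, mul_one] at this
          exact (hg v).trans this
        inv_mem' := by
          intro g hg v
          have := reachable_smul g⁻¹ (hg v)
          rw [smul_coset, smul_coset, mul_one, inv_mul_cancel] at this
          exact this.symm } ?_ ?_
    · have := Subgroup.mem_top g
      rw [← htop] at this
      exact this
    · intro u g v
      have h := reachable_smul (𝒢.ι S u g) (hbase u v)
      rw [smul_coset, smul_coset, mul_one, ← one_mul (𝒢.ι S u g), coset_mul, one_mul] at h
      exact (hbase v u).trans h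
    · intro e v
      have h := reachable_smul (𝒢.t S e) (hbase (𝒢.tgt e) v)
      rw [smul_coset, smul_coset, mul_one] at h
      have h2 := hedge e 1
      rw [one_mul] at h2
      exact ((hbase v _).trans h2).trans h
  intro a b
  obtain ⟨g, hg⟩ := exists_coset a
  obtain ⟨h, hh⟩ := exists_coset b
  rw [hg, hh]
  exact ((hgrp g _).symm.trans (hbase _ _)).trans (hgrp h _)

end GraphOfGroups

/-! ### Directions, half-spaces and rays in trees -/

namespace SimpleGraph

variable {V : Type*} (G : SimpleGraph V)

/-- The vertices on the geodesics between two vertices. -/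
def geodesicSegment (v w : V) : Set V := {x | G.dist v x + G.dist x w = G.dist v w}

open Classical in
/-- The neighbour of `v` in the direction of `w`, for `v ≠ w`. -/
noncomputable def next (v w : V) : V :=
  if h : ∃ u, G.Adj v u ∧ G.dist v w = G.dist u w + 1 then h.choose else v

/-- The vertices that are nearer to `b` than to `a`. -/
def halfSpace (a b : V) : Set V := {w | G.dist a w = G.dist b w + 1}

variable {G}

theorem mem_geodesicSegment_comm {v w x : V} :
    x ∈ G.geodesicSegment v w ↔ x ∈ G.geodesicSegment w v := by
  simp only [geodesicSegment, mem_ofPred_eq, G.dist_comm (u := v) (v := x),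
    G.dist_comm (u := x) (v := w), G.dist_comm (u := v) (v := w), add_comm]

theorem left_mem_geodesicSegment (v w : V) : v ∈ G.geodesicSegment v w := by
  simp [geodesicSegment]

theorem right_mem_geodesicSegment (v w : V) : w ∈ G.geodesicSegment v w := by
  simp [geodesicSegment]

namespace IsTree

variable (hG : G.IsTree)
include hG

theorem next_spec {v w : V} (h : v ≠ w) :
    G.Adj v (G.next v w) ∧ G.dist v w = G.dist (G.next v w) w + 1 := by
  have hex : ∃ u, G.Adj v u ∧ G.dist v w = G.dist u w + 1 := by
    obtain ⟨p, hp⟩ := hG.1.exists_walk_length_eq_dist v w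
    cases p with
    | nil => exact absurd rfl h
    | @cons _ u _ hvu p =>
      refine ⟨u, hvu, ?_⟩
      rw [Walk.length_cons] at hp
      have h1 := G.dist_le p
      have h2 := hG.1.dist_triangle (u := v) (v := u) (w := w)
      have h3 : G.dist v u = 1 := dist_eq_one_iff_adj.2 hvu
      omega
  rw [next, dif_pos hex]
  exact hex.choose_spec

theorem eq_next {v w u : V} (h : G.Adj v u) (hd : G.dist v w = G.dist u w + 1) :
    u = G.next v w := by
  have hne : v ≠ w := by rintro rfl; simp at hd
  have key : ∀ u, G.Adj v u → G.dist v w = G.dist u w + 1 →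
      ∃ p : G.Walk v w, p.IsPath ∧ p.snd = u := by
    intro u hu hd
    obtain ⟨p, hp⟩ := hG.1.exists_walk_length_eq_dist u w
    refine ⟨.cons hu p, Walk.isPath_of_length_eq_dist _ ?_, by simp⟩
    rw [Walk.length_cons, hp, hd]
  obtain ⟨p, hp, rfl⟩ := key u h hd
  obtain ⟨q, hq, hq'⟩ := key _ (hG.next_spec hne).1 (hG.next_spec hne).2
  rw [← hq', (hG.existsUnique_path v w).unique hp hq]

theorem next_of_adj {v w : V} (h : G.Adj v w) : G.next v w = w :=
  (hG.eq_next h (by rw [dist_self, dist_eq_one_iff_adj.2 h])).symm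

theorem next_eq_of_adj {x v w : V} (h : G.Adj v w) (hv : x ≠ v) (hw : x ≠ w) :
    G.next x v = G.next x w := by
  wlog hd : G.dist x w = G.dist x v + 1 generalizing v w
  · refine (this h.symm hw hv ?_).symm
    have := hG.dist_eq_dist_add_one_of_adj x h
    omega
  refine hG.eq_next (hG.next_spec hv).1 ?_
  have h1 := (hG.next_spec hv).2
  have h2 := hG.1.dist_triangle (u := G.next x v) (v := v) (w := w)
  have h3 := hG.1.dist_triangle (u := x) (v := G.next x v) (w := w)
  rw [dist_eq_one_iff_adj.2 (hG.next_spec hv).1] at h3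
  rw [dist_eq_one_iff_adj.2 h] at h2
  omega

/-- The direction seen from `x` cannot change while a point moves along an edge that avoids `x`; the
segment is traversed step by step. -/
theorem next_eq_of_notMem {x v w : V} (h : x ∉ G.geodesicSegment v w) :
    G.next x v = G.next x w := by
  induction hn : G.dist v w generalizing v with
  | zero => rw [hG.1.dist_eq_zero_iff.1 hn]
  | succ n ih =>
    have hvw : v ≠ w := by rintro rfl; simp at hn
    obtain ⟨h1, h2⟩ := hG.next_spec hvw
    have h3 : x ∉ G.geodesicSegment (G.next v w) w := by
      intro h3
      apply h
      simp only [geodesicSegment, mem_ofPred_eq] at h3 ⊢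
      have h4 := hG.1.dist_triangle (u := v) (v := G.next v w) (w := x)
      have h5 := hG.1.dist_triangle (u := v) (v := x) (w := w)
      rw [dist_eq_one_iff_adj.2 h1] at h4
      omega
    rw [← ih h3 (by omega)]
    refine hG.next_eq_of_adj h1 ?_ ?_
    · rintro rfl
      exact h (left_mem_geodesicSegment _ _)
    · intro hx
      rw [hx] at h3
      exact h3 (left_mem_geodesicSegment _ _)

theorem eq_of_mem_geodesicSegment {v s w : V} (h : s ∈ G.geodesicSegment v w)
    (h' : w ∈ G.geodesicSegment v s) : s = w := by
  simp only [geodesicSegment, mem_ofPred_eq] at h h'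
  exact hG.1.dist_eq_zero_iff.1 (by rw [G.dist_comm (u := w) (v := s)] at h'; omega)

theorem finite_geodesicSegment (v w : V) : (G.geodesicSegment v w).Finite := by
  induction hn : G.dist v w generalizing v with
  | zero =>
    refine (finite_singleton v).subset fun x hx => ?_
    simp only [geodesicSegment, mem_ofPred_eq] at hx
    exact (hG.1.dist_eq_zero_iff.1 (by omega)).symm
  | succ n ih =>
    have hvw : v ≠ w := by rintro rfl; simp at hn
    obtain ⟨h1, h2⟩ := hG.next_spec hvw
    refine ((ih (G.next v w) (by omega)).insert v).subset fun x hx => ?_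
    rcases eq_or_ne x v with rfl | hxv
    · exact mem_insert _ _
    refine mem_insert_of_mem _ ?_
    have h3 : v ∉ G.geodesicSegment x w := fun h3 => hxv
      (hG.eq_of_mem_geodesicSegment (mem_geodesicSegment_comm.1 hx)
        (mem_geodesicSegment_comm.1 h3))
    have h4 := (hG.next_spec hxv.symm).2
    rw [hG.next_eq_of_notMem h3] at h4
    simp only [geodesicSegment, mem_ofPred_eq] at hx ⊢
    omega

theorem mem_halfSpace_or {a b : V} (h : G.Adj a b) (w : V) :
    w ∈ G.halfSpace a b ∨ w ∈ G.halfSpace b a := by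
  have := hG.dist_eq_dist_add_one_of_adj w h
  simp only [halfSpace, mem_ofPred_eq, G.dist_comm (u := a), G.dist_comm (u := b)]
  omega

theorem next_halfSpace {a b t w : V} (ht : t ∈ G.halfSpace a b)
    (hw : w ∈ G.halfSpace b a) : G.next t w = G.next t a := by
  refine hG.next_eq_of_notMem fun h1 => ?_
  simp only [geodesicSegment, halfSpace, mem_ofPred_eq] at *
  have h2 := hG.1.dist_triangle (u := w) (v := t) (w := b)
  rw [G.dist_comm (u := b) (v := w), G.dist_comm (u := a) (v := w)] at hw
  rw [G.dist_comm (u := a) (v := t), G.dist_comm (u := b) (v := t)] at ht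
  omega

theorem mem_halfSpace_iff {a b w : V} (h : G.Adj a b) :
    w ∈ G.halfSpace a b ↔ a ≠ w ∧ G.next a w = b := by
  constructor
  · intro hw
    exact ⟨by rintro rfl; simp [halfSpace] at hw, (hG.eq_next h hw).symm⟩
  · rintro ⟨hne, rfl⟩
    exact (hG.next_spec hne).2

end IsTree

/-- A geodesic ray of a tree: an infinite path without repeated vertices. -/
def IsRay (G : SimpleGraph V) (r : ℕ → V) : Prop :=
  (∀ n, G.Adj (r n) (r (n + 1))) ∧ Function.Injective r

theorem IsRay.exists_ne {r : ℕ → V} (hr : G.IsRay r) (v : V) : ∃ N, ∀ n, N ≤ n → r n ≠ v := by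
  by_cases h : ∃ N, r N = v
  · obtain ⟨N, rfl⟩ := h
    exact ⟨N + 1, fun n hn h => by have := hr.2 h; omega⟩
  · push Not at h
    exact ⟨0, fun n _ => h n⟩

namespace IsTree

variable (hG : G.IsTree)
include hG

/-- Only one neighbour of a vertex is nearer to `v`. Once a path moves away from `v`, this neighbour
is the preceding vertex, to which the path does not return. -/
theorem dist_succ_of_dist_succ {r : ℕ → V} (hr : ∀ n, G.Adj (r n) (r (n + 1)))
    (hb : ∀ n, r (n + 2) ≠ r n) {v : V} {n : ℕ} (h : G.dist v (r (n + 1)) = G.dist v (r n) + 1)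
    (k : ℕ) : G.dist v (r (n + k + 1)) = G.dist v (r (n + k)) + 1 := by
  induction k with
  | zero => exact h
  | succ k ih =>
    have h1 := hG.dist_eq_dist_add_one_of_adj v (hr (n + k + 1))
    rcases h1 with h1 | h1
    · exact absurd ((hG.eq_next (hr (n + k + 1)) (w := v)
        (by rw [dist_comm, h1, dist_comm])).trans (hG.eq_next (hr (n + k)).symm (w := v)
        (by rw [dist_comm, ih, dist_comm])).symm) (hb (n + k))
    · exact h1

theorem isRay_of_not_backtrack {r : ℕ → V} (hr : ∀ n, G.Adj (r n) (r (n + 1)))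
    (hb : ∀ n, r (n + 2) ≠ r n) : G.IsRay r := by
  refine ⟨hr, ?_⟩
  have key : ∀ m k, G.dist (r m) (r (m + k)) = k := by
    intro m k
    induction k with
    | zero => simp
    | succ k ih =>
      rw [← add_assoc, hG.dist_succ_of_dist_succ hr hb
        (by rw [dist_self, dist_eq_one_iff_adj.2 (hr m)]) k, ih]
  intro m n hmn
  wlog h : m ≤ n generalizing m n
  · exact (this hmn.symm (by omega)).symm
  obtain ⟨k, rfl⟩ := Nat.exists_eq_add_of_le h
  have := key m k
  rw [← hmn, dist_self] at this
  omega

theorem exists_dist_ray {r : ℕ → V} (hr : G.IsRay r) (v : V) :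
    ∃ N, ∀ n, N ≤ n → G.dist v (r (n + 1)) = G.dist v (r n) + 1 := by
  have hb : ∀ n, r (n + 2) ≠ r n := fun n h => by simpa using hr.2 h
  obtain ⟨N, hN⟩ : ∃ N, G.dist v (r (N + 1)) = G.dist v (r N) + 1 := by
    by_contra! hcon
    have : ∀ n, G.dist v (r n) + n = G.dist v (r 0) := by
      intro n
      induction n with
      | zero => rfl
      | succ n ih =>
        have h1 := hG.dist_eq_dist_add_one_of_adj v (hr.1 n)
        have h2 := hcon n
        omega
    have h3 := this (G.dist v (r 0) + 1)
    omega
  refine ⟨N, fun n hn => ?_⟩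
  obtain ⟨k, rfl⟩ := Nat.exists_eq_add_of_le hn
  exact hG.dist_succ_of_dist_succ hr.1 hb hN k

theorem exists_next_ray {r : ℕ → V} (hr : G.IsRay r) (v : V) :
    ∃ N u, ∀ n, N ≤ n → r n ≠ v ∧ G.next v (r n) = u := by
  obtain ⟨N, hN⟩ := hr.exists_ne v
  refine ⟨N, G.next v (r N), fun n hn => ⟨hN n hn, ?_⟩⟩
  induction n, hn using Nat.le_induction with
  | base => rfl
  | succ n hn ih =>
    rw [← ih, hG.next_eq_of_adj (hr.1 n) (hN n hn).symm (hN _ (by omega)).symm]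

theorem ray_mem_halfSpace {r : ℕ → V} (hr : G.IsRay r) (m k : ℕ) :
    r (m + 1 + k) ∈ G.halfSpace (r m) (r (m + 1)) := by
  rw [hG.mem_halfSpace_iff (hr.1 m)]
  have hne : ∀ k, r m ≠ r (m + 1 + k) := fun k h => by have := hr.2 h; omega
  refine ⟨hne k, ?_⟩
  induction k with
  | zero => exact hG.next_of_adj (hr.1 m)
  | succ k ih => rw [← ih, hG.next_eq_of_adj (hr.1 (m + 1 + k)) (hne k) (hne (k + 1))]; rfl

theorem dist_ray {r : ℕ → V} (hr : G.IsRay r) (m : ℕ) (k : ℕ) : G.dist (r m) (r (m + k)) = k := by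
  induction k with
  | zero => simp
  | succ k ih =>
    have h1 := hG.dist_succ_of_dist_succ hr.1 (fun n h => by simpa using hr.2 h)
      (v := r m) (n := m) (by rw [dist_self, dist_eq_one_iff_adj.2 (hr.1 m)]) k
    rw [← add_assoc, h1, ih]

/-- This turns the tails `T_m(ξ)`, defined through a base vertex, into half-spaces of a single edge.
-/
theorem mem_halfSpace_ray_iff {r : ℕ → V} (hr : G.IsRay r) (m : ℕ) {w : V} :
    w ∈ G.halfSpace (r m) (r (m + 1)) ↔
      G.dist (r 0) w = (m + 1) + G.dist (r (m + 1)) w := by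
  have h0 : ∀ m, G.dist (r 0) (r m) = m := fun m => by simpa using hG.dist_ray hr 0 m
  constructor
  · intro hw
    have h3 : r m ∈ G.geodesicSegment (r 0) w := by
      by_contra h3
      have h1 := ((hG.mem_halfSpace_iff (hr.1 m)).1 hw).2
      rw [← hG.next_eq_of_notMem h3] at h1
      have hne : r m ≠ r 0 := by
        rintro h
        rw [h] at h3
        exact h3 (left_mem_geodesicSegment _ _)
      have h4 := (hG.next_spec hne).2
      rw [h1, dist_comm, h0, dist_comm, h0] at h4
      omega
    simp only [geodesicSegment, halfSpace, mem_ofPred_eq, h0] at hw h3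
    omega
  · intro hw
    have h1 := hG.1.dist_triangle (u := r 0) (v := r m) (w := w)
    have h2 := hG.dist_eq_dist_add_one_of_adj w (hr.1 m)
    rw [h0] at h1
    rw [dist_comm, G.dist_comm (u := w) (v := r (m + 1))] at h2
    simp only [halfSpace, mem_ofPred_eq]
    omega

/-- Every ray is asymptotic to a ray from any given vertex. -/
theorem exists_ray_from {r : ℕ → V} (hr : G.IsRay r) (v : V) :
    ∃ r' : ℕ → V, G.IsRay r' ∧ r' 0 = v ∧ ∃ m n, ∀ k, r (m + k) = r' (n + k) := by
  obtain ⟨p⟩ := hG.1.preconnected (r 0) v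
  generalize hw : r 0 = w at p
  induction p generalizing r with
  | nil => exact ⟨r, hr, hw, 0, 0, fun k => rfl⟩
  | @cons u u' v huu' p ih =>
    subst hw
    -- Moving the origin across one edge either deletes the first vertex of the ray or adds a new
    -- one in front.
    by_cases h : r 1 = u'
    · obtain ⟨r', h1, h2, m, n, h3⟩ := ih (r := fun n => r (n + 1))
        ⟨fun n => hr.1 (n + 1), fun a b hab => by simpa using hr.2 hab⟩ h
      refine ⟨r', h1, h2, m + 1, n, fun k => ?_⟩
      rw [← h3, add_right_comm]
    · obtain ⟨r', h1, h2, m, n, h3⟩ := ih (r := fun n => Nat.casesOn n u' r)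
        (hG.isRay_of_not_backtrack (by
          rintro (_ | n)
          · exact huu'.symm
          · exact hr.1 n) (by
          rintro (_ | n)
          · exact h
          · exact fun h => by simpa using hr.2 h)) rfl
      refine ⟨r', h1, h2, m, n + 1, fun k => ?_⟩
      have h4 := h3 (k + 1)
      rw [show n + 1 + k = n + (k + 1) by ring, ← h4]
      rfl

end IsTree

end SimpleGraph

/-! ### Projections of `M` to the compacta, and coherent families -/

namespace GraphOfGroups

namespace VertexSpaces

variable {V E : Type*} {𝒢 : GraphOfGroups V E} {𝒳 : VertexSpaces 𝒢} {S : Set E}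

variable (𝒳 S) in
/-- `x` and `y` are the images of the point of an edge in the compacta of its two vertices. -/
def Glued (x y : 𝒳.Omega S) : Prop := 𝒳.Glue S x y ∨ 𝒳.Glue S y x

theorem Glued.symm {x y : 𝒳.Omega S} (h : 𝒳.Glued S x y) : 𝒳.Glued S y x := Or.symm h

theorem Glued.toQuot_eq {x y : 𝒳.Omega S} (h : 𝒳.Glued S x y) :
    𝒳.toQuot S x = 𝒳.toQuot S y := by
  rcases h with h | h
  · exact Quot.sound h
  · exact (Quot.sound h).symm

theorem Glued.smul {x y : 𝒳.Omega S} (g : 𝒢.π₁ S) (h : 𝒳.Glued S x y) :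
    𝒳.Glued S (g • x) (g • y) :=
  h.imp (𝒳.glue_smul S g) (𝒳.glue_smul S g)

variable (𝒳 S) in
/-- The combinatorial conditions on the compacta of the Bass-Serre tree: it is a tree and every edge
has exactly one point in the compactum of each of its two vertices. -/
structure IsTreeOfSpaces : Prop where
  isTree : (𝒢.tree S).IsTree
  adj_iff : ∀ a b, (𝒢.tree S).Adj a b ↔
    ∃ x y, 𝒳.Glued S x y ∧ 𝒳.vert S x = a ∧ 𝒳.vert S y = b
  unique : ∀ x y x' y', 𝒳.Glued S x y → 𝒳.Glued S x' y' → 𝒳.vert S x = 𝒳.vert S x' →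
    𝒳.vert S y = 𝒳.vert S y' → x = x'

theorem pt_mul (v : V) (g : 𝒢.π₁ S) (a : 𝒢.G v) (x : 𝒳.X v) :
    𝒳.pt S v (g * 𝒢.ι S v a) x = 𝒳.pt S v g (a • x) :=
  congrArg (Sigma.mk v) (Quotient.sound ⟨a, by simp, rfl⟩)

theorem vert_pt (v : V) (g : 𝒢.π₁ S) (x : 𝒳.X v) :
    𝒳.vert S (𝒳.pt S v g x) = 𝒢.coset S v g := rfl

theorem exists_pt (x : 𝒳.Omega S) : ∃ v g y, x = 𝒳.pt S v g y := by
  obtain ⟨v, x⟩ := x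
  induction x using Quotient.inductionOn with
  | h a => exact ⟨v, a.1, a.2, rfl⟩

theorem exists_pt_of_vert {v : V} {g : 𝒢.π₁ S} {x : 𝒳.Omega S}
    (hx : 𝒳.vert S x = 𝒢.coset S v g) : ∃ y, x = 𝒳.pt S v g y := by
  obtain ⟨w, k, y, rfl⟩ := exists_pt x
  rw [vert_pt] at hx
  obtain rfl : w = v := (Sigma.mk.inj hx).1
  obtain ⟨a, rfl⟩ := coset_eq_iff.1 hx.symm
  exact ⟨a • y, pt_mul _ _ _ _⟩

/-- The element that translates a given edge is determined up to the edge group. As this group fixes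
the two marked points, the translated points depend on the edge only. -/
theorem isTreeOfSpaces [Finite E] (hS : 𝒢.IsMaximalTree S) [Nonempty (𝒳.Omega S)]
    (hsrc : ∀ e a, 𝒢.φ e a • 𝒳.srcPt e = 𝒳.srcPt e)
    (htgt : ∀ e a, 𝒢.ψ e a • 𝒳.tgtPt e = 𝒳.tgtPt e) : 𝒳.IsTreeOfSpaces S where
  isTree := by
    have : Nonempty (𝒢.TreeVertex S) := Nonempty.map (𝒳.vert S) inferInstance
    exact ⟨⟨hS.tree_preconnected⟩, hS.tree_isAcyclic⟩
  adj_iff a b := by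
    rw [hS.tree_adj_iff]
    constructor
    · rintro ⟨e, g, ⟨rfl, rfl⟩ | ⟨rfl, rfl⟩⟩
      · exact ⟨_, _, Or.inl ⟨e, g, rfl, rfl⟩, rfl, rfl⟩
      · exact ⟨_, _, Or.inr ⟨e, g, rfl, rfl⟩, rfl, rfl⟩
    · rintro ⟨x, y, ⟨e, g, rfl, rfl⟩ | ⟨e, g, rfl, rfl⟩, rfl, rfl⟩
      · exact ⟨e, g, Or.inl ⟨rfl, rfl⟩⟩
      · exact ⟨e, g, Or.inr ⟨rfl, rfl⟩⟩
  unique := by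
    have key : ∀ x y x' y', 𝒳.Glue S x y → 𝒳.Glue S x' y' → 𝒳.vert S x = 𝒳.vert S x' →
        𝒳.vert S y = 𝒳.vert S y' → x = x' ∧ y = y' := by
      rintro _ _ _ _ ⟨e, g, rfl, rfl⟩ ⟨e', g', rfl, rfl⟩ hx hy
      have h := (hS.edge_unique (Or.inl ⟨hx, hy⟩)).1
      obtain rfl : e = e' := (Sigma.mk.inj h).1
      obtain ⟨a, rfl⟩ := edgeCoset_eq h
      rw [mul_assoc, ← t_mul_ι, ← mul_assoc, pt_mul, pt_mul, hsrc, htgt]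
      exact ⟨rfl, rfl⟩
    have key' : ∀ x y x' y', 𝒳.Glue S x y → 𝒳.Glue S x' y' → 𝒳.vert S x = 𝒳.vert S y' →
        𝒳.vert S y = 𝒳.vert S x' → False := by
      rintro _ _ _ _ ⟨e, g, rfl, rfl⟩ ⟨e', g', rfl, rfl⟩ hx hy
      exact hS.src_ne_tgt e' g' ((hS.edge_unique (Or.inr ⟨hx, hy⟩)).2.symm.trans hx)
    rintro x y x' y' (h | h) (h' | h') hx hy
    · exact (key _ _ _ _ h h' hx hy).1
    · exact (key' _ _ _ _ h h' hx hy).elim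
    · exact (key' _ _ _ _ h h' hy hx).elim
    · exact (key _ _ _ _ h h' hy hx).2

variable [Nonempty (𝒳.Omega S)]

variable (𝒳 S) in
/-- The point, in the compactum of the vertex `v`, of the first edge of `[v, w]`. -/
noncomputable def dirPt (v w : 𝒢.TreeVertex S) : 𝒳.Omega S :=
  Classical.epsilon fun x => ∃ y, 𝒳.Glued S x y ∧ 𝒳.vert S x = v ∧
    𝒳.vert S y = (𝒢.tree S).next v w

theorem dirPt_congr {v w w' : 𝒢.TreeVertex S}
    (h : (𝒢.tree S).next v w = (𝒢.tree S).next v w') : 𝒳.dirPt S v w = 𝒳.dirPt S v w' := by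
  unfold dirPt
  rw [h]

open Classical in
variable (𝒳 S) in
/-- The projection of a point of `Ω` to the compactum of the vertex `t`. -/
noncomputable def coordPt (x : 𝒳.Omega S) (t : 𝒢.TreeVertex S) : 𝒳.Omega S :=
  if t = 𝒳.vert S x then x else 𝒳.dirPt S t (𝒳.vert S x)

theorem coordPt_vert (x : 𝒳.Omega S) : 𝒳.coordPt S x (𝒳.vert S x) = x := if_pos rfl

theorem coordPt_of_ne {x : 𝒳.Omega S} {t : 𝒢.TreeVertex S} (h : t ≠ 𝒳.vert S x) :
    𝒳.coordPt S x t = 𝒳.dirPt S t (𝒳.vert S x) := if_neg h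

variable (𝒳 S) in
/-- The projection of a point of `Ω/∼` to the compactum of the vertex `t`. -/
noncomputable def coord (z : 𝒳.OmegaQuot S) : 𝒢.TreeVertex S → 𝒳.Omega S :=
  𝒳.coordPt S (Quot.out z)

variable (𝒳 S) in
/-- The projection of a boundary point of the tree to the compactum of the vertex `t`. -/
noncomputable def coordEnd (ξ : 𝒢.Boundary S) (t : 𝒢.TreeVertex S) : 𝒳.Omega S :=
  Classical.epsilon fun x => ∃ N, ∀ n, N ≤ n → 𝒳.dirPt S t ((Quotient.out ξ).1 n) = x

variable (𝒳 S) in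
/-- The projections of a point of `M` to the compacta of the vertices. -/
noncomputable def coords (m : 𝒳.M S) : 𝒢.TreeVertex S → 𝒳.Omega S :=
  Sum.elim (𝒳.coordEnd S) (𝒳.coord S) (Quot.out m)

theorem ray_isRay (r : 𝒢.Ray S) : (𝒢.tree S).IsRay r.1 := r.2

namespace IsTreeOfSpaces

variable (h : 𝒳.IsTreeOfSpaces S)
include h

theorem dirPt_spec {v w : 𝒢.TreeVertex S} (hvw : v ≠ w) : ∃ y, 𝒳.Glued S (𝒳.dirPt S v w) y ∧
    𝒳.vert S (𝒳.dirPt S v w) = v ∧ 𝒳.vert S y = (𝒢.tree S).next v w := by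
  obtain ⟨x, y, h1, h2, h3⟩ := (h.adj_iff _ _).1 (h.isTree.next_spec hvw).1
  exact Classical.epsilon_spec (p := fun x => ∃ y, 𝒳.Glued S x y ∧ 𝒳.vert S x = v ∧
    𝒳.vert S y = (𝒢.tree S).next v w) ⟨x, y, h1, h2, h3⟩

theorem vert_dirPt {v w : 𝒢.TreeVertex S} (hvw : v ≠ w) : 𝒳.vert S (𝒳.dirPt S v w) = v :=
  let ⟨_, h2⟩ := h.dirPt_spec hvw
  h2.2.1

omit [Nonempty (𝒳.Omega S)] in
theorem adj_of_glued {x y : 𝒳.Omega S} (hxy : 𝒳.Glued S x y) :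
    (𝒢.tree S).Adj (𝒳.vert S x) (𝒳.vert S y) :=
  (h.adj_iff _ _).2 ⟨x, y, hxy, rfl, rfl⟩

theorem dirPt_of_glued {x y : 𝒳.Omega S} {w : 𝒢.TreeVertex S} (hxy : 𝒳.Glued S x y)
    (hw : 𝒳.vert S x ≠ w) (hn : (𝒢.tree S).next (𝒳.vert S x) w = 𝒳.vert S y) :
    𝒳.dirPt S (𝒳.vert S x) w = x := by
  obtain ⟨y', h1, h2, h3⟩ := h.dirPt_spec hw
  exact h.unique _ _ _ _ h1 hxy h2 (h3.trans hn)

theorem dirPt_vert {x y : 𝒳.Omega S} (hxy : 𝒳.Glued S x y) :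
    𝒳.dirPt S (𝒳.vert S x) (𝒳.vert S y) = x :=
  h.dirPt_of_glued hxy (h.adj_of_glued hxy).ne (h.isTree.next_of_adj (h.adj_of_glued hxy))

theorem glued_dirPt {v w : 𝒢.TreeVertex S} (hvw : v ≠ w) :
    𝒳.Glued S (𝒳.dirPt S v w) (𝒳.dirPt S ((𝒢.tree S).next v w) v) := by
  obtain ⟨y, h1, h2, h3⟩ := h.dirPt_spec hvw
  have h4 := h.dirPt_vert h1.symm
  rw [h2, h3] at h4
  rw [h4]
  exact h1

theorem dirPt_eq_of_notMem {x v w : 𝒢.TreeVertex S}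
    (hx : x ∉ (𝒢.tree S).geodesicSegment v w) : 𝒳.dirPt S x v = 𝒳.dirPt S x w :=
  dirPt_congr (h.isTree.next_eq_of_notMem hx)

theorem dirPt_halfSpace {a b t w : 𝒢.TreeVertex S} (ht : t ∈ (𝒢.tree S).halfSpace a b)
    (hw : w ∈ (𝒢.tree S).halfSpace b a) : 𝒳.dirPt S t w = 𝒳.dirPt S t a :=
  dirPt_congr (h.isTree.next_halfSpace ht hw)

theorem dirPt_eq_of_adj {x v w : 𝒢.TreeVertex S} (hvw : (𝒢.tree S).Adj v w) (hv : x ≠ v)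
    (hw : x ≠ w) : 𝒳.dirPt S x v = 𝒳.dirPt S x w :=
  dirPt_congr (h.isTree.next_eq_of_adj hvw hv hw)

omit [Nonempty (𝒳.Omega S)] in
theorem dist_smul (g : 𝒢.π₁ S) (a b : 𝒢.TreeVertex S) :
    (𝒢.tree S).dist (g • a) (g • b) = (𝒢.tree S).dist a b := by
  have hdist : ∀ (g : 𝒢.π₁ S) (a b : 𝒢.TreeVertex S),
      (𝒢.tree S).dist (g • a) (g • b) ≤ (𝒢.tree S).dist a b := by
    intro g a b
    obtain ⟨p, hp⟩ := h.isTree.1.exists_walk_length_eq_dist a b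
    let f : 𝒢.tree S →g 𝒢.tree S := ⟨fun a => g • a, fun hab => 𝒢.tree_adj_smul S g hab⟩
    rw [← hp, ← p.length_map f]
    exact SimpleGraph.dist_le _
  exact le_antisymm (hdist g a b) (by simpa using hdist g⁻¹ (g • a) (g • b))

omit [Nonempty (𝒳.Omega S)] in
theorem smul_mem_geodesicSegment_iff (g : 𝒢.π₁ S) {v w x : 𝒢.TreeVertex S} :
    g • x ∈ (𝒢.tree S).geodesicSegment (g • v) (g • w) ↔
      x ∈ (𝒢.tree S).geodesicSegment v w := by
  simp only [SimpleGraph.geodesicSegment, mem_ofPred_eq, h.dist_smul]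

omit [Nonempty (𝒳.Omega S)] in
theorem next_smul (g : 𝒢.π₁ S) {v w : 𝒢.TreeVertex S} (hvw : v ≠ w) :
    (𝒢.tree S).next (g • v) (g • w) = g • (𝒢.tree S).next v w := by
  obtain ⟨h4, h5⟩ := h.isTree.next_spec hvw
  exact (h.isTree.eq_next (𝒢.tree_adj_smul S g h4) (by rw [h.dist_smul, h.dist_smul, h5])).symm

theorem dirPt_smul (g : 𝒢.π₁ S) {v w : 𝒢.TreeVertex S} (hvw : v ≠ w) :
    𝒳.dirPt S (g • v) (g • w) = g • 𝒳.dirPt S v w := by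
  obtain ⟨y, h1, h2, h3⟩ := h.dirPt_spec hvw
  have h6 := h.dirPt_of_glued (h1.smul g) (w := g • w)
  rw [vert_smul, vert_smul, h2] at h6
  refine h6 (fun he => hvw (MulAction.injective g he)) ?_
  rw [h3, h.next_smul g hvw]

theorem coordPt_eq_of_glued {x y : 𝒳.Omega S} (hxy : 𝒳.Glued S x y) :
    𝒳.coordPt S x = 𝒳.coordPt S y := by
  have hadj := h.adj_of_glued hxy
  ext1 t
  by_cases h1 : t = 𝒳.vert S x
  · subst h1
    rw [coordPt_vert, coordPt_of_ne hadj.ne, h.dirPt_vert hxy]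
  by_cases h2 : t = 𝒳.vert S y
  · subst h2
    rw [coordPt_vert, coordPt_of_ne hadj.ne', h.dirPt_vert hxy.symm]
  · rw [coordPt_of_ne h1, coordPt_of_ne h2, h.dirPt_eq_of_adj hadj h1 h2]

theorem coord_toQuot (x : 𝒳.Omega S) : 𝒳.coord S (𝒳.toQuot S x) = 𝒳.coordPt S x := by
  have key : ∀ a b, Relation.EqvGen (𝒳.Glue S) a b → 𝒳.coordPt S a = 𝒳.coordPt S b := by
    intro a b hab
    induction hab with
    | rel a b hab => exact h.coordPt_eq_of_glued (Or.inl hab)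
    | refl a => rfl
    | symm a b _ ih => exact ih.symm
    | trans a b c _ _ ih1 ih2 => exact ih1.trans ih2
  exact key _ _ (Quot.eqvGen_exact (Quot.out_eq (𝒳.toQuot S x)))

theorem vert_coord (z : 𝒳.OmegaQuot S) (t : 𝒢.TreeVertex S) :
    𝒳.vert S (𝒳.coord S z t) = t := by
  obtain ⟨x⟩ := z
  change 𝒳.vert S (𝒳.coord S (𝒳.toQuot S x) t) = t
  rw [h.coord_toQuot]
  by_cases ht : t = 𝒳.vert S x
  · subst ht
    rw [coordPt_vert]
  · rw [coordPt_of_ne ht, h.vert_dirPt ht]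

theorem coord_eq_of_vert {x : 𝒳.Omega S} {v : 𝒢.TreeVertex S} (hx : 𝒳.vert S x = v) :
    𝒳.coord S (𝒳.toQuot S x) v = x := by
  subst hx
  rw [h.coord_toQuot, coordPt_vert]

theorem mem_domain_iff {z : 𝒳.OmegaQuot S} {v : 𝒢.TreeVertex S} :
    v ∈ 𝒳.domain S z ↔ 𝒳.toQuot S (𝒳.coord S z v) = z := by
  constructor
  · rintro ⟨y, hy, rfl⟩
    rw [h.coord_eq_of_vert hy]
  · exact fun hz => ⟨_, h.vert_coord z v, hz⟩

theorem coord_of_mem_domain {z : 𝒳.OmegaQuot S} {v t : 𝒢.TreeVertex S} (hv : v ∈ 𝒳.domain S z)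
    (ht : t ≠ v) : 𝒳.coord S z t = 𝒳.dirPt S t v := by
  obtain ⟨y, rfl, rfl⟩ := hv
  rw [h.coord_toQuot, coordPt_of_ne ht]

omit h [Nonempty (𝒳.Omega S)] in
theorem domain_nonempty (z : 𝒳.OmegaQuot S) : (𝒳.domain S z).Nonempty := by
  obtain ⟨x⟩ := z
  exact ⟨𝒳.vert S x, x, rfl, rfl⟩

/-- A point of `X_v` that is the point of an edge has been glued across this edge. Used in the
contrapositive: at a vertex of `D(z)` nearest to `w`, the coordinate of `z` does not point to `w`.
-/
theorem next_mem_domain {z : 𝒳.OmegaQuot S} {v w : 𝒢.TreeVertex S} (hv : v ∈ 𝒳.domain S z)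
    (hvw : v ≠ w) (hz : 𝒳.coord S z v = 𝒳.dirPt S v w) :
    (𝒢.tree S).next v w ∈ 𝒳.domain S z := by
  refine ⟨_, h.vert_dirPt (h.isTree.next_spec hvw).1.ne', ?_⟩
  rw [← (h.glued_dirPt hvw).toQuot_eq, ← hz, h.mem_domain_iff.1 hv]

theorem coord_injective : Function.Injective (𝒳.coord S) := by
  -- Induction on the distance: equality of the coordinates at the vertex of `x` forces `x` to be
  -- the point of the first edge towards `y`, so it may be replaced by the point glued to it.
  have key : ∀ n x y, (𝒢.tree S).dist (𝒳.vert S x) (𝒳.vert S y) = n →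
      𝒳.coordPt S x = 𝒳.coordPt S y → 𝒳.toQuot S x = 𝒳.toQuot S y := by
    intro n
    induction n with
    | zero =>
      intro x y hn hxy
      have h1 := h.isTree.1.dist_eq_zero_iff.1 hn
      have h2 := congrFun hxy (𝒳.vert S x)
      rw [coordPt_vert, h1, coordPt_vert] at h2
      rw [h2]
    | succ n ih =>
      intro x y hn hxy
      have hne : 𝒳.vert S x ≠ 𝒳.vert S y := fun h => by simp [h] at hn
      have h2 := congrFun hxy (𝒳.vert S x)
      rw [coordPt_vert, coordPt_of_ne hne] at h2
      have h3 := h.glued_dirPt hne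
      rw [← h2] at h3
      rw [h3.toQuot_eq]
      refine ih _ _ ?_ ((h.coordPt_eq_of_glued h3).symm.trans hxy)
      rw [h.vert_dirPt (h.isTree.next_spec hne).1.ne']
      have := (h.isTree.next_spec hne).2
      omega
  rintro ⟨x⟩ ⟨y⟩ hxy
  refine key _ x y rfl ?_
  rw [← h.coord_toQuot, ← h.coord_toQuot]
  exact hxy

/-- The direction of a ray seen from `t` is eventually constant, and asymptotic rays share it; hence
the choice of representative is immaterial. -/
theorem coordEnd_mk (r : 𝒢.Ray S) (t : 𝒢.TreeVertex S) : ∃ N, ∀ n, N ≤ n →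
    r.1 n ≠ t ∧ 𝒳.coordEnd S (Quotient.mk _ r) t = 𝒳.dirPt S t (r.1 n) := by
  set s := Quotient.out (Quotient.mk (𝒢.raySetoid S) r) with hs
  obtain ⟨m, k, hmk⟩ : (𝒢.raySetoid S) s r := Quotient.exact (Quotient.out_eq _)
  obtain ⟨N, u, hN⟩ := h.isTree.exists_next_ray (ray_isRay s) t
  have h1 : ∃ x, ∃ N, ∀ n, N ≤ n → 𝒳.dirPt S t (s.1 n) = x :=
    ⟨𝒳.dirPt S t (s.1 N), N, fun n hn => dirPt_congr (by rw [(hN n hn).2, (hN N le_rfl).2])⟩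
  obtain ⟨N', hN'⟩ := Classical.epsilon_spec h1
  refine ⟨k + N + N', fun n hn => ?_⟩
  obtain ⟨j, rfl⟩ := Nat.exists_eq_add_of_le hn
  rw [add_assoc, add_assoc, ← hmk]
  refine ⟨(hN _ (by omega)).1, ?_⟩
  exact (hN' _ (by omega)).symm

theorem coordEnd_eq_of_forall_ge {r : 𝒢.Ray S} {t : 𝒢.TreeVertex S} {x : 𝒳.Omega S} {N : ℕ}
    (hN : ∀ n, N ≤ n → 𝒳.dirPt S t (r.1 n) = x) : 𝒳.coordEnd S (Quotient.mk _ r) t = x := by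
  obtain ⟨N', hN'⟩ := h.coordEnd_mk r t
  rw [(hN' (N + N') (by omega)).2, hN _ (by omega)]

omit [Nonempty (𝒳.Omega S)] in
theorem exists_ray (ξ : 𝒢.Boundary S) (v : 𝒢.TreeVertex S) :
    ∃ r : 𝒢.Ray S, Quotient.mk _ r = ξ ∧ r.1 0 = v := by
  induction ξ using Quotient.inductionOn with
  | h r =>
    obtain ⟨r', h1, h2, m, n, h3⟩ := h.isTree.exists_ray_from (ray_isRay r) v
    refine ⟨⟨r', h1⟩, Quotient.sound ⟨n, m, fun k => (h3 k).symm⟩, h2⟩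

theorem vert_coordEnd (ξ : 𝒢.Boundary S) (t : 𝒢.TreeVertex S) :
    𝒳.vert S (𝒳.coordEnd S ξ t) = t := by
  induction ξ using Quotient.inductionOn with
  | h r =>
    obtain ⟨N, hN⟩ := h.coordEnd_mk r t
    rw [(hN N le_rfl).2, h.vert_dirPt (hN N le_rfl).1.symm]

theorem coordEnd_ray (r : 𝒢.Ray S) (m : ℕ) :
    𝒳.coordEnd S (Quotient.mk _ r) (r.1 m) = 𝒳.dirPt S (r.1 m) (r.1 (m + 1)) := by
  refine h.coordEnd_eq_of_forall_ge (N := m + 1) fun n hn => dirPt_congr ?_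
  obtain ⟨k, rfl⟩ := Nat.exists_eq_add_of_le hn
  rw [((h.isTree.mem_halfSpace_iff (r.2.1 m)).1 (h.isTree.ray_mem_halfSpace (ray_isRay r) m k)).2,
    h.isTree.next_of_adj (r.2.1 m)]

theorem coordEnd_eq_dirPt (r : 𝒢.Ray S) {m : ℕ} {t : 𝒢.TreeVertex S}
    (ht : t ∉ (𝒢.tree S).halfSpace (r.1 m) (r.1 (m + 1))) :
    𝒳.coordEnd S (Quotient.mk _ r) t = 𝒳.dirPt S t (r.1 (m + 1)) := by
  refine h.coordEnd_eq_of_forall_ge (N := m + 1) fun n hn => ?_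
  obtain ⟨k, rfl⟩ := Nat.exists_eq_add_of_le hn
  exact h.dirPt_halfSpace ((h.isTree.mem_halfSpace_or (r.2.1 m) t).resolve_left ht)
    (h.isTree.ray_mem_halfSpace (ray_isRay r) m k)

/-- On a ray to `ξ` that starts in `D(z)`, the coordinate of `z` at each vertex is the point of the
next edge, so the ray never leaves `D(z)`. -/
theorem mem_boundaryOf_of_coord_eq {ξ : 𝒢.Boundary S} {z : 𝒳.OmegaQuot S}
    (hz : 𝒳.coordEnd S ξ = 𝒳.coord S z) : ξ ∈ 𝒢.boundaryOf S (𝒳.domain S z) := by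
  obtain ⟨v, hv⟩ := domain_nonempty z
  obtain ⟨r, rfl, rfl⟩ := h.exists_ray ξ v
  refine ⟨r, rfl, fun n => ?_⟩
  induction n with
  | zero => exact hv
  | succ n ih =>
    have hadj := r.2.1 n
    rw [← h.isTree.next_of_adj hadj]
    refine h.next_mem_domain ih hadj.ne ?_
    rw [← hz, h.coordEnd_ray]

theorem coord_eq_of_mem_boundaryOf {ξ : 𝒢.Boundary S} {z : 𝒳.OmegaQuot S}
    (hz : ξ ∈ 𝒢.boundaryOf S (𝒳.domain S z)) : 𝒳.coordEnd S ξ = 𝒳.coord S z := by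
  obtain ⟨r, rfl, hr⟩ := hz
  ext1 t
  obtain ⟨N, hN⟩ := h.coordEnd_mk r t
  rw [(hN N le_rfl).2, h.coord_of_mem_domain (hr N) (hN N le_rfl).1.symm]

/-- Let two rays from one origin separate after `r k`. Any other vertex lies outside the branch of
at least one of them, hence sees that ray in the direction of `r k`. The common coordinates are then
those of the point of `Ω/∼` given by the coordinate at `r k`. -/
theorem eq_or_exists_coord_eq {ξ ζ : 𝒢.Boundary S} (hξ : 𝒳.coordEnd S ξ = 𝒳.coordEnd S ζ) :
    ξ = ζ ∨ ∃ z, 𝒳.coordEnd S ξ = 𝒳.coord S z := by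
  classical
  have ⟨v⟩ : Nonempty (𝒢.TreeVertex S) := h.isTree.1.nonempty
  obtain ⟨r, rfl, hr⟩ := h.exists_ray ξ v
  obtain ⟨s, rfl, hs⟩ := h.exists_ray ζ v
  by_cases hrs : ∃ k, r.1 k ≠ s.1 k
  · right
    have h1 := Nat.find_spec hrs
    have h2 : Nat.find hrs ≠ 0 := fun h0 => h1 (by rw [h0, hr, hs])
    obtain ⟨k, hk⟩ := Nat.exists_eq_succ_of_ne_zero h2
    have h3 : r.1 k = s.1 k := by
      by_contra h3
      have := Nat.find_min' hrs h3
      omega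
    rw [hk] at h1
    refine ⟨𝒳.toQuot S (𝒳.coordEnd S (Quotient.mk _ r) (r.1 k)), ?_⟩
    have h4 := h.vert_coordEnd (Quotient.mk _ r) (r.1 k)
    ext1 t
    rw [h.coord_toQuot]
    by_cases ht : t = r.1 k
    · subst ht
      have h5 := coordPt_vert (𝒳.coordEnd S (Quotient.mk _ r) (r.1 k))
      rw [h4] at h5
      exact h5.symm
    · rw [coordPt_of_ne (by rwa [h4]), h4]
      have key : ∀ r : 𝒢.Ray S, t ≠ r.1 k →
          t ∉ (𝒢.tree S).halfSpace (r.1 k) (r.1 (k + 1)) →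
          𝒳.coordEnd S (Quotient.mk _ r) t = 𝒳.dirPt S t (r.1 k) := by
        intro r ht hr
        rw [h.coordEnd_eq_dirPt r hr]
        by_cases ht' : t = r.1 (k + 1)
        · subst ht'
          exact absurd (h.isTree.ray_mem_halfSpace (ray_isRay r) k 0) hr
        · exact (h.dirPt_eq_of_adj (r.2.1 k) ht ht').symm
      by_cases ht2 : t ∈ (𝒢.tree S).halfSpace (r.1 k) (r.1 (k + 1))
      · rw [hξ, h3]
        rw [h3] at ht
        refine key s ht fun ht3 => h1 ?_
        have h5 := ((h.isTree.mem_halfSpace_iff (r.2.1 k)).1 ht2).2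
        rw [h3] at h5
        exact h5.symm.trans ((h.isTree.mem_halfSpace_iff (s.2.1 k)).1 ht3).2
      · exact key r ht ht2
  · push Not at hrs
    exact Or.inl (congrArg _ (Subtype.ext (funext hrs)))

theorem coords_mk (a : 𝒢.Boundary S ⊕ 𝒳.OmegaQuot S) :
    𝒳.coords S (Quot.mk _ a) = Sum.elim (𝒳.coordEnd S) (𝒳.coord S) a := by
  have key : ∀ a b, Relation.EqvGen (𝒳.Ident S) a b →
      Sum.elim (𝒳.coordEnd S) (𝒳.coord S) a = Sum.elim (𝒳.coordEnd S) (𝒳.coord S) b := by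
    intro a b hab
    induction hab with
    | rel a b hab =>
      obtain ⟨ξ, x, rfl, rfl, hx⟩ := hab
      exact h.coord_eq_of_mem_boundaryOf hx
    | refl a => rfl
    | symm a b _ ih => exact ih.symm
    | trans a b c _ _ ih1 ih2 => exact ih1.trans ih2
  exact key _ _ (Quot.eqvGen_exact (Quot.out_eq (Quot.mk (𝒳.Ident S) a)))

theorem coords_ofPt (z : 𝒳.OmegaQuot S) : 𝒳.coords S (𝒳.ofPt S z) = 𝒳.coord S z :=
  h.coords_mk (Sum.inr z)

theorem coords_ofEnd (ξ : 𝒢.Boundary S) : 𝒳.coords S (𝒳.ofEnd S ξ) = 𝒳.coordEnd S ξ :=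
  h.coords_mk (Sum.inl ξ)

omit h [Nonempty (𝒳.Omega S)] in
theorem exists_ofPt_or_ofEnd (m : 𝒳.M S) :
    (∃ z, m = 𝒳.ofPt S z) ∨ ∃ ξ ∈ 𝒳.FreeEnds S, m = 𝒳.ofEnd S ξ := by
  obtain ⟨ξ | z⟩ := m
  · by_cases hξ : ξ ∈ 𝒳.FreeEnds S
    · exact Or.inr ⟨ξ, hξ, rfl⟩
    · simp only [FreeEnds, mem_ofPred_eq, not_forall, not_not] at hξ
      obtain ⟨z, hz⟩ := hξ
      exact Or.inl ⟨z, Quot.sound ⟨ξ, z, rfl, rfl, hz⟩⟩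
  · exact Or.inl ⟨z, rfl⟩

theorem vert_coords (m : 𝒳.M S) (t : 𝒢.TreeVertex S) : 𝒳.vert S (𝒳.coords S m t) = t := by
  rcases exists_ofPt_or_ofEnd m with ⟨z, rfl⟩ | ⟨ξ, -, rfl⟩
  · rw [h.coords_ofPt, h.vert_coord]
  · rw [h.coords_ofEnd, h.vert_coordEnd]

theorem coords_injective : Function.Injective (𝒳.coords S) := by
  have hpt : ∀ (z : 𝒳.OmegaQuot S) (ξ : 𝒢.Boundary S), 𝒳.coordEnd S ξ = 𝒳.coord S z →
      𝒳.ofEnd S ξ = 𝒳.ofPt S z := fun z ξ hz =>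
    Quot.sound ⟨ξ, z, rfl, rfl, h.mem_boundaryOf_of_coord_eq hz⟩
  intro m m' hm
  rcases exists_ofPt_or_ofEnd m with ⟨z, rfl⟩ | ⟨ξ, -, rfl⟩ <;>
    rcases exists_ofPt_or_ofEnd m' with ⟨z', rfl⟩ | ⟨ξ', -, rfl⟩ <;>
    simp only [h.coords_ofPt, h.coords_ofEnd] at hm
  · rw [h.coord_injective hm]
  · exact (hpt _ _ hm.symm).symm
  · exact hpt _ _ hm
  · rcases h.eq_or_exists_coord_eq hm with rfl | ⟨z, hz⟩
    · rfl
    · rw [hpt _ _ hz, hpt _ _ (hm.symm.trans hz)]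

/-- The coherence of the projections of a point of `M`. -/
theorem coords_coherent (m : 𝒳.M S) {v w : 𝒢.TreeVertex S} (hvw : v ≠ w)
    (hv : 𝒳.coords S m v ≠ 𝒳.dirPt S v w) : 𝒳.coords S m w = 𝒳.dirPt S w v := by
  rcases exists_ofPt_or_ofEnd m with ⟨z, rfl⟩ | ⟨ξ, -, rfl⟩
  · rw [h.coords_ofPt] at hv ⊢
    obtain ⟨u, hu⟩ := domain_nonempty z
    by_cases huv : v = u
    · subst huv
      exact h.coord_of_mem_domain hu hvw.symm
    by_cases huw : w = u
    · subst huw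
      exact absurd (h.coord_of_mem_domain hu hvw) hv
    rw [h.coord_of_mem_domain hu huv] at hv
    rw [h.coord_of_mem_domain hu huw]
    by_contra hw
    -- If neither coordinate pointed to the other vertex, `v` would lie on `[u, w]` and `w` on `[u,
    -- v]`.
    refine hvw (h.isTree.eq_of_mem_geodesicSegment (v := u) ?_ ?_)
    · by_contra h1
      exact hv (h.dirPt_eq_of_notMem h1)
    · by_contra h1
      exact hw (h.dirPt_eq_of_notMem h1)
  · rw [h.coords_ofEnd] at hv ⊢
    induction ξ using Quotient.inductionOn with
    | h r =>
      obtain ⟨N, hN⟩ := h.coordEnd_mk r v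
      obtain ⟨N', hN'⟩ := h.coordEnd_mk r w
      rw [(hN (N + N') (by omega)).2] at hv
      rw [(hN' (N + N') (by omega)).2]
      by_contra hw
      refine hvw (h.isTree.eq_of_mem_geodesicSegment (v := r.1 (N + N')) ?_ ?_)
      · by_contra h1
        exact hv (h.dirPt_eq_of_notMem h1)
      · by_contra h1
        exact hw (h.dirPt_eq_of_notMem h1)

/-- Every coherent family of points of the compacta comes from a point of `M`. -/
theorem exists_coords_eq (y : 𝒢.TreeVertex S → 𝒳.Omega S) (hy : ∀ v, 𝒳.vert S (y v) = v)
    (hc : ∀ v w, v ≠ w → y v = 𝒳.dirPt S v w ∨ y w = 𝒳.dirPt S w v) :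
    ∃ m, 𝒳.coords S m = y := by
  by_contra! hcon
  -- If all coordinates pointed to `v`, the family would come from the point `y v`. Otherwise a
  -- witness `f v` shows in which direction to leave `v`; following these directions leads to an
  -- end.
  have h1 : ∀ v, ∃ w, w ≠ v ∧ y w ≠ 𝒳.dirPt S w v := by
    intro v
    by_contra! h1
    refine hcon (𝒳.ofPt S (𝒳.toQuot S (y v))) ?_
    rw [h.coords_ofPt]
    ext1 t
    by_cases ht : t = v
    · subst ht
      exact h.coord_eq_of_vert (hy t)
    · rw [h1 t ht]
      exact h.coord_of_mem_domain ⟨y v, hy v, rfl⟩ ht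
  choose f hf hf' using h1
  let n : 𝒢.TreeVertex S → 𝒢.TreeVertex S := fun v => (𝒢.tree S).next v (f v)
  have hn : ∀ v, (𝒢.tree S).Adj v (n v) := fun v => (h.isTree.next_spec (hf v).symm).1
  have hfn : ∀ v, f v ∈ (𝒢.tree S).halfSpace v (n v) := fun v =>
    (h.isTree.next_spec (hf v).symm).2
  -- A step back would put `f v` and `f (n v)` on opposite sides of an edge, with neither coordinate
  -- pointing to the other vertex, against coherence.
  have hback : ∀ v, n (n v) ≠ v := by
    intro v hv
    have h2 := hfn (n v)
    have h3 := hfn v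
    rw [hv] at h2
    have h4 : f v ≠ f (n v) := by
      intro h4
      simp only [SimpleGraph.halfSpace, mem_ofPred_eq, h4] at h2 h3
      omega
    rcases hc _ _ h4 with h5 | h5
    · rw [h.dirPt_halfSpace h3 h2] at h5
      exact hf' v h5
    · rw [h.dirPt_halfSpace h2 h3] at h5
      exact hf' (n v) h5
  have ⟨v₀⟩ : Nonempty (𝒢.TreeVertex S) := h.isTree.1.nonempty
  have hray : (𝒢.tree S).IsRay (fun k => n^[k] v₀) := by
    refine h.isTree.isRay_of_not_backtrack (fun k => ?_) (fun k => ?_)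
    · rw [Function.iterate_succ_apply']
      exact hn _
    · rw [Function.iterate_succ_apply', Function.iterate_succ_apply']
      exact hback _
  let r : 𝒢.Ray S := ⟨_, hray⟩
  refine hcon (𝒳.ofEnd S (Quotient.mk _ r)) ((h.coords_ofEnd _).trans ?_)
  ext1 t
  obtain ⟨N, hN⟩ := h.coordEnd_mk r t
  obtain ⟨N', hN'⟩ := h.isTree.exists_dist_ray hray t
  have h2 := (hN (N + N') (by omega))
  have h3 := hN' (N + N') (by omega)
  have h4 := (hN (N + N' + 1) (by omega)).2
  rw [h4]
  by_contra h5
  have h6 : t ∈ (𝒢.tree S).halfSpace (r.1 (N + N' + 1)) (r.1 (N + N')) := by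
    simp only [SimpleGraph.halfSpace, mem_ofPred_eq]
    rw [SimpleGraph.dist_comm, h3, SimpleGraph.dist_comm]
  have h7 : r.1 (N + N' + 1) = n (r.1 (N + N')) := Function.iterate_succ_apply' _ _ _
  have h8 := hfn (r.1 (N + N'))
  rw [← h7] at h8
  have h9 : t ≠ f (r.1 (N + N')) := by
    rintro h9
    rw [← h9] at h8
    simp only [SimpleGraph.halfSpace, mem_ofPred_eq] at h6 h8
    omega
  -- Far along the ray, `t` lies behind an edge of the ray and the witness ahead of it. The
  -- coordinate at the witness does not point back, so the coordinate at `t` points along the ray.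
  rcases hc _ _ h9 with h10 | h10
  · rw [h.dirPt_halfSpace h6 h8] at h10
    exact h5 h10.symm
  · rw [h.dirPt_halfSpace h8 h6] at h10
    exact hf' _ h10

end IsTreeOfSpaces

end VertexSpaces

end GraphOfGroups

/-! ### The topology of `M` is that of a closed subspace of a product -/

namespace GraphOfGroups

namespace VertexSpaces

variable {V E : Type*} {𝒢 : GraphOfGroups V E} {𝒳 : VertexSpaces 𝒢} {S : Set E}

section OmegaTopology

theorem isOpen_iff_pt {U : Set (𝒳.Omega S)} :
    IsOpen U ↔ ∀ v g, IsOpen (𝒳.pt S v g ⁻¹' U) := by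
  simp only [isOpen_iSup_iff, isOpen_coinduced]

theorem continuous_pt (v : V) (g : 𝒢.π₁ S) : Continuous (𝒳.pt S v g) :=
  ⟨fun _ hU => isOpen_iff_pt.1 hU v g⟩

theorem isOpen_fibre (c : 𝒢.TreeVertex S) : IsOpen (𝒳.fibre S c) := by
  refine isOpen_iff_pt.2 fun v g => ?_
  by_cases hc : 𝒢.coset S v g = c
  · convert isOpen_univ
    exact eq_univ_of_forall fun x => hc
  · convert isOpen_empty
    exact eq_empty_of_forall_notMem fun x hx => hc hx

theorem continuous_smul_omega (g : 𝒢.π₁ S) : Continuous fun x : 𝒳.Omega S => g • x := by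
  refine ⟨fun U hU => isOpen_iff_pt.2 fun v k => ?_⟩
  exact isOpen_iff_pt.1 hU v (g * k)

theorem fibre_eq_range (v : V) (g : 𝒢.π₁ S) :
    𝒳.fibre S (𝒢.coset S v g) = range (𝒳.pt S v g) := by
  ext x
  constructor
  · intro hx
    obtain ⟨y, rfl⟩ := exists_pt_of_vert hx
    exact ⟨y, rfl⟩
  · rintro ⟨y, rfl⟩
    exact vert_pt v g y

theorem pt_injective (hι : ∀ v, Function.Injective (𝒢.ι S v)) (v : V) (g : 𝒢.π₁ S) :
    Function.Injective (𝒳.pt S v g) := by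
  intro x y hxy
  obtain ⟨a, h1, h2⟩ : (𝒳.fibreSetoid S v) (g, x) (g, y) :=
    Quotient.exact (eq_of_heq (Sigma.mk.inj hxy).2)
  rw [inv_mul_cancel, ← map_one (𝒢.ι S v)] at h1
  rw [← hι v h1, one_smul] at h2
  exact h2

theorem isOpenEmbedding_pt (hι : ∀ v, Function.Injective (𝒢.ι S v))
    (hcont : ∀ v (a : 𝒢.G v), Continuous fun x : 𝒳.X v => a • x) (v : V) (g : 𝒢.π₁ S) :
    IsOpenEmbedding (𝒳.pt S v g) := by
  refine .of_continuous_injective_isOpenMap (continuous_pt v g) (pt_injective hι v g) ?_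
  intro U hU
  refine isOpen_iff_pt.2 fun w k => ?_
  by_cases hc : 𝒢.coset S w k = 𝒢.coset S v g
  · obtain rfl : w = v := (Sigma.mk.inj hc).1
    obtain ⟨a, rfl⟩ := coset_eq_iff.1 hc.symm
    convert hU.preimage (hcont w a) using 1
    ext x
    simp only [mem_preimage, pt_mul, (pt_injective hι w g).mem_set_image]
  · convert isOpen_empty
    refine eq_empty_of_forall_notMem fun x hx => hc ?_
    obtain ⟨y, -, hy⟩ := hx
    rw [← vert_pt w k x, ← hy, vert_pt]

variable (hι : ∀ v, Function.Injective (𝒢.ι S v)) (hconv : ∀ v, IsConvergenceGroupOn (𝒢.G v) (𝒳.X v))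
include hconv

theorem isCompact_fibre (c : 𝒢.TreeVertex S) : IsCompact (𝒳.fibre S c) := by
  obtain ⟨g, hg⟩ := exists_coset c
  have := (hconv c.1).compact
  rw [hg, fibre_eq_range]
  exact isCompact_range (continuous_pt _ _)

include hι

theorem isOpenEmbedding_pt' (v : V) (g : 𝒢.π₁ S) : IsOpenEmbedding (𝒳.pt S v g) :=
  isOpenEmbedding_pt hι (fun v => (hconv v).continuous_smul) v g

theorem t2Space_omega : T2Space (𝒳.Omega S) := by
  refine ⟨fun x y hxy => ?_⟩
  by_cases hv : 𝒳.vert S x = 𝒳.vert S y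
  · obtain ⟨v, g, x, rfl⟩ := exists_pt x
    obtain ⟨y, rfl⟩ := exists_pt_of_vert hv.symm
    have := (hconv v).metrizable
    obtain ⟨A, B, hA, hB, hxA, hyB, hAB⟩ := t2_separation (ne_of_apply_ne _ hxy)
    have ho := isOpenEmbedding_pt' hι hconv v g
    exact ⟨_, _, ho.isOpenMap A hA, ho.isOpenMap B hB, mem_image_of_mem _ hxA,
      mem_image_of_mem _ hyB, (disjoint_image_iff ho.injective).2 hAB⟩
  · refine ⟨_, _, isOpen_fibre (𝒳.vert S x), isOpen_fibre (𝒳.vert S y), rfl, rfl, ?_⟩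
    exact disjoint_left.2 fun z h1 h2 => hv (h1.symm.trans h2)

theorem secondCountable_omega [Countable (𝒢.TreeVertex S)] :
    SecondCountableTopology (𝒳.Omega S) := by
  have hfib : ∀ c : 𝒢.TreeVertex S, SecondCountableTopology (𝒳.fibre S c) := by
    intro c
    obtain ⟨g, hg⟩ := exists_coset c
    have := (hconv c.1).compact
    have := (hconv c.1).metrizable
    let _ := TopologicalSpace.metrizableSpaceMetric (𝒳.X c.1)
    rw [hg, fibre_eq_range]
    exact (isOpenEmbedding_pt' hι hconv c.1
      g).isEmbedding.toHomeomorph.symm.secondCountableTopology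
  refine TopologicalSpace.secondCountableTopology_of_countable_cover (fun c => isOpen_fibre c) ?_
  exact eq_univ_of_forall fun x => mem_iUnion.2 ⟨𝒳.vert S x, rfl⟩

end OmegaTopology

variable [Nonempty (𝒳.Omega S)]

namespace IsTreeOfSpaces

variable (h : 𝒳.IsTreeOfSpaces S)
include h

theorem mem_branches_iff {v w : 𝒢.TreeVertex S} {U : Set (𝒳.Omega S)} :
    w ∈ 𝒳.branches S v U ↔ v ≠ w ∧ 𝒳.dirPt S v w ∈ U := by
  constructor
  · rintro ⟨x, y, hxy, rfl, hx, hd⟩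
    have hne : 𝒳.vert S x ≠ w := by rintro rfl; simp at hd
    refine ⟨hne, ?_⟩
    rwa [h.dirPt_of_glued hxy hne (h.isTree.eq_next (h.adj_of_glued hxy) hd).symm]
  · rintro ⟨hne, hU⟩
    obtain ⟨y, h1, h2, h3⟩ := h.dirPt_spec hne
    exact ⟨_, y, h1, h2, hU, by rw [h3, (h.isTree.next_spec hne).2]⟩

theorem mem_boundaryOf_branches_iff {ξ : 𝒢.Boundary S} {v : 𝒢.TreeVertex S}
    {U : Set (𝒳.Omega S)} :
    ξ ∈ 𝒢.boundaryOf S (𝒳.branches S v U) ↔ 𝒳.coordEnd S ξ v ∈ U := by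
  constructor
  · rintro ⟨r, rfl, hr⟩
    obtain ⟨N, hN⟩ := h.coordEnd_mk r v
    rw [(hN N le_rfl).2]
    exact (h.mem_branches_iff.1 (hr N)).2
  · intro hU
    induction ξ using Quotient.inductionOn with
    | h r =>
      obtain ⟨N, hN⟩ := h.coordEnd_mk r v
      refine ⟨⟨fun n => r.1 (N + n), fun n => r.2.1 (N + n), fun a b hab => by
        simpa using r.2.2 hab⟩, Quotient.sound ⟨0, N, fun k => by simp⟩, fun n => ?_⟩
      have h1 := hN (N + n) (by omega)
      exact h.mem_branches_iff.2 ⟨h1.1.symm, h1.2 ▸ hU⟩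

/-- The three kinds of points in the definition amount to one condition on coordinates. A point in
`U v` for a single `v` meets the conditions at the other vertices of `D(z)` because there it has the
same coordinate as `z`. -/
theorem nhdPt_eq {z : 𝒳.OmegaQuot S} {U : 𝒢.TreeVertex S → Set (𝒳.Omega S)}
    (hU : 𝒳.IsNhdFamily S z U) :
    𝒳.nhdPt S z U = {m | ∀ v ∈ 𝒳.domain S z, 𝒳.coords S m v ∈ U v} := by
  ext m
  constructor
  · rintro ((⟨ξ, ⟨-, hξ⟩, rfl⟩ | ⟨y, ⟨hd, hy⟩, rfl⟩) | ⟨y, ⟨v, hv, x, hx, rfl⟩, rfl⟩) w hw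
    · rw [h.coords_ofEnd]
      exact h.mem_boundaryOf_branches_iff.1 (hξ w hw)
    · rw [h.coords_ofPt]
      obtain ⟨u, hu⟩ := domain_nonempty y
      obtain ⟨h1, h2⟩ := h.mem_branches_iff.1 (hy w hw hu)
      rwa [h.coord_of_mem_domain hu h1]
    · rw [h.coords_ofPt]
      by_cases hwv : w = v
      · subst hwv
        rwa [h.coord_eq_of_vert (hU.subset w hv hx)]
      · rw [h.coord_of_mem_domain ⟨x, hU.subset v hv hx, rfl⟩ hwv,
          ← h.coord_of_mem_domain hv hwv]
        obtain ⟨x', hx', rfl⟩ := hU.mem w hw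
        rwa [h.coord_eq_of_vert (hU.subset w hw hx')]
  · intro hm
    rcases exists_ofPt_or_ofEnd m with ⟨y, rfl⟩ | ⟨ξ, hξ, rfl⟩
    · simp only [mem_ofPred_eq, h.coords_ofPt] at hm
      by_cases hd : Disjoint (𝒳.domain S y) (𝒳.domain S z)
      · refine Or.inl (Or.inr ⟨y, ⟨hd, fun v hv w hw => ?_⟩, rfl⟩)
        have hvw : v ≠ w := fun hvw => disjoint_left.1 hd hw (hvw ▸ hv)
        exact h.mem_branches_iff.2 ⟨hvw, h.coord_of_mem_domain hw hvw ▸ hm v hv⟩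
      · obtain ⟨v, hv, hv'⟩ := not_disjoint_iff.1 hd
        exact Or.inr ⟨y, ⟨v, hv', _, hm v hv', h.mem_domain_iff.1 hv⟩, rfl⟩
    · simp only [mem_ofPred_eq, h.coords_ofEnd] at hm
      exact Or.inl (Or.inl ⟨ξ, ⟨hξ, fun v hv => h.mem_boundaryOf_branches_iff.2 (hm v hv)⟩, rfl⟩)

theorem nhdEnd_eq (r : 𝒢.Ray S) (m : ℕ) : 𝒳.nhdEnd S r m =
    {x | ∃ t ∈ (𝒢.tree S).halfSpace (r.1 m) (r.1 (m + 1)),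
      𝒳.coords S x t ≠ 𝒳.dirPt S t (r.1 m)} := by
  have htail : rayTail S r m = (𝒢.tree S).halfSpace (r.1 m) (r.1 (m + 1)) :=
    Set.ext fun w => (h.isTree.mem_halfSpace_ray_iff (ray_isRay r) m).symm
  have hadj := r.2.1 m
  unfold nhdEnd
  rw [htail]
  generalize r.1 m = a at *
  generalize r.1 (m + 1) = b at *
  have hne : ∀ {t}, t ∈ (𝒢.tree S).halfSpace a b → t ≠ a := by
    rintro t ht rfl
    simp [SimpleGraph.halfSpace] at ht
  ext x
  constructor
  · rintro (⟨ζ, ⟨hζ, s, rfl, hs⟩, rfl⟩ | ⟨y, hy, rfl⟩)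
    · by_contra! hcon
      rw [mem_ofPred_eq] at hcon
      push Not at hcon
      replace hcon : ∀ t ∈ (𝒢.tree S).halfSpace a b,
          𝒳.coordEnd S (Quotient.mk _ s) t = 𝒳.dirPt S t a := fun t ht =>
        (congrFun (h.coords_ofEnd _) t).symm.trans (hcon t ht)
      -- If all coordinates beyond the edge pointed back to `a`, the end would have the coordinates
      -- of the point of this edge and would not be free.
      refine hζ (𝒳.toQuot S (𝒳.dirPt S a b)) (h.mem_boundaryOf_of_coord_eq ?_)
      have ha : a ∈ 𝒳.domain S (𝒳.toQuot S (𝒳.dirPt S a b)) :=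
        ⟨_, h.vert_dirPt hadj.ne, rfl⟩
      have hb := h.next_mem_domain ha hadj.ne (h.coord_eq_of_vert (h.vert_dirPt hadj.ne))
      rw [h.isTree.next_of_adj hadj] at hb
      ext1 t
      by_cases ht : t ∈ (𝒢.tree S).halfSpace a b
      · rw [hcon t ht, h.coord_of_mem_domain ha (hne ht)]
      · have ht' := (h.isTree.mem_halfSpace_or hadj t).resolve_left ht
        have htb : t ≠ b := by
          rintro rfl
          simp [SimpleGraph.halfSpace] at ht'
        obtain ⟨N, hN⟩ := h.coordEnd_mk s t
        rw [(hN N le_rfl).2, h.coord_of_mem_domain hb htb, h.dirPt_halfSpace ht' (hs N)]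
    · obtain ⟨t, ht, hmin⟩ := exists_minimalFor_of_wellFoundedLT (· ∈ 𝒳.domain S y)
        (fun t => (𝒢.tree S).dist t a) (domain_nonempty y)
      refine ⟨t, hy ht, fun hta => ?_⟩
      rw [h.coords_ofPt] at hta
      have h1 := h.next_mem_domain ht (hne (hy ht)) hta
      have h2 := (h.isTree.next_spec (hne (hy ht))).2
      have h3 := hmin h1
      simp only at h3
      omega
  · rintro ⟨t, ht, hxt⟩
    rcases exists_ofPt_or_ofEnd x with ⟨y, rfl⟩ | ⟨ξ, hξ, rfl⟩
    · refine Or.inr ⟨y, fun w hw => ?_, rfl⟩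
      rw [h.coords_ofPt] at hxt
      by_contra hw'
      replace hw' := (h.isTree.mem_halfSpace_or hadj w).resolve_left hw'
      have hwt : t ≠ w := by
        rintro rfl
        simp only [SimpleGraph.halfSpace, mem_ofPred_eq] at ht hw'
        omega
      exact hxt (by rw [h.coord_of_mem_domain hw hwt, h.dirPt_halfSpace ht hw'])
    · refine Or.inl ⟨ξ, ⟨hξ, ?_⟩, rfl⟩
      rw [h.coords_ofEnd] at hxt
      induction ξ using Quotient.inductionOn with
      | h s =>
        obtain ⟨N, hN⟩ := h.coordEnd_mk s t
        refine ⟨⟨fun n => s.1 (N + n), fun n => s.2.1 (N + n), fun a b hab => by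
          simpa using s.2.2 hab⟩, Quotient.sound ⟨0, N, fun k => by simp⟩, fun n => ?_⟩
        by_contra hw'
        replace hw' := (h.isTree.mem_halfSpace_or hadj (s.1 (N + n))).resolve_left hw'
        exact hxt (by rw [(hN (N + n) (by omega)).2, h.dirPt_halfSpace ht hw'])

theorem continuous_coords [T1Space (𝒳.Omega S)] : Continuous (𝒳.coords S) := by
  refine continuous_pi fun t => ⟨fun O hO => isOpen_iff_forall_mem_open.2 fun m hm => ?_⟩
  rcases exists_ofPt_or_ofEnd m with ⟨z, rfl⟩ | ⟨ξ, hξ, rfl⟩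
  · classical
    rw [mem_preimage, h.coords_ofPt] at hm
    have hopen : ∀ U, 𝒳.IsNhdFamily S z U →
        IsOpen {m | ∀ v ∈ 𝒳.domain S z, 𝒳.coords S m v ∈ U v} := fun U hU =>
      h.nhdPt_eq hU ▸ TopologicalSpace.isOpen_generateFrom_of_mem (Or.inl ⟨z, U, hU, rfl⟩)
    have hfam : ∀ w ∈ 𝒳.domain S z, ∀ A : Set (𝒳.Omega S), IsOpen A → 𝒳.coord S z w ∈ A →
        ∃ W : Set (𝒳.M S), IsOpen W ∧ 𝒳.ofPt S z ∈ W ∧ ∀ m ∈ W, 𝒳.coords S m w ∈ A := by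
      intro w hw A hA hzA
      let U : 𝒢.TreeVertex S → Set (𝒳.Omega S) := fun v =>
        if v = w then A ∩ 𝒳.fibre S v else 𝒳.fibre S v
      have hzU : ∀ v, 𝒳.coord S z v ∈ U v := by
        intro v
        by_cases hvw : v = w
        · subst hvw
          simpa [U] using ⟨hzA, h.vert_coord z v⟩
        · simp only [U, if_neg hvw]
          exact h.vert_coord z v
      have hU : 𝒳.IsNhdFamily S z U :=
        { subset := fun v _ => by
            by_cases hvw : v = w
            · simp [U, hvw]
            · simp [U, hvw]
          isOpen := fun v _ => by
            by_cases hvw : v = w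
            · subst hvw
              simpa [U] using hA.inter (isOpen_fibre v)
            · simpa [U, hvw] using isOpen_fibre v
          mem := fun v hv => ⟨_, hzU v, h.mem_domain_iff.1 hv⟩
          finite := (finite_singleton w).subset fun v hv => by
            by_contra hvw
            exact hv.2 (if_neg hvw) }
      refine ⟨_, hopen U hU, fun v _ => h.coords_ofPt z ▸ hzU v, fun m hm => ?_⟩
      have := hm w hw
      simp only [U, if_true] at this
      exact this.1
    by_cases ht : t ∈ 𝒳.domain S z
    · obtain ⟨W, h1, h2, h3⟩ := hfam t ht O hO hm
      exact ⟨W, h3, h1, h2⟩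
    -- At the vertex `w` of `D(z)` nearest to `t`, the coordinate of `z` does not point to `t`. This
    -- persists near `z`, and by coherence the coordinate at `t` is then locally constant.
    · obtain ⟨w, hw, hmin⟩ := exists_minimalFor_of_wellFoundedLT (· ∈ 𝒳.domain S z)
        (fun w => (𝒢.tree S).dist w t) (domain_nonempty z)
      have hwt : w ≠ t := fun hwt => ht (hwt ▸ hw)
      have hne : 𝒳.coord S z w ≠ 𝒳.dirPt S w t := by
        intro hwz
        have h1 := h.next_mem_domain hw hwt hwz
        have h2 := (h.isTree.next_spec hwt).2
        have h3 := hmin h1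
        simp only at h3
        omega
      obtain ⟨W, h1, h2, h3⟩ := hfam w hw {𝒳.dirPt S w t}ᶜ isOpen_compl_singleton hne
      refine ⟨W, fun m' hm' => ?_, h1, h2⟩
      rw [mem_preimage, h.coords_coherent m' hwt (h3 m' hm'), ← h.coord_of_mem_domain hw hwt.symm]
      exact hm
  -- With `t` as base vertex, the coordinate at `t` is constant on the basic neighbourhood `W_0(ξ)`.
  · obtain ⟨r, rfl, rfl⟩ := h.exists_ray ξ t
    have hm' : 𝒳.coords S (𝒳.ofEnd S (Quotient.mk _ r)) (r.1 0) ∈ O := hm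
    have hopen : IsOpen (𝒳.nhdEnd S r 0) :=
      TopologicalSpace.isOpen_generateFrom_of_mem (Or.inr ⟨r, 0, hξ, rfl⟩)
    refine ⟨_, fun x hx => ?_, hopen, Or.inl ⟨_, ⟨hξ, ?_⟩, rfl⟩⟩
    · rw [h.nhdEnd_eq] at hx
      obtain ⟨s, hs, hxs⟩ := hx
      have hne : r.1 0 ≠ s := by
        rintro rfl
        simp [SimpleGraph.halfSpace] at hs
      have h2 : 𝒳.dirPt S (r.1 0) (r.1 1) ∈ O :=
        mem_of_eq_of_mem ((congrFun (h.coords_ofEnd _) _).trans (h.coordEnd_ray r 0)).symm hm'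
      rw [mem_preimage, h.coords_coherent x hne.symm hxs]
      rwa [dirPt_congr (w' := r.1 1)]
      rw [((h.isTree.mem_halfSpace_iff (r.2.1 0)).1 hs).2, h.isTree.next_of_adj (r.2.1 0)]
    · refine ⟨⟨fun n => r.1 (0 + 1 + n), fun n => r.2.1 (0 + 1 + n), fun a b hab => by
        simpa using r.2.2 hab⟩, Quotient.sound ⟨0, 1, fun k => by simp⟩, fun n => ?_⟩
      exact (h.isTree.mem_halfSpace_ray_iff (ray_isRay r) 0).1
        (h.isTree.ray_mem_halfSpace (ray_isRay r) 0 n)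

theorem isEmbedding_coords [T1Space (𝒳.Omega S)] : IsEmbedding (𝒳.coords S) := by
  refine ⟨⟨le_antisymm h.continuous_coords.le_induced (le_generateFrom ?_)⟩, h.coords_injective⟩
  let _ : TopologicalSpace (𝒳.M S) := TopologicalSpace.induced (𝒳.coords S) inferInstance
  have hc : Continuous (𝒳.coords S) := continuous_induced_dom
  have hc' : ∀ t, Continuous fun m => 𝒳.coords S m t := fun t => (continuous_apply t).comp hc
  rintro W (⟨z, U, hU, rfl⟩ | ⟨r, m, -, rfl⟩)
  · rw [h.nhdPt_eq hU]
    have heq : {m | ∀ v ∈ 𝒳.domain S z, 𝒳.coords S m v ∈ U v} =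
        ⋂ v ∈ {v ∈ 𝒳.domain S z | U v ≠ 𝒳.fibre S v}, (fun m => 𝒳.coords S m v) ⁻¹' U v := by
      ext m
      simp only [mem_ofPred_eq, mem_iInter, mem_preimage]
      refine ⟨fun hm v hv => hm v hv.1, fun hm v hv => ?_⟩
      by_cases hvU : U v = 𝒳.fibre S v
      · rw [hvU]
        exact h.vert_coords m v
      · exact hm v ⟨hv, hvU⟩
    rw [heq]
    exact hU.finite.isOpen_biInter fun v hv => (hU.isOpen v hv.1).preimage (hc' v)
  · rw [h.nhdEnd_eq]
    have heq : {x | ∃ t ∈ (𝒢.tree S).halfSpace (r.1 m) (r.1 (m + 1)),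
        𝒳.coords S x t ≠ 𝒳.dirPt S t (r.1 m)} =
        ⋃ t ∈ (𝒢.tree S).halfSpace (r.1 m) (r.1 (m + 1)),
          (fun x => 𝒳.coords S x t) ⁻¹' {𝒳.dirPt S t (r.1 m)}ᶜ := by
      ext x
      simp
    rw [heq]
    exact isOpen_biUnion fun t _ => isOpen_compl_singleton.preimage (hc' t)

theorem range_coords : range (𝒳.coords S) = {y | (∀ v, 𝒳.vert S (y v) = v) ∧
    ∀ v w, v ≠ w → y v = 𝒳.dirPt S v w ∨ y w = 𝒳.dirPt S w v} := by
  ext y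
  constructor
  · rintro ⟨m, rfl⟩
    exact ⟨h.vert_coords m, fun v w hvw => or_iff_not_imp_left.2 (h.coords_coherent m hvw)⟩
  · rintro ⟨h1, h2⟩
    exact h.exists_coords_eq y h1 h2

/-- Coherence involves two coordinates at a time and is closed, so the image of `coords` is closed
in the product of the compact fibres. -/
theorem compactSpace_M [T2Space (𝒳.Omega S)] (hf : ∀ c, IsCompact (𝒳.fibre S c)) :
    CompactSpace (𝒳.M S) := by
  have hcl : IsClosed (range (𝒳.coords S)) := by
    rw [h.range_coords]
    have heq : {y : 𝒢.TreeVertex S → 𝒳.Omega S | (∀ v, 𝒳.vert S (y v) = v) ∧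
        ∀ v w, v ≠ w → y v = 𝒳.dirPt S v w ∨ y w = 𝒳.dirPt S w v} =
        (⋂ v, (fun y => y v) ⁻¹' 𝒳.fibre S v) ∩ ⋂ v, ⋂ w, ⋂ (_ : v ≠ w),
          ((fun y => y v) ⁻¹' {𝒳.dirPt S v w} ∪ (fun y => y w) ⁻¹' {𝒳.dirPt S w v}) := by
      ext y
      simp [fibre]
    rw [heq]
    refine IsClosed.inter (isClosed_iInter fun v => (hf v).isClosed.preimage (continuous_apply v))
      (isClosed_iInter fun v => isClosed_iInter fun w => isClosed_iInter fun _ => ?_)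
    exact (isClosed_singleton.preimage (continuous_apply v)).union
      (isClosed_singleton.preimage (continuous_apply w))
  have hcomp : IsCompact (range (𝒳.coords S)) := by
    refine (isCompact_univ_pi hf).of_isClosed_subset hcl ?_
    rintro _ ⟨m, rfl⟩ v -
    exact h.vert_coords m v
  rw [← image_univ] at hcomp
  exact isCompact_univ_iff.1 (h.isEmbedding_coords.isCompact_iff.2 hcomp)

theorem metrizableSpace_M [T2Space (𝒳.Omega S)] [SecondCountableTopology (𝒳.Omega S)]
    [Countable (𝒢.TreeVertex S)] (hf : ∀ c, IsCompact (𝒳.fibre S c)) :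
    TopologicalSpace.MetrizableSpace (𝒳.M S) := by
  have := h.compactSpace_M hf
  have := h.isEmbedding_coords.t2Space
  have := h.isEmbedding_coords.secondCountableTopology
  exact TopologicalSpace.metrizableSpace_of_t3_secondCountable _

theorem coords_smul (g : 𝒢.π₁ S) (m : 𝒳.M S) (t : 𝒢.TreeVertex S) :
    𝒳.coords S (g • m) (g • t) = g • 𝒳.coords S m t := by
  rcases exists_ofPt_or_ofEnd m with ⟨⟨x⟩, rfl⟩ | ⟨ξ, -, rfl⟩
  · change 𝒳.coords S (𝒳.ofPt S (𝒳.toQuot S (g • x))) (g • t) =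
      g • 𝒳.coords S (𝒳.ofPt S (𝒳.toQuot S x)) t
    rw [h.coords_ofPt, h.coords_ofPt, h.coord_toQuot, h.coord_toQuot]
    by_cases ht : t = 𝒳.vert S x
    · subst ht
      rw [← vert_smul, coordPt_vert, coordPt_vert]
    · have hgt : g • t ≠ 𝒳.vert S (g • x) := by
        rw [vert_smul]
        exact fun he => ht (MulAction.injective g he)
      rw [coordPt_of_ne ht, coordPt_of_ne hgt, vert_smul, h.dirPt_smul g ht]
  · induction ξ using Quotient.inductionOn with
    | h r =>
      change 𝒳.coords S (𝒳.ofEnd S (Quotient.mk _ (𝒢.smulRay S g r))) (g • t) =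
        g • 𝒳.coords S (𝒳.ofEnd S (Quotient.mk _ r)) t
      obtain ⟨N, hN⟩ := h.coordEnd_mk r t
      have h1 : 𝒳.coordEnd S (Quotient.mk _ (𝒢.smulRay S g r)) (g • t) =
          g • 𝒳.coordEnd S (Quotient.mk _ r) t := by
        refine h.coordEnd_eq_of_forall_ge (N := N) fun n hn => ?_
        rw [(hN n hn).2]
        exact h.dirPt_smul g (hN n hn).1.symm
      exact (congrFun (h.coords_ofEnd _) _).trans
        (h1.trans (congrArg (g • ·) (congrFun (h.coords_ofEnd _) _).symm))

end IsTreeOfSpaces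

end VertexSpaces

end GraphOfGroups

/-! ### Convergence dynamics and parabolic points -/

section Collapse

variable {G X : Type*} [Group G] [TopologicalSpace X] [MulAction G X]

/-- The sequence `γ` collapses the complement of `η` to `ξ`, locally uniformly. -/
def Collapses (γ : ℕ → G) (ξ η : X) : Prop :=
  ∀ U ∈ 𝓝 ξ, ∀ N ∈ 𝓝 η, ∀ᶠ n in atTop, ∀ x ∉ N, γ n • x ∈ U

namespace Collapses

variable {γ : ℕ → G} {ξ η : X}

theorem comp (h : Collapses γ ξ η) {σ : ℕ → ℕ} (hσ : Tendsto σ atTop atTop) :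
    Collapses (fun n => γ (σ n)) ξ η :=
  fun U hU N hN => hσ.eventually (h U hU N hN)

theorem inv (h : Collapses γ ξ η) : Collapses (fun n => (γ n)⁻¹) η ξ := by
  intro N hN U hU
  filter_upwards [h U hU N hN] with n hn x hx
  by_contra hxN
  exact hx (by simpa using hn _ hxN)

theorem tendsto [T2Space X] (h : Collapses γ ξ η) {x : ℕ → X} {y : X}
    (hx : Tendsto x atTop (𝓝 y)) (hy : y ≠ η) : Tendsto (fun n => γ n • x n) atTop (𝓝 ξ) := by
  obtain ⟨A, B, hA, hB, hyA, hηB, hAB⟩ := t2_separation hy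
  refine tendsto_iff_forall_eventually_mem.2 fun U hU => ?_
  filter_upwards [h U hU B (hB.mem_nhds hηB), hx.eventually_mem (hA.mem_nhds hyA)] with n hn hxn
  exact hn _ (disjoint_left.1 hAB hxn)

theorem iff_isCompact [CompactSpace X] [T2Space X] : Collapses γ ξ η ↔
    ∀ K : Set X, IsCompact K → K ⊆ {η}ᶜ → ∀ U ∈ 𝓝 ξ, ∀ᶠ n in atTop, ∀ x ∈ K, γ n • x ∈ U := by
  constructor
  · intro h K hK hη U hU
    filter_upwards [h U hU Kᶜ (hK.isClosed.isOpen_compl.mem_nhds fun hK => hη hK rfl)] with n hn x hx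
    exact hn x fun hx' => hx' hx
  · intro h U hU N hN
    have h1 := h (interior N)ᶜ isOpen_interior.isClosed_compl.isCompact
      (fun x hx hxη => hx (hxη ▸ mem_interior_iff_mem_nhds.2 hN)) U hU
    filter_upwards [h1] with n hn x hx
    exact hn x fun hx' => hx (interior_subset hx')

end Collapses

/-- A sequence of elements that contracts the complement of a set has its attracting point in any
closed set into which it contracts. -/
theorem fixed_of_collapses [T2Space X] {g : G} (hg : Continuous fun x : X => g • x) {U N : Set X}
    (hU : IsClosed U) (hUN : Disjoint U N) (hmaps : ∀ x ∉ N, g • x ∈ U) {e : ℕ → ℕ} {ξ η : X}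
    (hcol : Collapses (fun n => g ^ (e n + 1)) ξ η) {a c : X} (ha : a ∈ U) (hc : c ∉ U)
    (hcN : c ∉ N) : ξ ∈ U ∧ (η ∈ N → g • ξ = ξ) := by
  have hpow : ∀ n, ∀ x ∉ N, g ^ (n + 1) • x ∈ U := by
    intro n
    induction n with
    | zero => simpa using hmaps
    | succ n ih =>
      intro x hx
      rw [pow_succ', mul_smul]
      exact hmaps _ (disjoint_left.1 hUN (ih x hx))
  have haN : a ∉ N := disjoint_left.1 hUN ha
  constructor
  · obtain ⟨x, hxN, hx⟩ : ∃ x ∉ N, x ≠ η := by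
      by_cases haη : a = η
      · exact ⟨c, hcN, fun h => hc (h ▸ haη ▸ ha)⟩
      · exact ⟨a, haN, haη⟩
    exact hU.mem_of_tendsto (hcol.tendsto tendsto_const_nhds hx)
      (Eventually.of_forall fun n => hpow _ x hxN)
  · intro hη
    -- Neither `a` nor `g • a` is repelling, so the powers of `g` send both to `ξ`; continuity of
    -- `g` identifies `g • ξ` with the second limit.
    have h1 := hcol.tendsto (x := fun _ => a) tendsto_const_nhds (fun h => haN (h ▸ hη))
    have h2 := hcol.tendsto (x := fun _ => g • a) tendsto_const_nhds
      (fun h => disjoint_left.1 hUN (hmaps a haN) (h ▸ hη))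
    refine tendsto_nhds_unique (((hg.tendsto ξ).comp h1).congr fun n => ?_) h2
    simp only [Function.comp_apply, ← mul_smul, ← pow_succ, ← pow_succ']

omit [TopologicalSpace X] in
theorem IsLoxodromic.of_conj {g k : G} (h : IsLoxodromic X (k * g * k⁻¹)) : IsLoxodromic X g := by
  constructor
  · intro hg
    refine h.1 ?_
    rw [isOfFinOrder_iff_pow_eq_one] at hg ⊢
    obtain ⟨n, hn, hgn⟩ := hg
    exact ⟨n, hn, by rw [conj_pow, hgn, mul_one, mul_inv_cancel]⟩
  · rw [← h.2, ← MulAction.smul_fixedBy]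
    exact (ncard_image_of_injective _ (MulAction.injective k)).symm

/-- A sequence with infinite range has an injective subsequence. -/
theorem exists_strictMono_injective {α : Type*} {f : ℕ → α} (hf : (range f).Infinite) :
    ∃ σ : ℕ → ℕ, StrictMono σ ∧ Function.Injective fun n => f (σ n) := by
  classical
  let P : Set ℕ := {n | ∀ m < n, f m ≠ f n}
  have himg : f '' P = range f := by
    refine Subset.antisymm (image_subset_range _ _) ?_
    rintro _ ⟨n, rfl⟩
    have hex : ∃ m, f m = f n := ⟨n, rfl⟩
    refine ⟨Nat.find hex, fun m hm => ?_, Nat.find_spec hex⟩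
    rw [Nat.find_spec hex]
    exact Nat.find_min hex hm
  have hP : P.Infinite := fun hfin => hf (himg ▸ hfin.image f)
  have : Infinite P := hP.to_subtype
  refine ⟨Nat.orderEmbeddingOfSet P, (Nat.orderEmbeddingOfSet P).strictMono, fun m n hmn => ?_⟩
  have hmem : ∀ n, Nat.orderEmbeddingOfSet P n ∈ P := fun n =>
    (Nat.orderEmbeddingOfSet_range P).subset (mem_range_self n)
  rcases lt_trichotomy m n with hlt | heq | hlt
  · exact absurd hmn (hmem n _ ((Nat.orderEmbeddingOfSet P).strictMono hlt))
  · exact heq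
  · exact absurd hmn.symm (hmem m _ ((Nat.orderEmbeddingOfSet P).strictMono hlt))

omit [TopologicalSpace X] in
/-- A nontrivial space with a parabolic point has at least three points. -/
theorem IsParabolicAt.exists_third {H : Subgroup G} {q x : X} (hq : IsParabolicAt H q)
    (hx : x ≠ q) (a b : X) : ∃ c, c ≠ a ∧ c ≠ b := by
  obtain ⟨g, hg, hgx⟩ : ∃ g ∈ H, g • x ≠ x := by
    by_contra! hcon
    exact hx (hq.unique x hcon)
  have hgq : g • x ≠ q := fun h => hx (MulAction.injective g (h.trans (hq.fixes g hg).symm))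
  by_contra! hcon
  by_cases hqa : q = a
  · subst hqa
    exact hgx ((hcon _ hgq).trans (hcon _ hx).symm)
  by_cases hxa : x = a
  · subst hxa
    exact hgq ((hcon _ hgx).trans (hcon _ hqa).symm)
  · exact hx ((hcon _ hxa).trans (hcon _ hqa).symm)

namespace IsConvergenceGroupOn

variable (hG : IsConvergenceGroupOn G X)
include hG

theorem exists_collapses {γ : ℕ → G} (hγ : Function.Injective γ) :
    ∃ σ : ℕ → ℕ, StrictMono σ ∧ ∃ ξ η : X, Collapses (fun n => γ (σ n)) ξ η := by
  have := hG.compact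
  have := hG.metrizable
  obtain ⟨σ, hσ, ξ, η, h⟩ := hG.convergence γ hγ
  exact ⟨σ, hσ, ξ, η, Collapses.iff_isCompact.2 h⟩

/-- With disjoint closed neighbourhoods `U` of `a` and `N` of `b`, an element far along the sequence
maps the complement of `N` into `U`. A third point outside both never returns, so the order is
infinite. Subsequential limits of the powers give one fixed point in `U` and one in `N`, and every
fixed point other than the repelling one equals the attracting one. -/
theorem eventually_isLoxodromic {γ : ℕ → G} {a b : X} (hcol : Collapses γ a b) (hab : a ≠ b)
    (hX : ∀ a b : X, ∃ c, c ≠ a ∧ c ≠ b) : ∀ᶠ n in atTop, IsLoxodromic X (γ n) := by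
  have := hG.compact
  have := hG.metrizable
  obtain ⟨c, hca, hcb⟩ := hX a b
  obtain ⟨A, B, hA, hB, haA, hbB, hAB⟩ := t2_separation hab
  obtain ⟨U, hUa, hU, hUA⟩ := exists_mem_nhds_isClosed_subset
    (inter_mem (hA.mem_nhds haA) (isOpen_compl_singleton.mem_nhds hca.symm : {c}ᶜ ∈ 𝓝 a))
  obtain ⟨N, hNb, hN, hNB⟩ := exists_mem_nhds_isClosed_subset
    (inter_mem (hB.mem_nhds hbB) (isOpen_compl_singleton.mem_nhds hcb.symm : {c}ᶜ ∈ 𝓝 b))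
  have hUN : Disjoint U N :=
    hAB.mono (hUA.trans inter_subset_left) (hNB.trans inter_subset_left)
  have hcU : c ∉ U := fun h => (hUA h).2 rfl
  have hcN : c ∉ N := fun h => (hNB h).2 rfl
  have haU := mem_of_mem_nhds hUa
  have hbN := mem_of_mem_nhds hNb
  filter_upwards [hcol U hUa N hNb] with n hmaps
  generalize γ n = g at hmaps
  have hmaps' : ∀ x ∉ U, g⁻¹ • x ∈ N := by
    intro x hx
    by_contra hxN
    exact hx (by simpa using hmaps _ hxN)
  have hpow : ∀ n, g ^ (n + 1) • c ∈ U := by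
    intro n
    induction n with
    | zero => simpa using hmaps c hcN
    | succ n ih =>
      rw [pow_succ', mul_smul]
      exact hmaps _ (disjoint_left.1 hUN ih)
  have hinf : ¬ IsOfFinOrder g := by
    rw [isOfFinOrder_iff_pow_eq_one]
    rintro ⟨n, hn, hgn⟩
    obtain ⟨m, rfl⟩ := Nat.exists_eq_succ_of_ne_zero hn.ne'
    have := hpow m
    rw [hgn, one_smul] at this
    exact hcU this
  refine ⟨hinf, ?_⟩
  have hinj : Function.Injective fun n => g ^ (n + 1) := fun m n hmn => by
    simpa using injective_pow_iff_not_isOfFinOrder.2 hinf hmn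
  obtain ⟨σ, -, ξ, η, hcol⟩ := hG.exists_collapses hinj
  have hcol' : Collapses (fun n => g⁻¹ ^ (σ n + 1)) η ξ := by
    simpa only [inv_pow] using hcol.inv
  have h1 := fixed_of_collapses (hG.continuous_smul g) hU hUN hmaps hcol haU hcU hcN
  have h2 := fixed_of_collapses (hG.continuous_smul g⁻¹) hN hUN.symm hmaps' hcol' hbN hcN hcU
  have hξ := h1.2 h2.1
  have hη : g • η = η := (inv_smul_eq_iff.1 (h2.2 h1.1)).symm
  have heq : MulAction.fixedBy X g = {ξ, η} := by
    ext z
    simp only [MulAction.mem_fixedBy, mem_insert_iff, mem_singleton_iff]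
    constructor
    · intro hz
      refine or_iff_not_imp_right.2 fun hzη => ?_
      have hzn : ∀ n : ℕ, g ^ n • z = z := by
        intro n
        induction n with
        | zero => simp
        | succ n ih => rw [pow_succ, mul_smul, hz, ih]
      have h3 := hcol.tendsto (x := fun _ => z) tendsto_const_nhds hzη
      simp only [hzn] at h3
      exact tendsto_nhds_unique tendsto_const_nhds h3
    · rintro (rfl | rfl) <;> assumption
  rw [heq, ncard_pair]
  rintro rfl
  exact disjoint_left.1 hUN h1.1 h2.1

/-- A sequence of distinct elements that are not loxodromic cannot almost fix two points. -/
theorem false_of_almost_fixes (hX : ∀ a b : X, ∃ c, c ≠ a ∧ c ≠ b) {g : ℕ → G}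
    (hg : Function.Injective g) (hlox : ∀ n, ¬ IsLoxodromic X (g n)) {a c : X} (hac : a ≠ c)
    {x y : ℕ → X} (hx : Tendsto x atTop (𝓝 a)) (hgx : Tendsto (fun n => g n • x n) atTop (𝓝 a))
    (hy : Tendsto y atTop (𝓝 c)) (hgy : Tendsto (fun n => g n • y n) atTop (𝓝 c)) : False := by
  have := hG.metrizable
  obtain ⟨σ, hσ, A, B, hcol⟩ := hG.exists_collapses hg
  have hσ' := hσ.tendsto_atTop
  have key : ∀ {x : ℕ → X} {a}, Tendsto x atTop (𝓝 a) →
      Tendsto (fun n => g n • x n) atTop (𝓝 a) → a ≠ B → A = a := fun hx hgx ha =>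
    tendsto_nhds_unique (hcol.tendsto (hx.comp hσ') ha) (hgx.comp hσ')
  have hAB : A ≠ B := by
    rintro rfl
    by_cases ha : a = A
    · subst ha
      exact hac (key hy hgy hac.symm)
    · exact ha (key hx hgx ha).symm
  obtain ⟨n, hn⟩ := (hG.eventually_isLoxodromic hcol hAB hX).exists
  exact hlox _ hn

/-- A parabolic point is not a conical limit point. -/
theorem tendsto_of_parabolic {γ : ℕ → G} {a q : X} (hcol : Collapses γ a q) {H : Subgroup G}
    (hq : IsParabolicAt H q) : Tendsto (fun n => γ n • q) atTop (𝓝 a) := by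
  have := hG.compact
  have := hG.metrizable
  by_contra hcon
  obtain ⟨U, hU, hfreq⟩ : ∃ U ∈ 𝓝 a, ∃ᶠ n in atTop, γ n • q ∉ U := by
    simpa [tendsto_def, Filter.Frequently] using hcon
  obtain ⟨σ, hσ, hσU⟩ := extraction_of_frequently_atTop hfreq
  let _ := TopologicalSpace.metrizableSpaceMetric X
  obtain ⟨c, τ, hτ, hc⟩ := CompactSpace.tendsto_subseq fun n => γ (σ n) • q
  replace hcol := hcol.comp (hσ.comp hτ).tendsto_atTop
  simp only [Function.comp_def] at hcol hc
  set δ := fun n => γ (σ (τ n)) with hδ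
  have hac : a ≠ c := by
    rintro rfl
    obtain ⟨n, hn⟩ := (hc.eventually_mem hU).exists
    exact hσU _ hn
  obtain ⟨x, hxq⟩ : ∃ x, x ≠ q := by
    by_cases ha : a = q
    · exact ⟨c, fun hcq => hac (ha.trans hcq.symm)⟩
    · exact ⟨a, ha⟩
  have hX := hq.exists_third hxq
  have hfix : ∀ h ∈ H, h • x ≠ q := fun h hh hx =>
    hxq (MulAction.injective h (hx.trans (hq.fixes h hh).symm))
  have hx : Tendsto (fun n => δ n • x) atTop (𝓝 a) := hcol.tendsto tendsto_const_nhds hxq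
  have hx' : ∀ h ∈ H, Tendsto (fun n => (δ n * h * (δ n)⁻¹) • δ n • x) atTop (𝓝 a) := by
    intro h hh
    refine (hcol.tendsto tendsto_const_nhds (hfix h hh)).congr fun n => ?_
    simp [mul_smul]
  have hc' : ∀ h ∈ H, Tendsto (fun n => (δ n * h * (δ n)⁻¹) • δ n • q) atTop (𝓝 c) := by
    intro h hh
    refine hc.congr fun n => ?_
    simp [mul_smul, hq.fixes h hh, hδ]
  have hlox : ∀ h ∈ H, ∀ k : G, ¬ IsLoxodromic X (k * h * k⁻¹) := fun h hh k hk =>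
    hq.not_loxodromic h hh hk.of_conj
  -- The conjugates of `h` are not loxodromic and almost fix both `a` and `c`, so infinitely many
  -- distinct ones are impossible.
  have hfin : ∀ h ∈ H, (range fun n => δ n * h * (δ n)⁻¹).Finite := by
    intro h hh
    by_contra hinf
    obtain ⟨ρ, hρ, hinj⟩ := exists_strictMono_injective hinf
    exact hG.false_of_almost_fixes hX hinj (fun n => hlox h hh _) hac
      (hx.comp hρ.tendsto_atTop) ((hx' h hh).comp hρ.tendsto_atTop)
      (hc.comp hρ.tendsto_atTop) ((hc' h hh).comp hρ.tendsto_atTop)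
  -- Along an ultrafilter the conjugates become constant for every `h` at once. The infinitely many
  -- constants are distinct, not loxodromic, and fix both `a` and `c`, which is again impossible.
  let F : Ultrafilter ℕ := Ultrafilter.of atTop
  have hF : (F : Filter ℕ) ≤ atTop := Ultrafilter.of_le _
  have hconst : ∀ h ∈ H, ∃ k, ∀ᶠ n in F, δ n * h * (δ n)⁻¹ = k := by
    intro h hh
    obtain ⟨k, -, hk⟩ := (Ultrafilter.eventually_exists_mem_iff (hfin h hh)
      (P := fun k n => δ n * h * (δ n)⁻¹ = k)).1
      (Eventually.of_forall fun n => ⟨_, mem_range_self n, rfl⟩)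
    exact ⟨k, hk⟩
  have := hq.infinite
  let e := Infinite.natEmbedding H
  choose k hk using fun n => hconst (e n) (e n).2
  have hkinj : Function.Injective k := by
    intro m n hmn
    obtain ⟨i, hi⟩ := ((hk m).and (hk n)).exists
    refine e.injective (Subtype.ext ?_)
    have := hi.1.trans (hmn.trans hi.2.symm)
    simpa using this
  have hkfix : ∀ n, ∀ {z : ℕ → X} {y : X}, Tendsto z atTop (𝓝 y) →
      Tendsto (fun i => (δ i * e n * (δ i)⁻¹) • z i) atTop (𝓝 y) → k n • y = y := by
    intro n z y h1 h2
    refine tendsto_nhds_unique (((hG.continuous_smul (k n)).tendsto y).comp (h1.mono_left hF)) ?_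
    refine (h2.mono_left hF).congr' ?_
    filter_upwards [hk n] with i hi
    rw [hi]
    rfl
  refine hG.false_of_almost_fixes hX hkinj (fun n => ?_) hac tendsto_const_nhds
    (tendsto_const_nhds.congr fun n => (hkfix n hx (hx' _ (e n).2)).symm)
    tendsto_const_nhds (tendsto_const_nhds.congr fun n => (hkfix n hc (hc' _ (e n).2)).symm)
  obtain ⟨i, hi⟩ := (hk n).exists
  rw [← hi]
  exact hlox _ (e n).2 _

/-- Distinct elements of a parabolic group collapse the space to the parabolic point. -/
theorem collapses_of_parabolic {γ : ℕ → G} (hγ : Function.Injective γ) {H : Subgroup G} {q : X}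
    (hq : IsParabolicAt H q) (hH : ∀ n, γ n ∈ H) : Collapses γ q q := by
  have := hG.compact
  have := hG.metrizable
  intro U hU N hN
  by_contra hcon
  obtain ⟨σ, hσ, hσU⟩ := extraction_of_frequently_atTop (not_eventually.1 hcon)
  obtain ⟨τ, hτ, A, B, hcol⟩ := hG.exists_collapses (hγ.comp hσ.injective)
  obtain ⟨x, hxq⟩ : ∃ x, x ≠ q := by
    have := hσU 0
    push Not at this
    obtain ⟨x, hx, -⟩ := this
    exact ⟨x, fun h => hx (h ▸ mem_of_mem_nhds hN)⟩
  have hAB : A = B := by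
    by_contra hAB
    obtain ⟨n, hn⟩ := (hG.eventually_isLoxodromic hcol hAB (hq.exists_third hxq)).exists
    exact hq.not_loxodromic _ (hH _) hn
  subst hAB
  have hAq : A = q := by
    by_contra hne
    have h1 := hcol.tendsto (x := fun _ => q) tendsto_const_nhds (Ne.symm hne)
    simp only [Function.comp_apply, hq.fixes _ (hH _)] at h1
    exact hne (tendsto_nhds_unique tendsto_const_nhds h1).symm
  subst hAq
  obtain ⟨n, hn⟩ := (hcol U hU N hN).exists
  exact hσU _ hn

end IsConvergenceGroupOn

end Collapse

/-! ### Dynamics of the fundamental group on the compacta and on `M` -/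

namespace GraphOfGroups

namespace VertexSpaces

variable {V E : Type*} {𝒢 : GraphOfGroups V E} {𝒳 : VertexSpaces 𝒢} {S : Set E}

/-- The sequence `γ` collapses the complement of `b` in the compactum of `c` to `a`, locally
uniformly. -/
def CollapsesFibre (γ : ℕ → 𝒢.π₁ S) (c : 𝒢.TreeVertex S) (a b : 𝒳.Omega S) : Prop :=
  ∀ U ∈ 𝓝 a, ∀ N ∈ 𝓝 b, ∀ᶠ n in atTop, ∀ x ∈ 𝒳.fibre S c, x ∉ N → γ n • x ∈ U

theorem CollapsesFibre.inv {γ : ℕ → 𝒢.π₁ S} {c : 𝒢.TreeVertex S} {a b : 𝒳.Omega S}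
    (h : CollapsesFibre γ c a b) (hγ : ∀ n, γ n • c = c) :
    CollapsesFibre (fun n => (γ n)⁻¹) c b a := by
  intro N hN U hU
  filter_upwards [h U hU N hN] with n hn x hx hxU
  by_contra hxN
  have hxc : (γ n)⁻¹ • x ∈ 𝒳.fibre S c := by
    rw [fibre, mem_ofPred_eq, vert_smul, hx, inv_smul_eq_iff, hγ]
  exact hxU (by simpa using hn _ hxc hxN)

theorem collapsesFibre_iff {v : V} {g : 𝒢.π₁ S} (hpt : IsOpenEmbedding (𝒳.pt S v g))
    {γ : ℕ → 𝒢.π₁ S} {a : ℕ → 𝒢.G v} (ha : ∀ n, γ n * g = g * 𝒢.ι S v (a n)) {ξ η : 𝒳.X v} :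
    CollapsesFibre γ (𝒢.coset S v g) (𝒳.pt S v g ξ) (𝒳.pt S v g η) ↔ Collapses a ξ η := by
  have hact : ∀ n x, γ n • 𝒳.pt S v g x = 𝒳.pt S v g (a n • x) := fun n x => by
    rw [smul_pt, ha, pt_mul]
  constructor
  · intro h U hU N hN
    filter_upwards [h _ (hpt.image_mem_nhds.2 hU) _ (hpt.image_mem_nhds.2 hN)] with n hn x hx
    have h1 := hn (𝒳.pt S v g x) (vert_pt v g x) (by rwa [hpt.injective.mem_set_image])
    rwa [hact, hpt.injective.mem_set_image] at h1
  · intro h U hU N hN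
    filter_upwards [h _ (hpt.continuous.continuousAt.preimage_mem_nhds hU) _
      (hpt.continuous.continuousAt.preimage_mem_nhds hN)] with n hn x hx hxN
    obtain ⟨y, rfl⟩ := exists_pt_of_vert hx
    rw [hact]
    exact hn y hxN

theorem exists_vertexGroup_seq {v : V} {g : 𝒢.π₁ S} {γ : ℕ → 𝒢.π₁ S}
    (hγ : ∀ n, γ n • 𝒢.coset S v g = 𝒢.coset S v g) :
    ∃ a : ℕ → 𝒢.G v, ∀ n, γ n * g = g * 𝒢.ι S v (a n) := by
  have : ∀ n, ∃ a : 𝒢.G v, γ n * g = g * 𝒢.ι S v a := fun n => coset_eq_iff.1 (hγ n).symm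
  choose a ha using this
  exact ⟨a, ha⟩

theorem injective_vertexGroup_seq {v : V} {g : 𝒢.π₁ S} {γ : ℕ → 𝒢.π₁ S}
    (hinj : Function.Injective γ) {a : ℕ → 𝒢.G v} (ha : ∀ n, γ n * g = g * 𝒢.ι S v (a n)) :
    Function.Injective a := by
  intro m n hmn
  have h1 := (ha m).trans ((congrArg (fun x => g * 𝒢.ι S v x) hmn).trans (ha n).symm)
  exact hinj (mul_right_cancel h1)

variable (𝒳 S) in
/-- The hypotheses on the vertex spaces under which the fundamental group acts as a convergence
group. -/
structure IsParabolicSplitting : Prop where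
  isMaximalTree : 𝒢.IsMaximalTree S
  ι_injective : ∀ v, Function.Injective (𝒢.ι S v)
  convergence : ∀ v, IsConvergenceGroupOn (𝒢.G v) (𝒳.X v)
  src_parabolic : ∀ e, IsParabolicAt (𝒢.φ e).range (𝒳.srcPt e)
  tgt_parabolic : ∀ e, IsParabolicAt (𝒢.ψ e).range (𝒳.tgtPt e)

namespace IsParabolicSplitting

variable (hp : 𝒳.IsParabolicSplitting S)
include hp

theorem isOpenEmbedding_pt (v : V) (g : 𝒢.π₁ S) : IsOpenEmbedding (𝒳.pt S v g) :=
  isOpenEmbedding_pt' hp.ι_injective hp.convergence v g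

theorem exists_collapsesFibre {γ : ℕ → 𝒢.π₁ S} (hinj : Function.Injective γ)
    {c : 𝒢.TreeVertex S} (hγ : ∀ n, γ n • c = c) : ∃ σ : ℕ → ℕ, StrictMono σ ∧
      ∃ a ∈ 𝒳.fibre S c, ∃ b ∈ 𝒳.fibre S c, CollapsesFibre (fun n => γ (σ n)) c a b := by
  obtain ⟨g, hg⟩ := exists_coset c
  rw [hg] at hγ ⊢
  obtain ⟨a, ha⟩ := exists_vertexGroup_seq hγ
  obtain ⟨σ, hσ, ξ, η, hcol⟩ :=
    (hp.convergence c.1).exists_collapses (injective_vertexGroup_seq hinj ha)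
  exact ⟨σ, hσ, _, vert_pt _ _ ξ, _, vert_pt _ _ η,
    (collapsesFibre_iff (hp.isOpenEmbedding_pt _ _) fun n => ha (σ n)).2 hcol⟩

variable [Nonempty (𝒳.Omega S)]

section

variable [Finite E]

theorem isTreeOfSpaces : 𝒳.IsTreeOfSpaces S :=
  VertexSpaces.isTreeOfSpaces hp.isMaximalTree (fun e a => (hp.src_parabolic e).fixes _ ⟨a, rfl⟩)
    (fun e a => (hp.tgt_parabolic e).fixes _ ⟨a, rfl⟩)

/-- The stabilizers of the edges are parabolic in the stabilizers of the vertices. -/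
theorem exists_parabolic {c w : 𝒢.TreeVertex S} (hcw : c ≠ w) :
    ∃ (v : V) (k : 𝒢.π₁ S) (H : Subgroup (𝒢.G v)) (q : 𝒳.X v), c = 𝒢.coset S v k ∧
      IsParabolicAt H q ∧ 𝒳.dirPt S c w = 𝒳.pt S v k q ∧
      ∀ (γ : 𝒢.π₁ S) (a : 𝒢.G v), γ * k = k * 𝒢.ι S v a → γ • w = w → a ∈ H := by
  have h := hp.isTreeOfSpaces
  obtain ⟨y, h1, h2, h3⟩ := h.dirPt_spec hcw
  -- An element that fixes `c` and `w` fixes the first edge of `[c, w]`, hence comes from the edge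
  -- group by `edge_unique`.
  have key : ∀ (γ : 𝒢.π₁ S), γ • c = c → γ • w = w → γ • 𝒳.vert S y = 𝒳.vert S y := by
    intro γ hc hw
    rw [h3, ← h.next_smul γ hcw, hc, hw]
  rcases h1 with ⟨e, k, h1, rfl⟩ | ⟨e, k, rfl, h1⟩
  · rw [h1] at h2
    refine ⟨𝒢.src e, k, (𝒢.φ e).range, 𝒳.srcPt e, h2.symm, hp.src_parabolic e, h1, fun γ a ha hw => ?_⟩
    have hc : γ • c = c := by rw [← h2, vert_pt, smul_coset, ha, coset_mul]
    have h4 := key γ hc hw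
    rw [vert_pt, smul_coset, ← mul_assoc] at h4
    have h5 := (hp.isMaximalTree.edge_unique (g := k) (g' := γ * k) (Or.inl ⟨by
      rw [ha, coset_mul], h4.symm⟩)).1
    obtain ⟨b, hb⟩ := edgeCoset_eq h5
    rw [ha, mul_right_inj] at hb
    exact ⟨b, (hp.ι_injective _ hb).symm⟩
  · rw [h1] at h2
    refine ⟨𝒢.tgt e, k * 𝒢.t S e, (𝒢.ψ e).range, 𝒳.tgtPt e, h2.symm, hp.tgt_parabolic e, h1, fun γ a ha hw => ?_⟩
    have hc : γ • c = c := by rw [← h2, vert_pt, smul_coset, ha, coset_mul]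
    have h4 := key γ hc hw
    rw [vert_pt, smul_coset] at h4
    have h5 := (hp.isMaximalTree.edge_unique (g := k) (g' := γ * k) (Or.inl ⟨h4.symm, by
      rw [mul_assoc, ha, coset_mul]⟩)).1
    obtain ⟨b, hb⟩ := edgeCoset_eq h5
    rw [← mul_assoc, hb, mul_assoc, ← t_mul_ι, mul_assoc, mul_right_inj, mul_right_inj] at ha
    exact ⟨b, hp.ι_injective _ ha⟩

/-- The point of an edge is not a conical limit point. -/
theorem tendsto_dirPt {γ : ℕ → 𝒢.π₁ S} {c w : 𝒢.TreeVertex S} (hcw : c ≠ w)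
    (hγ : ∀ n, γ n • c = c) {a : 𝒳.Omega S} (ha : a ∈ 𝒳.fibre S c)
    (hcol : CollapsesFibre γ c a (𝒳.dirPt S c w)) :
    Tendsto (fun n => γ n • 𝒳.dirPt S c w) atTop (𝓝 a) := by
  obtain ⟨v, k, H, q, rfl, hq, hdir, -⟩ := hp.exists_parabolic hcw
  rw [hdir] at hcol ⊢
  obtain ⟨b, hb⟩ := exists_vertexGroup_seq hγ
  obtain ⟨ξ, rfl⟩ := exists_pt_of_vert ha
  have h1 := (hp.convergence v).tendsto_of_parabolic
    ((collapsesFibre_iff (hp.isOpenEmbedding_pt v k) hb).1 hcol) hq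
  refine (((continuous_pt v k).tendsto ξ).comp h1).congr fun n => ?_
  rw [smul_pt, hb, pt_mul]
  rfl

/-- A sequence of distinct elements that maps an edge to a fixed edge collapses the compactum of a
vertex of the edge to the point of the edge. -/
theorem collapsesFibre_of_edge {γ : ℕ → 𝒢.π₁ S} (hinj : Function.Injective γ)
    {s u t u' : 𝒢.TreeVertex S} (hsu : s ≠ u) (hs : ∀ n, γ n • s = t) (hu : ∀ n, γ n • u = u') :
    CollapsesFibre γ s (𝒳.dirPt S t u') (𝒳.dirPt S s u) := by
  have h := hp.isTreeOfSpaces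
  have hδs : ∀ n, ((γ 0)⁻¹ * γ n) • s = s := fun n => by
    rw [mul_smul, hs, inv_smul_eq_iff, hs]
  have hδu : ∀ n, ((γ 0)⁻¹ * γ n) • u = u := fun n => by
    rw [mul_smul, hu, inv_smul_eq_iff, hu]
  have hδinj : Function.Injective fun n => (γ 0)⁻¹ * γ n := fun m n hmn =>
    hinj (mul_left_cancel hmn)
  have hcol : CollapsesFibre (fun n => (γ 0)⁻¹ * γ n) s (𝒳.dirPt S s u) (𝒳.dirPt S s u) := by
    obtain ⟨v, k, H, q, rfl, hq, hdir, hH⟩ := hp.exists_parabolic hsu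
    obtain ⟨a, ha⟩ := exists_vertexGroup_seq hδs
    rw [hdir, collapsesFibre_iff (hp.isOpenEmbedding_pt v k) ha]
    exact (hp.convergence v).collapses_of_parabolic (injective_vertexGroup_seq hδinj ha) hq
      fun n => hH _ _ (ha n) (hδu n)
  intro U hU N hN
  rw [← hs 0, ← hu 0, h.dirPt_smul _ hsu] at hU
  filter_upwards [hcol _ ((continuous_smul_omega (γ 0)).continuousAt.preimage_mem_nhds hU) N hN]
    with n hn x hx hxN
  simpa [mul_smul] using hn x hx hxN

/-- The condition `γ n • s = t` may hold for any set of indices. This form can be applied to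
finitely many `s` and `t` without passing to subsequences. -/
theorem eventually_of_edge {γ : ℕ → 𝒢.π₁ S} (hinj : Function.Injective γ)
    {s v t : 𝒢.TreeVertex S} (hsv : s ≠ v) (hv : ∀ n, γ n • v = v) {U N : Set (𝒳.Omega S)}
    (hU : U ∈ 𝓝 (𝒳.dirPt S t v)) (hN : N ∈ 𝓝 (𝒳.dirPt S s v)) :
    ∀ᶠ n in atTop, γ n • s = t → ∀ x ∈ 𝒳.fibre S s, x ∉ N → γ n • x ∈ U := by
  by_contra hcon
  obtain ⟨σ, hσ, hσU⟩ := extraction_of_frequently_atTop (not_eventually.1 hcon)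
  push Not at hσU
  have hcol := hp.collapsesFibre_of_edge (hinj.comp hσ.injective) hsv (fun n => (hσU n).1)
    (fun n => hv (σ n))
  obtain ⟨n, hn⟩ := (hcol U hU N hN).exists
  obtain ⟨-, x, hx, hxN, hxU⟩ := hσU n
  exact hxU (hn x hx hxN)

end

end IsParabolicSplitting

section Dynamics

variable [Nonempty (𝒳.Omega S)]

variable (h : 𝒳.IsTreeOfSpaces S)
include h

theorem IsTreeOfSpaces.continuous_smul_M [T1Space (𝒳.Omega S)] (g : 𝒢.π₁ S) :
    Continuous fun m : 𝒳.M S => g • m := by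
  rw [h.isEmbedding_coords.continuous_iff]
  refine continuous_pi fun t => ?_
  have heq : (fun m => (𝒳.coords S ∘ fun m => g • m) m t) =
      fun m => g • 𝒳.coords S m (g⁻¹ • t) := by
    ext1 m
    rw [← h.coords_smul, smul_inv_smul]
    rfl
  rw [heq]
  exact (continuous_smul_omega g).comp ((continuous_apply _).comp h.continuous_coords)

/-- The collapsing of `M` can be checked on the projections. -/
theorem IsTreeOfSpaces.collapses_of_coords [T1Space (𝒳.Omega S)] {γ : ℕ → 𝒢.π₁ S} {ξ η : 𝒳.M S}
    (hγ : ∀ s t, ∀ U ∈ 𝓝 (𝒳.coords S η s), ∀ O ∈ 𝓝 (𝒳.coords S ξ t), ∀ᶠ n in atTop,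
      ∀ y : 𝒳.M S, 𝒳.coords S y s ∉ U → 𝒳.coords S (γ n • y) t ∈ O) : Collapses γ ξ η := by
  have hbasis : ∀ {m : 𝒳.M S} {W : Set (𝒳.M S)}, W ∈ 𝓝 m → ∃ I : Set (𝒢.TreeVertex S), I.Finite ∧
      ∃ O : 𝒢.TreeVertex S → Set (𝒳.Omega S), (∀ t, O t ∈ 𝓝 (𝒳.coords S m t)) ∧
        ∀ y, (∀ t ∈ I, 𝒳.coords S y t ∈ O t) → y ∈ W := by
    intro m W hW
    rw [h.isEmbedding_coords.nhds_eq_comap, nhds_pi] at hW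
    obtain ⟨A, hA, hAW⟩ := hW
    obtain ⟨I, hI, O, hO, hOA⟩ := Filter.mem_pi.1 hA
    exact ⟨I, hI, O, hO, fun y hy => hAW (hOA hy)⟩
  intro W hW N hN
  obtain ⟨J, hJ, O, hO, hOW⟩ := hbasis hW
  obtain ⟨I, hI, U, hU, hUN⟩ := hbasis hN
  have h1 := (eventually_all_finite hI).2 fun s _ => (eventually_all_finite hJ).2 fun t _ =>
    hγ s t (U s) (hU s) (O t) (hO t)
  filter_upwards [h1] with n hn y hy
  obtain ⟨s, hs, hys⟩ : ∃ s ∈ I, 𝒳.coords S y s ∉ U s := by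
    by_contra! hcon
    exact hy (hUN y hcon)
  exact hOW _ fun t ht => hn s hs t ht y hys

theorem IsTreeOfSpaces.coords_smul' (g : 𝒢.π₁ S) (m : 𝒳.M S) (t : 𝒢.TreeVertex S) :
    𝒳.coords S (g • m) t = g • 𝒳.coords S m (g⁻¹ • t) := by
  rw [← h.coords_smul, smul_inv_smul]

/-- A sequence that moves all vertices of the tree to infinity has a collapsing subsequence. -/
theorem IsTreeOfSpaces.exists_collapses_of_far [T1Space (𝒳.Omega S)] [CompactSpace (𝒳.M S)]
    [TopologicalSpace.MetrizableSpace (𝒳.M S)] {γ : ℕ → 𝒢.π₁ S}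
    (hfar : ∀ v w : 𝒢.TreeVertex S, ∀ᶠ n in atTop, γ n • v ≠ w) :
    ∃ σ : ℕ → ℕ, StrictMono σ ∧ ∃ ξ η : 𝒳.M S, Collapses (fun n => γ (σ n)) ξ η := by
  obtain ⟨x₀⟩ : Nonempty (𝒳.Omega S) := inferInstance
  set m₀ := 𝒳.ofPt S (𝒳.toQuot S x₀) with hm₀
  set v₀ := 𝒳.vert S x₀ with hv₀
  have hcoords : ∀ t, t ≠ v₀ → 𝒳.coords S m₀ t = 𝒳.dirPt S t v₀ := fun t ht => by
    rw [hm₀, h.coords_ofPt, h.coord_of_mem_domain ⟨x₀, rfl, rfl⟩ ht]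
  -- The finite segment `[s, v₀]` is eventually moved off `t`, so `t` sees the images of `s` and of
  -- the base point in one direction.
  have key : ∀ δ : ℕ → 𝒢.π₁ S, (∀ v w : 𝒢.TreeVertex S, ∀ᶠ n in atTop, δ n • v ≠ w) → ∀ s t,
      ∀ᶠ n in atTop, 𝒳.coords S (δ n • m₀) t = 𝒳.dirPt S t (δ n • s) := by
    intro δ hδ s t
    have h1 := (eventually_all_finite (h.isTree.finite_geodesicSegment s v₀)).2
      fun w _ => hδ w t
    filter_upwards [h1] with n hn
    have h2 : (δ n)⁻¹ • t ∉ (𝒢.tree S).geodesicSegment s v₀ := fun h2 =>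
      hn _ h2 (smul_inv_smul _ _)
    have h3 : (δ n)⁻¹ • t ≠ v₀ := by
      intro h3
      rw [h3] at h2
      exact h2 (SimpleGraph.right_mem_geodesicSegment _ _)
    have h4 : (δ n)⁻¹ • t ≠ s := by
      intro h4
      rw [h4] at h2
      exact h2 (SimpleGraph.left_mem_geodesicSegment _ _)
    rw [h.coords_smul', hcoords _ h3, ← h.dirPt_eq_of_notMem h2, ← h.dirPt_smul _ h4,
      smul_inv_smul]
  let _ := TopologicalSpace.metrizableSpaceMetric (𝒳.M S)
  obtain ⟨ξ, σ, hσ, hξ⟩ := CompactSpace.tendsto_subseq fun n => γ n • m₀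
  obtain ⟨η, τ, hτ, hη⟩ := CompactSpace.tendsto_subseq fun n => (γ (σ n))⁻¹ • m₀
  replace hξ := hξ.comp hτ.tendsto_atTop
  have hστ := hσ.comp hτ
  refine ⟨σ ∘ τ, hστ, ξ, η, h.collapses_of_coords fun s t U hU O hO => ?_⟩
  have hfar' : ∀ v w : 𝒢.TreeVertex S, ∀ᶠ n in atTop, γ (σ (τ n)) • v ≠ w := fun v w =>
    hστ.tendsto_atTop.eventually (hfar v w)
  have hinv : ∀ v w : 𝒢.TreeVertex S, ∀ᶠ n in atTop, (γ (σ (τ n)))⁻¹ • v ≠ w := fun v w => by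
    filter_upwards [hfar' w v] with n hn hvw
    exact hn (by rw [← hvw, smul_inv_smul])
  have hc : ∀ t, Continuous fun m => 𝒳.coords S m t := fun t =>
    (continuous_apply t).comp h.continuous_coords
  have h1 := (((hc s).tendsto η).comp hη).eventually_mem hU
  have h2 := (((hc t).tendsto ξ).comp hξ).eventually_mem hO
  filter_upwards [h1, h2, key _ hfar' s t, key _ hinv t s, hfar' s t] with n h1 h2 h3 h4 h5 y hy
  simp only [Function.comp_apply] at h1 h2 ⊢
  rw [h4] at h1
  rw [h3] at h2
  have hne : s ≠ (γ (σ (τ n)))⁻¹ • t := fun hs => h5 (by rw [hs, smul_inv_smul])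
  -- The direction from `s` to `γ⁻¹ • t` lies in `U`, so the coordinate of `y` at `s` differs from
  -- it. By coherence the coordinate of `γ • y` at `t` points to `γ • s`, as does that of `γ • m₀`,
  -- which is near `ξ`.
  rw [h.coords_smul', h.coords_coherent y hne fun hys => hy (hys ▸ h1),
    ← h.dirPt_smul _ hne.symm, smul_inv_smul]
  exact h2

end Dynamics

namespace IsParabolicSplitting

variable [Finite E] [Nonempty (𝒳.Omega S)]

variable (hp : 𝒳.IsParabolicSplitting S)
include hp

/-- The action of the stabilizer of a vertex collapses `M` as it collapses the compactum of this
vertex. -/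
theorem collapses_of_collapsesFibre [T1Space (𝒳.Omega S)] {γ : ℕ → 𝒢.π₁ S}
    (hinj : Function.Injective γ) {v : 𝒢.TreeVertex S} (hv : ∀ n, γ n • v = v)
    {a b : 𝒳.Omega S} (ha : a ∈ 𝒳.fibre S v) (hb : b ∈ 𝒳.fibre S v)
    (hcol : CollapsesFibre γ v a b) :
    Collapses γ (𝒳.ofPt S (𝒳.toQuot S a)) (𝒳.ofPt S (𝒳.toQuot S b)) := by
  have h := hp.isTreeOfSpaces
  have hcv : ∀ {x}, x ∈ 𝒳.fibre S v → 𝒳.coords S (𝒳.ofPt S (𝒳.toQuot S x)) v = x := fun hx => by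
    rw [h.coords_ofPt, h.coord_eq_of_vert hx]
  have hct : ∀ {x}, x ∈ 𝒳.fibre S v → ∀ {t}, t ≠ v →
      𝒳.coords S (𝒳.ofPt S (𝒳.toQuot S x)) t = 𝒳.dirPt S t v := fun {x} hx {t} ht => by
    rw [h.coords_ofPt, h.coord_of_mem_domain ⟨x, hx, rfl⟩ ht]
  have hinv : ∀ n, (γ n)⁻¹ • v = v := fun n => by rw [inv_smul_eq_iff, hv]
  have hvt : ∀ n {t : 𝒢.TreeVertex S}, t ≠ v → (γ n)⁻¹ • t ≠ v := fun n t ht htv =>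
    ht ((inv_smul_eq_iff.1 htv).trans (hv n))
  have hback : ∀ n {t : 𝒢.TreeVertex S}, t ≠ v →
      γ n • 𝒳.dirPt S ((γ n)⁻¹ • t) v = 𝒳.dirPt S t v := fun n t ht => by
    rw [← h.dirPt_smul _ (hvt n ht), smul_inv_smul, hv]
  have hbase : ∀ t, ∀ U ∈ 𝓝 b, ∀ O ∈ 𝓝 (𝒳.coords S (𝒳.ofPt S (𝒳.toQuot S a)) t),
      ∀ᶠ n in atTop, ∀ y : 𝒳.M S, 𝒳.coords S y v ∉ U → 𝒳.coords S (γ n • y) t ∈ O := by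
    intro t U hU O hO
    by_cases ht : t = v
    · subst ht
      rw [hcv ha] at hO
      filter_upwards [hcol O hO U hU] with n hn y hy
      rw [h.coords_smul', hinv]
      exact hn _ (h.vert_coords y _) hy
    · rw [hct ha ht] at hO
      -- The inverses collapse the compactum away from `a` to `b`. At `a` itself this can fail in
      -- general, but not for the point of an edge, which is parabolic.
      have h1 : ∀ᶠ n in atTop, (γ n)⁻¹ • 𝒳.dirPt S v t ∈ U := by
        have hcol' := hcol.inv hv
        by_cases hat : 𝒳.dirPt S v t = a
        · rw [← hat] at hcol'
          exact (hp.tendsto_dirPt (Ne.symm ht) hinv hb hcol').eventually_mem hU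
        · filter_upwards [hcol' U hU {𝒳.dirPt S v t}ᶜ
            (isOpen_compl_singleton.mem_nhds (Ne.symm hat))] with n hn
          exact hn _ (h.vert_dirPt (Ne.symm ht)) (by simp)
      filter_upwards [h1] with n hn y hy
      rw [← h.dirPt_smul _ (Ne.symm ht), hinv] at hn
      rw [h.coords_smul', h.coords_coherent y (hvt n ht).symm fun hy' => hy (hy' ▸ hn),
        hback n ht]
      exact mem_of_mem_nhds hO
  refine h.collapses_of_coords fun s t U hU O hO => ?_
  by_cases hs : s = v
  · subst hs
    rw [hcv hb] at hU
    exact hbase t U hU O hO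
  rw [hct hb hs] at hU
  have hUs : ∀ y : 𝒳.M S, 𝒳.coords S y s ∉ U → 𝒳.coords S y s ≠ 𝒳.dirPt S s v := fun y hy hys =>
    hy (hys ▸ mem_of_mem_nhds hU)
  -- Here the coordinate of `y` at `s` does not point to `v`, so that at `v` points to `s`. If this
  -- direction is not `b`, the case of the coordinate at `v` applies.
  by_cases hsb : 𝒳.dirPt S v s = b
  swap
  · filter_upwards [hbase t {𝒳.dirPt S v s}ᶜ (isOpen_compl_singleton.mem_nhds (Ne.symm hsb)) O hO]
      with n hn y hy
    exact hn y (by simpa using h.coords_coherent y hs (hUs y hy))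
  by_cases ht : t = v
  · subst ht
    rw [hcv ha] at hO
    rw [← hsb] at hcol
    filter_upwards [(hp.tendsto_dirPt (Ne.symm hs) hv ha hcol).eventually_mem hO] with n hn y hy
    rw [h.coords_smul', hinv, h.coords_coherent y hs (hUs y hy)]
    exact hn
  rw [hct ha ht] at hO
  have h1 := hp.eventually_of_edge hinj hs hv (t := t) hO hU
  -- With `w = (γ n)⁻¹ • t`, the edge collapse is prepared for the possible positions: `w = s`, `w`
  -- inside `[v, s]`, and `s` inside `[v, w]`. In the last case `γ n • s` lies on `[v, t]`, so
  -- finitely many vertices suffice throughout.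
  have h2 := (eventually_all_finite ((h.isTree.finite_geodesicSegment v s).inter_of_left
      {w | w ≠ v ∧ 𝒳.dirPt S w s ≠ 𝒳.dirPt S w v})).2 fun w hw =>
    hp.eventually_of_edge hinj hw.2.1 hv (t := t) hO
      (isOpen_compl_singleton.mem_nhds hw.2.2.symm : {𝒳.dirPt S w s}ᶜ ∈ 𝓝 (𝒳.dirPt S w v))
  have h3 := (eventually_all_finite ((h.isTree.finite_geodesicSegment v t).inter_of_left
      {t' | 𝒳.dirPt S t' t ≠ 𝒳.dirPt S t' v})).2 fun t' ht' =>
    hp.eventually_of_edge hinj hs hv (t := t')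
      (isOpen_compl_singleton.mem_nhds ht'.2.symm : {𝒳.dirPt S t' t}ᶜ ∈ 𝓝 (𝒳.dirPt S t' v)) hU
  filter_upwards [h1, h2, h3] with n h1 h2 h3 y hy
  rw [h.coords_smul']
  have hwv := hvt n ht
  have hγw : γ n • (γ n)⁻¹ • t = t := smul_inv_smul _ _
  have hbackw := hback n ht
  generalize (γ n)⁻¹ • t = w at hwv hγw hbackw
  by_cases hyw : 𝒳.coords S y w = 𝒳.dirPt S w v
  · rw [hyw, hbackw]
    exact mem_of_mem_nhds hO
  by_cases hws : w = s
  · subst hws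
    exact h1 hγw _ (h.vert_coords y w) hy
  by_cases hwvs : w ∈ (𝒢.tree S).geodesicSegment v s
  · have hsw : s ∉ (𝒢.tree S).geodesicSegment v w := fun hsw =>
      hws (h.isTree.eq_of_mem_geodesicSegment hwvs hsw)
    have h4 := hUs y hy
    rw [h.dirPt_eq_of_notMem hsw] at h4
    have h5 := h.coords_coherent y (Ne.symm hws) h4
    exact h2 w ⟨hwvs, hwv, fun h6 => hyw (h5.trans h6)⟩ hγw _ (h.vert_coords y w) (by simpa using h5)
  · rw [h.dirPt_eq_of_notMem hwvs] at hyw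
    have h4 := h.coords_coherent y hws hyw
    have hsw : s ∈ (𝒢.tree S).geodesicSegment v w := by
      by_contra hsw
      exact hUs y hy (h4.trans (h.dirPt_eq_of_notMem hsw).symm)
    rw [← h.smul_mem_geodesicSegment_iff (γ n), hv, hγw] at hsw
    have h5 : γ n • 𝒳.coords S y s = 𝒳.dirPt S (γ n • s) t := by
      rw [h4, ← h.dirPt_smul _ (Ne.symm hws), hγw]
    -- If the directions agree, pulling back by `γ n` makes the coordinate of `y` at `s` point to
    -- `v`; if not, the edge collapse keeps its image away from the direction of `t`. Both are
    -- contradictions.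
    by_cases h6 : 𝒳.dirPt S (γ n • s) t = 𝒳.dirPt S (γ n • s) v
    · refine absurd ?_ (hUs y hy)
      rw [h6] at h5
      have h7 := h.dirPt_smul (γ n) hs
      rw [hv] at h7
      exact MulAction.injective (γ n) (h5.trans h7)
    · exact absurd h5 (h3 _ ⟨hsw, h6⟩ rfl _ (h.vert_coords y s) hy)

theorem isConvergenceGroupOn [T2Space (𝒳.Omega S)] [SecondCountableTopology (𝒳.Omega S)]
    [Countable (𝒢.TreeVertex S)] : IsConvergenceGroupOn (𝒢.π₁ S) (𝒳.M S) := by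
  have h := hp.isTreeOfSpaces
  have hf := fun c => isCompact_fibre (𝒳 := 𝒳) (S := S) hp.convergence c
  have hcomp := h.compactSpace_M hf
  have hmet := h.metrizableSpace_M hf
  refine ⟨hcomp, hmet, h.continuous_smul_M, fun γ hγ => ?_⟩
  suffices hcol : ∃ σ : ℕ → ℕ, StrictMono σ ∧ ∃ ξ η : 𝒳.M S, Collapses (fun n => γ (σ n)) ξ η by
    obtain ⟨σ, hσ, ξ, η, hcol⟩ := hcol
    exact ⟨σ, hσ, ξ, η, Collapses.iff_isCompact.1 hcol⟩
  by_cases hfar : ∀ v w : 𝒢.TreeVertex S, ∀ᶠ n in atTop, γ n • v ≠ w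
  · exact h.exists_collapses_of_far hfar
  push Not at hfar
  obtain ⟨v, w, hvw⟩ := hfar
  obtain ⟨σ, hσ, hσw⟩ := extraction_of_frequently_atTop hvw
  -- Right multiplication by a fixed element moves the sequence into the stabilizer of `w`; it only
  -- translates the repelling point.
  have hinj : Function.Injective fun n => γ (σ n) * (γ (σ 0))⁻¹ := fun m n hmn =>
    hσ.injective (hγ (mul_right_cancel hmn))
  have hw : ∀ n, (γ (σ n) * (γ (σ 0))⁻¹) • w = w := fun n => by
    rw [mul_smul, inv_smul_eq_iff.2 (hσw 0).symm, hσw]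
  obtain ⟨τ, hτ, a, ha, b, hb, hcol⟩ := hp.exists_collapsesFibre hinj hw
  have hcol' := hp.collapses_of_collapsesFibre (hinj.comp hτ.injective) (fun n => hw (τ n))
    ha hb hcol
  refine ⟨σ ∘ τ, hσ.comp hτ, 𝒳.ofPt S (𝒳.toQuot S a),
    (γ (σ 0))⁻¹ • 𝒳.ofPt S (𝒳.toQuot S b), fun U hU N hN => ?_⟩
  filter_upwards [hcol' U hU _
    ((h.continuous_smul_M (γ (σ 0))⁻¹).continuousAt.preimage_mem_nhds hN)] with n hn x hx
  have := hn (γ (σ 0) • x) (by simpa using hx)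
  simpa [mul_smul] using this

/-- In coordinates this map is the inclusion at the vertex of `v` and constant at all other
vertices; compactness does the rest. -/
theorem isEmbedding_vertexMap [T2Space (𝒳.Omega S)] (v : V) : IsEmbedding (𝒳.vertexMap S v) := by
  have h := hp.isTreeOfSpaces
  have := (hp.convergence v).compact
  have := h.isEmbedding_coords.t2Space
  have hcoords : ∀ x t, 𝒳.coords S (𝒳.vertexMap S v x) t = 𝒳.coordPt S (𝒳.pt S v 1 x) t :=
    fun x t => congrFun ((h.coords_ofPt _).trans (h.coord_toQuot _)) t
  have hcont : Continuous (𝒳.vertexMap S v) := by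
    rw [h.isEmbedding_coords.continuous_iff]
    refine continuous_pi fun t => ?_
    simp only [Function.comp_apply, hcoords]
    by_cases ht : t = 𝒢.coset S v 1
    · subst ht
      exact (continuous_pt v 1).congr fun x => (coordPt_vert (𝒳.pt S v 1 x)).symm
    · refine (continuous_const (y := 𝒳.dirPt S t (𝒢.coset S v 1))).congr fun x => ?_
      exact (coordPt_of_ne (x := 𝒳.pt S v 1 x) ht).symm
  refine (hcont.isClosedEmbedding fun x y hxy => ?_).isEmbedding
  have h1 := hcoords x (𝒢.coset S v 1)
  rw [hxy, hcoords] at h1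
  exact (hp.isOpenEmbedding_pt v 1).injective ((coordPt_vert (𝒳.pt S v 1 x)).symm.trans
    (h1.symm.trans (coordPt_vert (𝒳.pt S v 1 y))))

end IsParabolicSplitting

end VertexSpaces

end GraphOfGroups

/-! ### The degenerate case of empty vertex spaces, and the conclusion -/

namespace GraphOfGroups

variable {V E : Type*} {𝒢 : GraphOfGroups V E} {S : Set E}

theorem isEmpty_boundary [IsEmpty E] : IsEmpty (𝒢.Boundary S) := by
  refine ⟨fun ξ => ?_⟩
  induction ξ using Quotient.inductionOn with
  | h r =>
    have h1 : (𝒢.tree S).Adj (r.1 0) (r.1 1) := r.2.1 0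
    rcases ((SimpleGraph.fromRel_adj _ _ _).1 h1).2 with ⟨e, -⟩ | ⟨e, -⟩ <;> exact isEmptyElim e

theorem exists_ι_range_eq_top [IsEmpty E] (hS : 𝒢.Connects S) (v : V) :
    (𝒢.ι S v).range = ⊤ := by
  have h : ∀ w, w = v := fun w => by
    induction hS w v with
    | rel a b h => exact isEmptyElim h.choose
    | refl => rfl
    | symm _ _ _ ih => exact ih.symm
    | trans _ _ _ _ _ ih ih' => exact ih.trans ih'
  refine 𝒢.eq_top_of_generators S _ (fun w g => ?_) fun e => isEmptyElim e
  obtain rfl := h w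
  exact ⟨g, rfl⟩

namespace VertexSpaces

variable {𝒳 : VertexSpaces 𝒢}

theorem isEmpty_edges_of_isEmpty_omega [h : IsEmpty (𝒳.Omega S)] : IsEmpty E :=
  ⟨fun e => h.false (𝒳.pt S _ 1 (𝒳.srcPt e))⟩

theorem isEmpty_M [h : IsEmpty (𝒳.Omega S)] : IsEmpty (𝒳.M S) := by
  have := isEmpty_edges_of_isEmpty_omega (h := h)
  refine ⟨?_⟩
  rintro ⟨ξ | x⟩
  · exact isEmpty_boundary.false ξ
  · induction x using Quot.ind with
    | mk x => exact h.false x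

/-- Every edge supplies a point, so there are no edges and at most one vertex. The fundamental group
is then trivial or the image of one vertex group, which has no sequence of distinct elements since
the convergence property on its empty space would produce a point. -/
theorem isConvergenceGroupOn_of_isEmpty [h : IsEmpty (𝒳.Omega S)] (hS : 𝒢.Connects S)
    (hconv : ∀ v, IsConvergenceGroupOn (𝒢.G v) (𝒳.X v)) :
    IsConvergenceGroupOn (𝒢.π₁ S) (𝒳.M S) := by
  have hE := isEmpty_edges_of_isEmpty_omega (h := h)
  have hM := isEmpty_M (h := h)
  have : DiscreteTopology (𝒳.M S) := Subsingleton.discreteTopology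
  refine ⟨inferInstance, inferInstance, fun g => continuous_of_discreteTopology, fun γ hγ => ?_⟩
  exfalso
  rcases isEmpty_or_nonempty V with hV | ⟨⟨v⟩⟩
  · have h1 := 𝒢.eq_top_of_generators S ⊥ (fun v => isEmptyElim v) fun e => isEmptyElim e
    have h2 : ∀ g : 𝒢.π₁ S, g = 1 := fun g => Subgroup.mem_bot.1 (h1 ▸ Subgroup.mem_top g)
    exact zero_ne_one (hγ ((h2 (γ 0)).trans (h2 (γ 1)).symm))
  · have h1 : ∀ n, ∃ a, 𝒢.ι S v a = γ n := fun n => by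
      rw [← MonoidHom.mem_range, exists_ι_range_eq_top hS]
      exact Subgroup.mem_top _
    choose a ha using h1
    have hinj : Function.Injective a := fun m n hmn => hγ (by rw [← ha, ← ha, hmn])
    obtain ⟨-, -, ξ, -⟩ := (hconv v).convergence a hinj
    exact h.false (𝒳.pt S v 1 ξ)

end VertexSpaces

end GraphOfGroups

theorem theorem1p2 {V E : Type*} [Finite V] [Finite E] (𝒢 : GraphOfGroups V E)
    (S : Set E) (hS : 𝒢.IsMaximalTree S)
    [∀ v, Countable (𝒢.G v)]
    (𝒳 : GraphOfGroups.VertexSpaces 𝒢)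
    (hconv : ∀ v, IsConvergenceGroupOn (𝒢.G v) (𝒳.X v))
    (hsrc : ∀ e, IsParabolicAt (𝒢.φ e).range (𝒳.srcPt e))
    (htgt : ∀ e, IsParabolicAt (𝒢.ψ e).range (𝒳.tgtPt e)) :
    IsConvergenceGroupOn (𝒢.π₁ S) (𝒳.M S) ∧
      ∀ v, Topology.IsEmbedding (𝒳.vertexMap S v) := by
  rcases isEmpty_or_nonempty (𝒳.Omega S) with h | h
  · refine ⟨GraphOfGroups.VertexSpaces.isConvergenceGroupOn_of_isEmpty hS.prop hconv, fun v => ?_⟩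
    have hX : IsEmpty (𝒳.X v) := ⟨fun x => h.false (𝒳.pt S v 1 x)⟩
    exact .of_subsingleton _
  · have hp : 𝒳.IsParabolicSplitting S := ⟨hS, fun v => hS.ι_injective v, hconv, hsrc, htgt⟩
    have : Countable (𝒢.TreeVertex S) := by
      have : ∀ v, Countable (𝒢.π₁ S ⧸ (𝒢.ι S v).range) := fun v =>
        QuotientGroup.mk_surjective.countable
      infer_instance
    have := GraphOfGroups.VertexSpaces.t2Space_omega (S := S) hp.ι_injective hconv
    have := GraphOfGroups.VertexSpaces.secondCountable_omega (S := S) hp.ι_injective hconv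
    exact ⟨hp.isConvergenceGroupOn, hp.isEmbedding_vertexMap⟩
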